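/- Throughout, a digraph is a non-empty vertex set with an irreflexive, asymmetric edge relation; it is connected if its underlying undirected graph is, and its ends are the equivalence classes of rays of the underlying undirected graph, where two rays are equivalent if for every finite vertex set $S$ both lie eventually in the same component of the graph minus $S$. It is C-homogeneous if every isomorphism between two finite connected induced subdigraphs extends to an automorphism. An alternating walk is a sequence $x_0x_1\dots x_n$ of vertices, consecutive ones adjacent, such that $x_{i-1}\in N^+(x_i)\Leftrightarrow x_{i+1}\in N^+(x_i)$ for all $1\le i\le n-1$. Two edges are reachable from each other if they lie on a common alternating walk; the reachability digraph of an edge $e$ consists of all edges reachable from $e$ and the vertices incident with them. In a C-homogeneous digraph $D$ all reachability digraphs are isomorphic, and $\Delta(D)$ denotes this digraph. It is a bipartite reachability digraph if it has a bipartition in which the vertices of one class have no in-neighbours and those of the other class have no out-neighbours in $\Delta(D)$. Notation: $C_3$ is the directed triangle; $\bar K_k$ is the edgeless digraph on $k$ vertices; $C_3[\bar K_k]$ is the lexicographic product, obtained from $C_3$ by replacing each vertex by $k$ independent vertices. $K_{k,k}$ is the complete bipartite digraph with classes of size $k$ and all edges directed from one class to the other; $CP_k$ is obtained from $K_{k,k}$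 by deleting a perfect matching. $Y_k$ has vertex set $\mathbb Z/3\times\{1,\dots,k\}$ and edges $(i,a)\to(i+1,b)$ for $a\ne b$. $C_{2m}$, as a reachability digraph, is the undirected cycle of length $2m$, and $T_{2,2}$ is the two-way infinite undirected path, each with all edges directed from one class of its bipartition to the other. **Lemma.** Let $D$ be a locally finite connected C-homogeneous digraph that contains an isomorphic copy of $C_3$ and such that $N^+(x)$ and $N^-(x)$ are independent sets for every vertex $x$. If $\Delta(D)$ is a bipartite reachability digraph, then one of the following holds. (i) $D$ has at least two ends. (ii) $\Delta(D)\cong K_{k,k}$ and $D\cong C_3[\bar K_k]$ for some $k\ge 1$. (iii) $\Delta(D)\cong CP_k$ and $D\cong Y_k$ for some $k\ge 3$. (iv) $\Delta(D)\cong C_{2m}$ for some $m\ge 2$, or $\Delta(D)\cong T_{2,2}$. -/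

import Mathlib

/-- A one-way infinite path in an undirected graph. -/
structure GraphRay {V : Type*} (G : SimpleGraph V) where
  vert : ℕ → V
  inj : Function.Injective vert
  adj : ∀ n, G.Adj (vert n) (vert (n + 1))

/-- The ray `r` lies eventually in the component `C` of `G - S`. -/
def GraphRay.EventuallyIn {V : Type*} {G : SimpleGraph V} (r : GraphRay G) (S : Set V)
    (C : (G.induce Sᶜ).ConnectedComponent) : Prop :=
  ∃ N : ℕ, ∀ n, N ≤ n → ∃ h : r.vert n ∈ Sᶜ,
    (G.induce Sᶜ).connectedComponentMk ⟨r.vert n, h⟩ = C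

/-- Two rays are equivalent if, for every finite vertex set `S`, both lie eventually in the same
component of `G - S`. -/
def GraphRay.Equivalent {V : Type*} {G : SimpleGraph V} (r s : GraphRay G) : Prop :=
  ∀ S : Set V, S.Finite → ∃ C : (G.induce Sᶜ).ConnectedComponent,
    r.EventuallyIn S C ∧ s.EventuallyIn S C

theorem GraphRay.equivalent_refl {V : Type*} {G : SimpleGraph V} (r : GraphRay G) :
    r.Equivalent r := by
  intro S hS
  have hfin : (r.vert ⁻¹' S).Finite := hS.preimage r.inj.injOn
  obtain ⟨B, hB⟩ := hfin.bddAbove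
  have hout : ∀ n, B + 1 ≤ n → r.vert n ∈ Sᶜ := by
    intro n hn hmem
    have := hB (show n ∈ r.vert ⁻¹' S from hmem)
    omega
  refine ⟨(G.induce Sᶜ).connectedComponentMk ⟨r.vert (B + 1), hout _ le_rfl⟩, ?_⟩
  have key : r.EventuallyIn S
      ((G.induce Sᶜ).connectedComponentMk ⟨r.vert (B + 1), hout _ le_rfl⟩) := by
    refine ⟨B + 1, fun n hn => ⟨hout n hn, ?_⟩⟩
    induction n, hn using Nat.le_induction with
    | base => rfl
    | succ n hn ih =>
      rw [← ih]
      apply SimpleGraph.ConnectedComponent.sound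
      apply SimpleGraph.Adj.reachable
      exact (r.adj n).symm
  exact ⟨key, key⟩

theorem GraphRay.equivalent_trans {V : Type*} {G : SimpleGraph V} {r s t : GraphRay G}
    (h₁ : r.Equivalent s) (h₂ : s.Equivalent t) : r.Equivalent t := by
  intro S hS
  obtain ⟨C, hr, N, hs⟩ := h₁ S hS
  obtain ⟨C', ⟨M, hs'⟩, ht⟩ := h₂ S hS
  obtain ⟨_, e₁⟩ := hs (max N M) (le_max_left _ _)
  obtain ⟨_, e₂⟩ := hs' (max N M) (le_max_right _ _)
  have : C = C' := e₁.symm.trans e₂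
  subst this
  exact ⟨C, hr, ht⟩

instance GraphRay.setoid {V : Type*} (G : SimpleGraph V) : Setoid (GraphRay G) where
  r := GraphRay.Equivalent
  iseqv :=
    { refl := GraphRay.equivalent_refl
      symm := fun h S hS => (h S hS).imp fun _ hC => hC.symm
      trans := GraphRay.equivalent_trans }

/-- The ends of an undirected graph: equivalence classes of rays. -/
def GraphEnds {V : Type*} (G : SimpleGraph V) : Type _ := Quotient (GraphRay.setoid G)

namespace Digraph

/-- The edge relation is asymmetric; in particular there are no loops. -/
def IsAsymmetric {V : Type*} (D : Digraph V) : Prop :=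
  ∀ x y, D.Adj x y → ¬ D.Adj y x

/-- The out-neighbourhood of a vertex. -/
def outNbhd {V : Type*} (D : Digraph V) (x : V) : Set V := {y | D.Adj x y}

/-- The in-neighbourhood of a vertex. -/
def inNbhd {V : Type*} (D : Digraph V) (x : V) : Set V := {y | D.Adj y x}

/-- No two vertices of `S` are adjacent. -/
def IsIndependent {V : Type*} (D : Digraph V) (S : Set V) : Prop :=
  ∀ x ∈ S, ∀ y ∈ S, ¬ D.Adj x y

/-- Every vertex has finite degree. -/
def IsLocallyFinite {V : Type*} (D : Digraph V) : Prop :=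
  ∀ x, (D.outNbhd x).Finite ∧ (D.inNbhd x).Finite

/-- The underlying undirected graph is connected. -/
def IsConnected {V : Type*} (D : Digraph V) : Prop := D.toSimpleGraphInclusive.Connected

/-- The digraph has at least two ends (ends of its underlying undirected graph). -/
def HasAtLeastTwoEnds {V : Type*} (D : Digraph V) : Prop :=
  Nontrivial (GraphEnds D.toSimpleGraphInclusive)

/-- The subdigraph induced by a vertex set. -/
def inducedOn {V : Type*} (D : Digraph V) (S : Set V) : Digraph S where
  Adj x y := D.Adj x y

/-- Isomorphism of digraphs. -/
def IsIsomorphic {V W : Type*} (D : Digraph V) (D' : Digraph W) : Prop :=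
  Nonempty (D.Adj ≃r D'.Adj)

/-- `D` is C-homogeneous: every isomorphism between two finite connected induced subdigraphs
extends to an automorphism of `D`. -/
def IsCHomogeneous {V : Type*} (D : Digraph V) : Prop :=
  ∀ A B : Set V, A.Finite → B.Finite → (D.inducedOn A).IsConnected → (D.inducedOn B).IsConnected →
    ∀ φ : (D.inducedOn A).Adj ≃r (D.inducedOn B).Adj,
      ∃ α : D.Adj ≃r D.Adj, ∀ a : A, α a = φ a

/-- `x 0, …, x n` is an alternating walk. -/
def IsAlternatingWalk {V : Type*} (D : Digraph V) (n : ℕ) (x : ℕ → V) : Prop :=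
  (∀ i < n, D.Adj (x i) (x (i + 1)) ∨ D.Adj (x (i + 1)) (x i)) ∧
  (∀ i, i + 1 < n → (x i ∈ D.outNbhd (x (i + 1)) ↔ x (i + 2) ∈ D.outNbhd (x (i + 1))))

/-- The edge `e` lies on the walk `x 0, …, x n`. -/
def EdgeOnWalk {V : Type*} (D : Digraph V) (n : ℕ) (x : ℕ → V) (e : V × V) : Prop :=
  D.Adj e.1 e.2 ∧ ∃ i < n, (x i = e.1 ∧ x (i + 1) = e.2) ∨ (x i = e.2 ∧ x (i + 1) = e.1)

/-- The reachability class of the edge `e`: all edges that lie on a common alternating walk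
with `e`. -/
def reachClass {V : Type*} (D : Digraph V) (e : V × V) : Set (V × V) :=
  {f | ∃ (n : ℕ) (x : ℕ → V), D.IsAlternatingWalk n x ∧ D.EdgeOnWalk n x e ∧ D.EdgeOnWalk n x f}

/-- The reachability digraph containing `e`: its edges are the edges in the reachability class
of `e`, and its vertices are the vertices incident with these edges. -/
def reachDigraph {V : Type*} (D : Digraph V) (e : V × V) :
    Digraph {v : V // ∃ f ∈ D.reachClass e, v = f.1 ∨ v = f.2} where
  Adj u v := ((u : V), (v : V)) ∈ D.reachClass e

/-- The digraph is bipartite with a bipartition in which the vertices of one class `X` have empty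
in-neighbourhood and those of the other class have empty out-neighbourhood. -/
def IsDirectedBipartite {W : Type*} (B : Digraph W) : Prop :=
  ∃ X : Set W, B.IsIndependent X ∧ B.IsIndependent Xᶜ ∧
    (∀ x ∈ X, B.inNbhd x = ∅) ∧ (∀ y ∈ Xᶜ, B.outNbhd y = ∅)

/-- `Δ(D)` is bipartite: the reachability digraphs of `D` (which for a 1-arc transitive `D` are
all isomorphic to each other) are bipartite reachability digraphs. -/
def HasBipartiteReachDigraph {V : Type*} (D : Digraph V) : Prop :=
  ∀ x y, D.Adj x y → (D.reachDigraph (x, y)).IsDirectedBipartite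

/-- `Δ(D) ≅ F`: the reachability digraphs of `D` (which for a 1-arc transitive `D` are
all isomorphic to each other) are isomorphic to `F`. -/
def ReachDigraphIso {V W : Type*} (D : Digraph V) (F : Digraph W) : Prop :=
  ∀ x y, D.Adj x y → (D.reachDigraph (x, y)).IsIsomorphic F

/-- The directed cycle `C_m` (for `m ≥ 3`). -/
def directedCycle (m : ℕ) : Digraph (ZMod m) where
  Adj a b := b = a + 1

/-- The lexicographic product `D[D']`. -/
def lexProduct {V W : Type*} (D : Digraph V) (D' : Digraph W) : Digraph (V × W) where
  Adj p q := D.Adj p.1 q.1 ∨ (p.1 = q.1 ∧ D'.Adj p.2 q.2)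

/-- The complete bipartite digraph `K_{k,l}`, all edges directed from the first class to the
second. -/
def completeBipartiteDigraph (k l : ℕ) : Digraph (Fin k ⊕ Fin l) where
  Adj
    | .inl _, .inr _ => True
    | _, _ => False

/-- The directed complement of a perfect matching `CP_k`: from `K_{k,k}` a perfect matching is
removed. -/
def complementPerfectMatching (k : ℕ) : Digraph (Fin k ⊕ Fin k) where
  Adj
    | .inl a, .inr b => a ≠ b
    | _, _ => False

/-- The cycle `C_{2m}` (`m ≥ 2`) as a bipartite reachability digraph: the cyclically ordered
vertices `0, 1, …, 2m - 1`, consecutive ones being joined by an edge directed from the even one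
to the odd one. -/
def alternatingCycle (m : ℕ) : Digraph (ZMod (2 * m)) where
  Adj a b := Even a ∧ (b = a + 1 ∨ a = b + 1)

/-- The semiregular tree `T_{2,2}`, that is the two-way infinite path, as a bipartite
reachability digraph: consecutive integers are joined by an edge directed from the even one to
the odd one. -/
def alternatingDoubleRay : Digraph ℤ where
  Adj a b := Even a ∧ (b = a + 1 ∨ a = b + 1)

/-- The digraph `Y_k`: three classes `V_i = {i} × Fin k` (`i` modulo 3), with an edge from `(i, a)`
to `(i + 1, b)` whenever `a ≠ b`. The missing edges `(i, a) → (i + 1, a)`, which form the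
tripartite complement, make up `k` disjoint directed triangles. -/
def tripartiteY (k : ℕ) : Digraph (ZMod 3 × Fin k) where
  Adj p q := q.1 = p.1 + 1 ∧ p.2 ≠ q.2

end Digraph

/-!
Let `k` be the common in- and outdegree of `D`, and let `t` be the number of directed triangles on
an edge; both are well defined because `D` is C-homogeneous, and neighbourhoods are independent.
Exchanging in-neighbours of a vertex `x` by automorphisms shows that the edges from `N⁺(x)` to
`N⁻(x)` form a homogeneous bipartite graph, so they are a perfect matching, the complement of one,
or all pairs: `t = 1`, `t = k - 1` or `t = k` (`IsTriangular.triangle_number`).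

* If `t = k`, the vertices split into three classes that follow each other completely, and `D` is
  `C₃[K̄ₖ]` (`IsTriangular.lexProduct_iso`).
* If `k = 2`, the edges of a reachability digraph are met by one alternating walk that extends
  indefinitely in both directions; it is injective or periodic, which gives a double ray or a cycle
  (`reachDigraphIso_of_two_regular`).
* If `t = k - 1 ≥ 2`, every `y ∈ N⁺(x)` has one out-neighbour outside `N⁻(x)`, and this vertex does
  not depend on `y` (`IsTriangular.extra_outNeighbour_agree`). It completes `N⁻(x)` to a class of
  `k + 1` vertices, and `D` is `Yₖ₊₁` (`IsTriangular.tripartiteY_iso`).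
* If `t = 1` and `k ≥ 3`, the underlying undirected graph has no 4-cycles
  (`IsTriangular.isSquareFree`). By induction on the length, a walk that neither turns back nor runs
  along two sides of a triangle never closes up (`IsSquareFree.reduced_ends`): otherwise another
  continuation of the walk would close up as well, by C-homogeneity, and a 4-cycle or a shorter
  closed walk of this kind would result. So triangles are glued together in a tree-like manner,
  deleting a vertex separates the triangles at it, and `D` has at least two ends
  (`IsSquareFree.hasAtLeastTwoEnds`).

The common tool is `IsCHomogeneous.move`: a vertex can be moved to any other one that is attached in
the same way to a finite connected set, while this set stays fixed.
Bipartiteness of `Δ(D)` enters through `IsTriangular.not_head_tail`: edges that are reachable from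
each other have no edges between their ends other than those from a tail to a head.
-/

namespace Digraph

/-! ### Connected vertex sets and extension of partial isomorphisms -/

section Extension

variable {V : Type*} {D : Digraph V}

/-- Adjacency in the underlying undirected graph of an asymmetric digraph. -/
def Link (D : Digraph V) (a b : V) : Prop := D.Adj a b ∨ D.Adj b a

theorem Link.symm {a b : V} (h : D.Link a b) : D.Link b a := Or.symm h

/-- The vertex set `A` induces a connected subdigraph. -/
def ConnSet (D : Digraph V) (A : Set V) : Prop := (D.inducedOn A).IsConnected

theorem connSet_singleton (x : V) : D.ConnSet {x} := by
  have : Unique ({x} : Set V) := Set.uniqueSingleton x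
  exact SimpleGraph.Connected.mk (fun a b => by rw [Subsingleton.elim a b])

theorem ConnSet.union {A B : Set V} (hA : D.ConnSet A)
    (hB : ∀ b ∈ B, ∃ a ∈ A, D.Link a b) : D.ConnSet (A ∪ B) := by
  obtain ⟨⟨a₀, ha₀⟩⟩ := hA.nonempty
  let ι : (D.inducedOn A).toSimpleGraphInclusive →g
      (D.inducedOn (A ∪ B)).toSimpleGraphInclusive :=
    { toFun := fun a => ⟨a.1, Or.inl a.2⟩
      map_rel' := by
        rintro a b ⟨hne, h⟩
        exact ⟨fun e => hne (Subtype.ext (congrArg (fun z => z.1) e)), h⟩ }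
  have key : ∀ a (ha : a ∈ A), (D.inducedOn (A ∪ B)).toSimpleGraphInclusive.Reachable
      ⟨a₀, Or.inl ha₀⟩ ⟨a, Or.inl ha⟩ := fun a ha =>
    (hA.preconnected ⟨a₀, ha₀⟩ ⟨a, ha⟩).map ι
  refine (SimpleGraph.connected_iff_exists_forall_reachable _).2 ⟨⟨a₀, Or.inl ha₀⟩, ?_⟩
  rintro ⟨w, hw | hw⟩
  · exact key w hw
  · by_cases hwA : w ∈ A
    · exact key w hwA
    · obtain ⟨a, ha, hl⟩ := hB w hw
      refine (key a ha).trans (SimpleGraph.Adj.reachable ⟨?_, hl⟩)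
      intro e
      exact hwA ((congrArg (fun z => z.1) e : a = w) ▸ ha)

theorem ConnSet.insert {A : Set V} (hA : D.ConnSet A) {a b : V} (ha : a ∈ A)
    (hl : D.Link a b) : D.ConnSet (insert b A) := by
  rw [Set.insert_eq, Set.union_comm]
  exact hA.union (by rintro _ rfl; exact ⟨a, ha, hl⟩)

theorem connSet_pair {a b : V} (hl : D.Link a b) : D.ConnSet {b, a} :=
  (connSet_singleton a).insert (Set.mem_singleton a) hl

/-- C-homogeneity for a partial isomorphism given as the restriction of a map. -/
theorem IsCHomogeneous.extend (hom : D.IsCHomogeneous) {A : Set V} (hfin : A.Finite)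
    (hA : D.ConnSet A) (φ : V → V) (inj : Set.InjOn φ A)
    (hφ : ∀ a ∈ A, ∀ b ∈ A, (D.Adj (φ a) (φ b) ↔ D.Adj a b)) :
    ∃ α : D.Adj ≃r D.Adj, ∀ a ∈ A, α a = φ a := by
  let e : A ≃ (φ '' A) := Equiv.Set.imageOfInjOn φ A inj
  let ψ : (D.inducedOn A).Adj ≃r (D.inducedOn (φ '' A)).Adj :=
    { toEquiv := e
      map_rel_iff' := by
        rintro ⟨a, ha⟩ ⟨b, hb⟩
        exact hφ a ha b hb }
  let ψ' : (D.inducedOn A).toSimpleGraphInclusive ≃g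
      (D.inducedOn (φ '' A)).toSimpleGraphInclusive :=
    { toEquiv := e
      map_rel_iff' := by
        intro a b
        exact and_congr e.injective.ne_iff (or_congr ψ.map_rel_iff ψ.map_rel_iff) }
  obtain ⟨α, hα⟩ := hom A (φ '' A) hfin (hfin.image φ) hA (ψ'.connected_iff.1 hA) ψ
  exact ⟨α, fun a ha => hα ⟨a, ha⟩⟩

/-- If `u` and `v` are attached in the same way to a finite connected set `A`, some automorphism
fixes `A` pointwise and maps `u` to `v`. If `A` determines another vertex that is adjacent to just
one of `u` and `v`, this is a contradiction; several cases are excluded in this way. -/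
theorem IsCHomogeneous.move (hom : D.IsCHomogeneous) (asymm : D.IsAsymmetric) {A : Set V}
    (hfin : A.Finite) (hA : D.ConnSet A) {u v : V} (hu : u ∉ A) (hv : v ∉ A)
    (hl : ∃ a ∈ A, D.Link a u)
    (h : ∀ a ∈ A, (D.Adj a u ↔ D.Adj a v) ∧ (D.Adj u a ↔ D.Adj v a)) :
    ∃ α : D.Adj ≃r D.Adj, (∀ a ∈ A, α a = a) ∧ α u = v := by
  classical
  have hne : ∀ a ∈ A, a ≠ u := fun a ha e => hu (e ▸ ha)
  have hnv : ∀ a ∈ A, a ≠ v := fun a ha e => hv (e ▸ ha)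
  have irr : ∀ a, ¬ D.Adj a a := fun a ha => asymm a a ha ha
  obtain ⟨a₀, ha₀, hl⟩ := hl
  obtain ⟨α, hα⟩ := hom.extend (hfin.insert u) (hA.insert ha₀ hl)
    (fun w => if w = u then v else w)
    (by
      rintro a (rfl | ha) b (rfl | hb) hab
      · rfl
      · simp only [if_true, if_neg (hne b hb)] at hab
        exact absurd hab.symm (hnv b hb)
      · simp only [if_true, if_neg (hne a ha)] at hab
        exact absurd hab (hnv a ha)
      · simpa only [if_neg (hne a ha), if_neg (hne b hb)] using hab)
    (by
      rintro a (rfl | ha) b (rfl | hb)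
      · simp [irr]
      · simp only [if_true, if_neg (hne b hb)]
        exact (h b hb).2.symm
      · simp only [if_true, if_neg (hne a ha)]
        exact (h a ha).1.symm
      · simp only [if_neg (hne a ha), if_neg (hne b hb)])
  refine ⟨α, fun a ha => ?_, ?_⟩
  · rw [hα a (Or.inr ha), if_neg (hne a ha)]
  · rw [hα u (Or.inl rfl), if_pos rfl]

end Extension

/-! ### The reachability relation on edges -/

section Reachability

variable {V : Type*} {D : Digraph V}

/-- The edge `a → b` arises from the edge `x → y` by repeatedly passing to an edge with the same
tail or the same head. -/
inductive Reach (D : Digraph V) (x y : V) : V → V → Prop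
  | refl : Reach D x y x y
  | tail {a b b' : V} : Reach D x y a b → D.Adj a b' → Reach D x y a b'
  | head {a b a' : V} : Reach D x y a b → D.Adj a' b → Reach D x y a' b

theorem Reach.adj {x y a b : V} (h : D.Reach x y a b) (hxy : D.Adj x y) : D.Adj a b := by
  cases h <;> assumption

theorem Reach.trans {x y a b c d : V} (h : D.Reach x y a b) (h' : D.Reach a b c d) :
    D.Reach x y c d := by
  induction h' with
  | refl => exact h
  | tail _ hb ih => exact ih.tail hb
  | head _ hb ih => exact ih.head hb

theorem Reach.symm {x y a b : V} (h : D.Reach x y a b) (hxy : D.Adj x y) :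
    D.Reach a b x y := by
  induction h with
  | refl => exact Reach.refl
  | tail h' hb ih => exact (Reach.refl.tail (h'.adj hxy)).trans ih
  | head h' hb ih => exact (Reach.refl.head (h'.adj hxy)).trans ih

theorem Reach.map {W : Type*} {D' : Digraph W} (α : D.Adj ≃r D'.Adj) {x y a b : V}
    (h : D.Reach x y a b) : D'.Reach (α x) (α y) (α a) (α b) := by
  induction h with
  | refl => exact Reach.refl
  | tail h' hb ih => exact ih.tail (α.map_rel_iff.2 hb)
  | head h' hb ih => exact ih.head (α.map_rel_iff.2 hb)

theorem IsAlternatingWalk.snoc {n : ℕ} {w : ℕ → V} (hw : D.IsAlternatingWalk (n + 1) w) {c : V}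
    (h₁ : D.Adj (w (n + 1)) c ∨ D.Adj c (w (n + 1)))
    (h₂ : D.Adj (w (n + 1)) (w n) ↔ D.Adj (w (n + 1)) c) :
    D.IsAlternatingWalk (n + 2) (fun i => if i ≤ n + 1 then w i else c) := by
  refine ⟨fun i hi => ?_, fun i hi => ?_⟩
  · rcases Nat.lt_succ_iff_lt_or_eq.1 hi with hi | rfl
    · have h1 : i ≤ n + 1 := by omega
      have h2 : i + 1 ≤ n + 1 := by omega
      simp only [h1, h2, if_true]
      exact hw.1 i hi
    · simpa using h₁
  · have h1 : i ≤ n + 1 := by omega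
    have h2 : i + 1 ≤ n + 1 := by omega
    by_cases h3 : i + 2 ≤ n + 1
    · simp only [h1, h2, h3, if_true]
      exact hw.2 i (by omega)
    · obtain rfl : i = n := by omega
      simpa [outNbhd] using h₂

theorem EdgeOnWalk.snoc {n : ℕ} {w : ℕ → V} {e : V × V} (h : D.EdgeOnWalk (n + 1) w e) (c : V) :
    D.EdgeOnWalk (n + 2) (fun i => if i ≤ n + 1 then w i else c) e := by
  obtain ⟨ha, i, hi, h⟩ := h
  have h1 : i ≤ n + 1 := by omega
  have h2 : i + 1 ≤ n + 1 := by omega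
  exact ⟨ha, i, by omega, by simpa only [h1, h2, if_true] using h⟩

theorem Reach.exists_walk (asymm : D.IsAsymmetric) {x y a b : V} (hxy : D.Adj x y)
    (h : D.Reach x y a b) :
    (∃ n w, D.IsAlternatingWalk (n + 1) w ∧ D.EdgeOnWalk (n + 1) w (x, y) ∧
      w n = a ∧ w (n + 1) = b) ∧
    (∃ n w, D.IsAlternatingWalk (n + 1) w ∧ D.EdgeOnWalk (n + 1) w (x, y) ∧
      w n = b ∧ w (n + 1) = a) := by
  -- A walk that ends with an edge may traverse that edge once more, in the other direction.
  have toTail : ∀ {a b b' : V}, D.Adj a b → D.Adj a b' →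
      (∃ n w, D.IsAlternatingWalk (n + 1) w ∧ D.EdgeOnWalk (n + 1) w (x, y) ∧
        w n = b ∧ w (n + 1) = a) →
      (∃ n w, D.IsAlternatingWalk (n + 1) w ∧ D.EdgeOnWalk (n + 1) w (x, y) ∧
        w n = a ∧ w (n + 1) = b') := by
    rintro a b b' hab hab' ⟨n, w, hw, he, rfl, rfl⟩
    exact ⟨n + 1, _, hw.snoc (Or.inl hab') (by simp [hab, hab']), he.snoc _, by simp, by simp⟩
  have toHead : ∀ {a a' b : V}, D.Adj a b → D.Adj a' b →
      (∃ n w, D.IsAlternatingWalk (n + 1) w ∧ D.EdgeOnWalk (n + 1) w (x, y) ∧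
        w n = a ∧ w (n + 1) = b) →
      (∃ n w, D.IsAlternatingWalk (n + 1) w ∧ D.EdgeOnWalk (n + 1) w (x, y) ∧
        w n = b ∧ w (n + 1) = a') := by
    rintro a a' b hab hab' ⟨n, w, hw, he, rfl, rfl⟩
    exact ⟨n + 1, _, hw.snoc (Or.inr hab') (by simp [asymm _ _ hab, asymm _ _ hab']),
      he.snoc _, by simp, by simp⟩
  induction h with
  | refl =>
    have h0 : ∃ n w, D.IsAlternatingWalk (n + 1) w ∧ D.EdgeOnWalk (n + 1) w (x, y) ∧
        w n = x ∧ w (n + 1) = y := by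
      refine ⟨0, fun i => if i = 0 then x else y, ⟨fun i hi => ?_, fun i hi => by omega⟩,
        ⟨hxy, 0, by omega, by simp⟩, by simp, by simp⟩
      obtain rfl : i = 0 := by omega
      simpa using Or.inl hxy
    exact ⟨h0, toHead hxy hxy h0⟩
  | tail h' hb ih =>
    have h1 := toTail (h'.adj hxy) hb ih.2
    exact ⟨h1, toHead hb hb h1⟩
  | head h' hb ih =>
    have h1 := toHead (h'.adj hxy) hb ih.1
    exact ⟨toTail hb hb h1, h1⟩

theorem mem_reachClass_iff (asymm : D.IsAsymmetric) {x y a b : V} (hxy : D.Adj x y) :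
    (a, b) ∈ D.reachClass (x, y) ↔ D.Reach x y a b := by
  constructor
  · rintro ⟨n, w, hw, ⟨-, i, hi, hei⟩, ⟨hab, j, hj, hej⟩⟩
    -- `E i a b` : the edge `a → b` is the `i`-th edge of the walk.
    let E : ℕ → V → V → Prop := fun i a b =>
      D.Adj a b ∧ ((w i = a ∧ w (i + 1) = b) ∨ (w i = b ∧ w (i + 1) = a))
    have step : ∀ i a b c d, i + 1 < n → E i a b → E (i + 1) c d → a = c ∨ b = d := by
      rintro i a b c d hi ⟨hab, h⟩ ⟨hcd, h'⟩
      have alt := hw.2 i hi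
      simp only [outNbhd, Set.mem_ofPred_eq] at alt
      have n1 := asymm _ _ hab
      have n2 := asymm _ _ hcd
      rcases h with ⟨rfl, rfl⟩ | ⟨rfl, rfl⟩ <;> rcases h' with ⟨h1, h2⟩ | ⟨h1, h2⟩ <;>
        simp_all
    have ex : ∀ i, i < n → ∃ a b, E i a b := by
      intro i hi
      rcases hw.1 i hi with h | h
      · exact ⟨_, _, h, Or.inl ⟨rfl, rfl⟩⟩
      · exact ⟨_, _, h, Or.inr ⟨rfl, rfl⟩⟩
    have uniq : ∀ i a b c d, E i a b → E i c d → a = c ∧ b = d := by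
      rintro i a b c d ⟨hab, h⟩ ⟨hcd, h'⟩
      have n1 := asymm _ _ hab
      have n2 := asymm _ _ hcd
      rcases h with ⟨rfl, rfl⟩ | ⟨rfl, rfl⟩ <;> rcases h' with ⟨h1, h2⟩ | ⟨h1, h2⟩ <;>
        simp_all
    have main : ∀ i j, i ≤ j → j < n → ∀ a b c d, E i a b → E j c d → D.Reach a b c d := by
      intro i j hij
      induction j, hij using Nat.le_induction with
      | base =>
        intro _ a b c d h h'
        obtain ⟨rfl, rfl⟩ := uniq i a b c d h h'
        exact Reach.refl
      | succ j hij ih =>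
        intro hj a b c d h h'
        obtain ⟨c', d', hc⟩ := ex j (by omega)
        have hr := ih (by omega) a b c' d' h hc
        rcases step j c' d' c d hj hc h' with rfl | rfl
        · exact hr.tail h'.1
        · exact hr.head h'.1
    rcases le_total i j with h | h
    · exact main i j h hj x y a b ⟨hxy, hei⟩ ⟨hab, hej⟩
    · exact (main j i h hi a b x y ⟨hab, hej⟩ ⟨hxy, hei⟩).symm hab
  · intro h
    obtain ⟨⟨n, w, hw, he, ha, hb⟩, -⟩ := h.exists_walk asymm hxy
    exact ⟨n + 1, w, hw, he, h.adj hxy, n, by omega, Or.inl ⟨ha, hb⟩⟩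

/-- In a bipartite reachability digraph no vertex is both a tail and a head. -/
theorem HasBipartiteReachDigraph.not_reach (hbip : D.HasBipartiteReachDigraph)
    (asymm : D.IsAsymmetric) {a b c : V} (hab : D.Adj a b) (h : D.Reach a b c a) : False := by
  obtain ⟨X, -, -, hX, hY⟩ := hbip a b hab
  have m1 : (a, b) ∈ D.reachClass (a, b) := (mem_reachClass_iff asymm hab).2 Reach.refl
  have m2 : (c, a) ∈ D.reachClass (a, b) := (mem_reachClass_iff asymm hab).2 h
  by_cases ha : (⟨a, (a, b), m1, Or.inl rfl⟩ : {v : V // ∃ f ∈ D.reachClass (a, b),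
      v = f.1 ∨ v = f.2}) ∈ X
  · have := hX _ ha
    exact (Set.eq_empty_iff_forall_notMem.1 this ⟨c, (c, a), m2, Or.inl rfl⟩) m2
  · have := hY _ ha
    exact (Set.eq_empty_iff_forall_notMem.1 this ⟨b, (a, b), m1, Or.inr rfl⟩) m1

/-- A description of the edges of the reachability digraph of `x → y` by a labelling of its
vertices yields an isomorphism. -/
theorem reachDigraph_iso (asymm : D.IsAsymmetric) {x y : V} (hxy : D.Adj x y) {W : Type*}
    {F : Digraph W} (p : W → V) (hp : Function.Injective p)
    (hadj : ∀ i j, F.Adj i j ↔ D.Reach x y (p i) (p j))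
    (hsurj : ∀ a b, D.Reach x y a b → (∃ i, p i = a) ∧ ∃ i, p i = b)
    (hinc : ∀ i, ∃ j, F.Adj i j ∨ F.Adj j i) :
    (D.reachDigraph (x, y)).IsIsomorphic F := by
  have mem : ∀ i, ∃ f ∈ D.reachClass (x, y), p i = f.1 ∨ p i = f.2 := by
    intro i
    obtain ⟨j, h | h⟩ := hinc i
    · exact ⟨(p i, p j), (mem_reachClass_iff asymm hxy).2 ((hadj _ _).1 h), Or.inl rfl⟩
    · exact ⟨(p j, p i), (mem_reachClass_iff asymm hxy).2 ((hadj _ _).1 h), Or.inr rfl⟩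
  let q : W → {v : V // ∃ f ∈ D.reachClass (x, y), v = f.1 ∨ v = f.2} := fun i => ⟨p i, mem i⟩
  have hq : Function.Bijective q := by
    refine ⟨fun i j h => hp (congrArg Subtype.val h), ?_⟩
    rintro ⟨v, ⟨a, b⟩, hf, hv⟩
    obtain ⟨⟨i, hi⟩, ⟨j, hj⟩⟩ := hsurj a b ((mem_reachClass_iff asymm hxy).1 hf)
    rcases hv with hv | hv
    · exact ⟨i, Subtype.ext (hi.trans hv.symm)⟩
    · exact ⟨j, Subtype.ext (hj.trans hv.symm)⟩
  refine ⟨RelIso.symm ⟨Equiv.ofBijective q hq, ?_⟩⟩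
  intro i j
  exact (mem_reachClass_iff asymm hxy).trans (hadj i j).symm

/-- The isomorphism type of the reachability digraphs, computed on an isomorphic copy. -/
theorem reachDigraphIso_of_iso (asymm : D.IsAsymmetric) {U W : Type*} {D' : Digraph U}
    (α : D.Adj ≃r D'.Adj) {F : Digraph W}
    (hF : ∀ x y, D'.Adj x y → ∃ p : W → U, Function.Injective p ∧
      (∀ i j, F.Adj i j ↔ D'.Reach x y (p i) (p j)) ∧
      (∀ a b, D'.Reach x y a b → (∃ i, p i = a) ∧ ∃ i, p i = b))
    (hinc : ∀ i, ∃ j, F.Adj i j ∨ F.Adj j i) : D.ReachDigraphIso F := by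
  intro x y hxy
  obtain ⟨p, hp, hadj, hsurj⟩ := hF (α x) (α y) (α.map_rel_iff.2 hxy)
  refine reachDigraph_iso asymm hxy (fun i => α.symm (p i))
    (α.symm.injective.comp hp) (fun i j => (hadj i j).trans ?_) (fun a b h => ?_) hinc
  · constructor
    · intro h
      simpa using h.map α.symm
    · intro h
      simpa using h.map α
  · obtain ⟨⟨i, hi⟩, ⟨j, hj⟩⟩ := hsurj _ _ (h.map α)
    exact ⟨⟨i, by simp [hi]⟩, ⟨j, by simp [hj]⟩⟩

end Reachability


/-! ### Recognising `C₃[K̄ₖ]` and `Yₖ` -/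

section Models

variable {V : Type*} {D : Digraph V}

/-- The out-neighbourhood of a vertex of a locally finite digraph, as a finite set. -/
noncomputable def IsLocallyFinite.outF (h : D.IsLocallyFinite) (x : V) : Finset V :=
  (h x).1.toFinset

/-- The in-neighbourhood of a vertex of a locally finite digraph, as a finite set. -/
noncomputable def IsLocallyFinite.inF (h : D.IsLocallyFinite) (x : V) : Finset V :=
  (h x).2.toFinset

@[simp] theorem IsLocallyFinite.mem_outF (h : D.IsLocallyFinite) {x y : V} :
    y ∈ h.outF x ↔ D.Adj x y := by
  simp [IsLocallyFinite.outF, outNbhd]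

@[simp] theorem IsLocallyFinite.mem_inF (h : D.IsLocallyFinite) {x y : V} :
    y ∈ h.inF x ↔ D.Adj y x := by
  simp [IsLocallyFinite.inF, inNbhd]

theorem IsConnected.mem_of_closed (hconn : D.IsConnected) {S : Set V} {x : V} (hx : x ∈ S)
    (hS : ∀ a ∈ S, ∀ b, D.Link a b → b ∈ S) (v : V) : v ∈ S := by
  obtain ⟨w⟩ := hconn.preconnected x v
  induction w with
  | nil => exact hx
  | cons hadj _ ih => exact ih (hS _ hx _ hadj.2)

open scoped Classical in
/-- If all edges into `B` come from the equally large set `A`, then, in a digraph all of whose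
in- and outdegrees agree, all edges out of `A` lead to `B`. -/
theorem out_closed_of_in_closed (h : D.IsLocallyFinite) {k : ℕ}
    (hk : ∀ x, (h.outF x).card = k ∧ (h.inF x).card = k) {A B : Finset V}
    (hAB : A.card = B.card) (hin : ∀ b ∈ B, ∀ u, D.Adj u b → u ∈ A) :
    ∀ a ∈ A, ∀ v, D.Adj a v → v ∈ B := by
  have hcount := Finset.sum_card_bipartiteAbove_eq_sum_card_bipartiteBelow
    (s := A) (t := B) D.Adj
  have hB : ∑ b ∈ B, (Finset.bipartiteBelow D.Adj A b).card = B.card * k := by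
    rw [Finset.sum_const_nat]
    intro b hb
    rw [← (hk b).2]
    congr 1
    ext u
    simp only [Finset.mem_bipartiteBelow, h.mem_inF]
    exact ⟨fun hu => hu.2, fun hu => ⟨hin b hb u hu, hu⟩⟩
  have hsub : ∀ a, Finset.bipartiteAbove D.Adj B a ⊆ h.outF a := by
    intro a v hv
    exact h.mem_outF.2 ((Finset.mem_bipartiteAbove _).1 hv).2
  have hle : ∀ a ∈ A, (Finset.bipartiteAbove D.Adj B a).card ≤ k := fun a _ =>
    (Finset.card_le_card (hsub a)).trans (hk a).1.le
  have hall : ∀ a ∈ A, (Finset.bipartiteAbove D.Adj B a).card = k := by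
    refine (Finset.sum_eq_sum_iff_of_le hle).1 ?_
    rw [hcount, hB, Finset.sum_const, hAB, smul_eq_mul]
  intro a ha v hv
  have := Finset.eq_of_subset_of_card_le (hsub a) (by rw [hall a ha, (hk a).1])
  have hv' : v ∈ h.outF a := h.mem_outF.2 hv
  rw [← this] at hv'
  exact ((Finset.mem_bipartiteAbove _).1 hv').1

/-- A digraph whose edges are all pairs between consecutive classes of a cyclic tripartition with
classes of size `k` is `C₃[K̄ₖ]`. -/
theorem lexProduct_iso_of_partition {k : ℕ} (π : V → ZMod 3)
    (hadj : ∀ u v, D.Adj u v ↔ π v = π u + 1)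
    (hcard : ∀ i, ∃ s : Finset V, s.card = k ∧ ∀ v, v ∈ s ↔ π v = i) :
    D.IsIsomorphic ((directedCycle 3).lexProduct (Digraph.emptyDigraph (Fin k))) := by
  have he : ∀ i, Nonempty ({v // π v = i} ≃ Fin k) := by
    intro i
    obtain ⟨s, hs, hi⟩ := hcard i
    exact ⟨(Equiv.subtypeEquivRight fun v => (hi v).symm).trans (s.equivFinOfCardEq hs)⟩
  let e : ∀ i, {v // π v = i} ≃ Fin k := fun i => (he i).some
  let ε : V ≃ ZMod 3 × Fin k :=
    (Equiv.sigmaFiberEquiv π).symm.trans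
      ((Equiv.sigmaCongrRight e).trans (Equiv.sigmaEquivProd _ _))
  refine ⟨⟨ε, ?_⟩⟩
  intro u v
  have h1 : ∀ u, (ε u).1 = π u := fun u => rfl
  simp only [lexProduct, directedCycle, Digraph.emptyDigraph, and_false, or_false, h1, hadj]

/-- Recognition of `Yₖ₊₁`: three classes of size `k + 1` such that each vertex has its `k`
in-neighbours in the preceding class, where the missing edges are controlled by a map `f` that
sends a vertex `x` of the first class to the vertex of the third class that lies with `x` in a
triangle of missing edges. -/
theorem tripartiteY_iso_of_partition (h : D.IsLocallyFinite) (hconn : D.IsConnected) {k : ℕ}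
    (hk2 : 2 ≤ k) (hk : ∀ x, (h.outF x).card = k ∧ (h.inF x).card = k)
    (hout : ∀ x, D.IsIndependent (D.outNbhd x))
    {X Y Z : Finset V} (hX : X.card = k + 1) (hY : Y.card = k + 1) (hZ : Z.card = k + 1)
    (inX : ∀ x ∈ X, ∀ u, D.Adj u x → u ∈ Z) (inY : ∀ y ∈ Y, ∀ u, D.Adj u y → u ∈ X)
    (inZ : ∀ z ∈ Z, ∀ u, D.Adj u z → u ∈ Y) (f : V → V)
    (hf : ∀ x ∈ X, ∀ u, D.Adj u (f x) ↔ D.Adj x u) (hf' : ∀ x ∈ X, ¬ D.Adj (f x) x) :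
    D.IsIsomorphic (tripartiteY (k + 1)) := by
  classical
  have outX := out_closed_of_in_closed h hk (hX.trans hY.symm) inY
  have outY := out_closed_of_in_closed h hk (hY.trans hZ.symm) inZ
  have outZ := out_closed_of_in_closed h hk (hZ.trans hX.symm) inX
  -- Two vertices of a class miss at most two of the vertices of the preceding class.
  have indep : ∀ {A B : Finset V}, A.card = k + 1 → (∀ b ∈ B, ∀ u, D.Adj u b → u ∈ A) →
      ∀ b ∈ B, ∀ b' ∈ B, ¬ D.Adj b b' := by
    intro A B hA hin b hb b' hb'
    have h1 : (h.inF b ∪ h.inF b').card ≤ k + 1 := by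
      rw [← hA]
      refine Finset.card_le_card fun u hu => ?_
      rcases Finset.mem_union.1 hu with hu | hu
      · exact hin b hb u (h.mem_inF.1 hu)
      · exact hin b' hb' u (h.mem_inF.1 hu)
    have h2 := Finset.card_union_add_card_inter (h.inF b) (h.inF b')
    rw [(hk b).2, (hk b').2] at h2
    obtain ⟨a, ha⟩ := Finset.card_pos.1 (show 0 < (h.inF b ∩ h.inF b').card by omega)
    simp only [Finset.mem_inter, h.mem_inF] at ha
    exact hout a b ha.1 b' ha.2
  have iX := indep hZ inX
  have iY := indep hX inY
  have iZ := indep hY inZ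
  have exOut : ∀ x, ∃ y, D.Adj x y := fun x => by
    obtain ⟨y, hy⟩ := Finset.card_pos.1 (show 0 < (h.outF x).card by rw [(hk x).1]; omega)
    exact ⟨y, h.mem_outF.1 hy⟩
  have dXY : ∀ v ∈ X, v ∉ Y := fun v hv hv' => by
    obtain ⟨u, hu⟩ := exOut v
    exact iY v hv' u (outX v hv u hu) hu
  have dYZ : ∀ v ∈ Y, v ∉ Z := fun v hv hv' => by
    obtain ⟨u, hu⟩ := exOut v
    exact iZ v hv' u (outY v hv u hu) hu
  have dZX : ∀ v ∈ Z, v ∉ X := fun v hv hv' => by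
    obtain ⟨u, hu⟩ := exOut v
    exact iX v hv' u (outZ v hv u hu) hu
  have fZ : ∀ x ∈ X, f x ∈ Z := fun x hx => by
    obtain ⟨u, hu⟩ := exOut x
    exact outY u (outX x hx u hu) _ ((hf x hx u).2 hu)
  have miss : ∀ x ∈ X, ∃ y ∈ Y, ∀ v ∈ Y, D.Adj x v ↔ v ≠ y := by
    intro x hx
    have hsub : h.outF x ⊆ Y := fun v hv => outX x hx v (h.mem_outF.1 hv)
    have hc : (Y \ h.outF x).card = 1 := by
      rw [Finset.card_sdiff_of_subset hsub, hY, (hk x).1]; omega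
    obtain ⟨y, hy⟩ := Finset.card_eq_one.1 hc
    refine ⟨y, (Finset.mem_sdiff.1 (hy ▸ Finset.mem_singleton_self y)).1, fun v hv => ?_⟩
    have := Finset.ext_iff.1 hy v
    simp only [Finset.mem_sdiff, hv, h.mem_outF, true_and, Finset.mem_singleton] at this
    rw [← not_iff_not, this, not_not]
  choose! m hm hm' using miss
  have uniqIn : ∀ {A : Finset V} {b x x' : V}, A.card = k + 1 →
      (∀ u, D.Adj u b → u ∈ A) → x ∈ A → x' ∈ A → ¬ D.Adj x b → ¬ D.Adj x' b → x = x' := by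
    intro A b x x' hA hin hx hx' h1 h2
    by_contra hne
    have hsub : h.inF b ⊆ (A.erase x).erase x' := by
      intro u hu
      have hu := h.mem_inF.1 hu
      refine Finset.mem_erase.2 ⟨?_, Finset.mem_erase.2 ⟨?_, hin u hu⟩⟩
      · rintro rfl; exact h2 hu
      · rintro rfl; exact h1 hu
    have := Finset.card_le_card hsub
    rw [Finset.card_erase_of_mem (Finset.mem_erase.2 ⟨fun e => hne e.symm, hx'⟩),
      Finset.card_erase_of_mem hx, hA, (hk b).2] at this
    omega
  have minj : ∀ x ∈ X, ∀ x' ∈ X, m x = m x' → x = x' := by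
    intro x hx x' hx' e
    refine uniqIn hX (inY (m x) (hm x hx)) hx hx' ?_ ?_
    · rw [hm' x hx _ (hm x hx)]; simp
    · rw [hm' x' hx' _ (hm x hx)]; simp [e]
  have finj : ∀ x ∈ X, ∀ x' ∈ X, f x = f x' → x = x' := by
    intro x hx x' hx' e
    refine minj x hx x' hx' ?_
    by_contra hne
    have h1 := (hm' x hx _ (hm x' hx')).2 (Ne.symm hne)
    rw [← hf x hx, e, hf x' hx', hm' x' hx' _ (hm x' hx')] at h1
    exact h1 rfl
  have msurj : ∀ y ∈ Y, ∃ x ∈ X, m x = y := by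
    have := Finset.surj_on_of_inj_on_of_card_le (s := X) (t := Y) (fun x _ => m x)
      (fun x hx => hm x hx) (fun x x' hx hx' e => minj x hx x' hx' e) (by rw [hX, hY])
    intro y hy
    obtain ⟨x, hx, e⟩ := this y hy
    exact ⟨x, hx, e.symm⟩
  have fsurj : ∀ z ∈ Z, ∃ x ∈ X, f x = z := by
    have := Finset.surj_on_of_inj_on_of_card_le (s := X) (t := Z) (fun x _ => f x)
      (fun x hx => fZ x hx) (fun x x' hx hx' e => finj x hx x' hx' e) (by rw [hX, hZ])
    intro y hy
    obtain ⟨x, hx, e⟩ := this y hy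
    exact ⟨x, hx, e.symm⟩
  have aXY : ∀ x ∈ X, ∀ x' ∈ X, D.Adj x (m x') ↔ x ≠ x' := by
    intro x hx x' hx'
    rw [hm' x hx _ (hm x' hx')]
    exact ⟨fun h1 e => h1 (by rw [e]), fun h1 e => h1 (minj x hx x' hx' e.symm)⟩
  have aYZ : ∀ x ∈ X, ∀ x' ∈ X, D.Adj (m x) (f x') ↔ x ≠ x' := by
    intro x hx x' hx'
    rw [hf x' hx', aXY x' hx' x hx]
    exact ne_comm
  have aZX : ∀ x ∈ X, ∀ x' ∈ X, D.Adj (f x) x' ↔ x ≠ x' := by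
    intro x hx x' hx'
    refine ⟨fun h1 e => hf' x hx (e ▸ h1), fun hne => ?_⟩
    by_contra hnot
    have hsub : h.outF (f x) ⊆ (X.erase x).erase x' := by
      intro u hu
      have hu := h.mem_outF.1 hu
      refine Finset.mem_erase.2 ⟨?_, Finset.mem_erase.2 ⟨?_, outZ _ (fZ x hx) u hu⟩⟩
      · rintro rfl; exact hnot hu
      · rintro rfl; exact hf' _ hx hu
    have := Finset.card_le_card hsub
    rw [Finset.card_erase_of_mem (Finset.mem_erase.2 ⟨hne.symm, hx'⟩),
      Finset.card_erase_of_mem hx, hX, (hk _).1] at this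
    omega
  have cover : ∀ v, v ∈ X ∨ v ∈ Y ∨ v ∈ Z := by
    obtain ⟨x, hx⟩ := Finset.card_pos.1 (show 0 < X.card by omega)
    refine hconn.mem_of_closed (S := {v | v ∈ X ∨ v ∈ Y ∨ v ∈ Z}) (Or.inl hx) ?_
    rintro a (ha | ha | ha) b (hb | hb)
    · exact Or.inr (Or.inl (outX a ha b hb))
    · exact Or.inr (Or.inr (inX a ha b hb))
    · exact Or.inr (Or.inr (outY a ha b hb))
    · exact Or.inl (inY a ha b hb)
    · exact Or.inl (outZ a ha b hb)
    · exact Or.inr (Or.inl (inZ a ha b hb))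
  let e : Fin (k + 1) ≃ X := (X.equivFinOfCardEq hX).symm
  let g : ZMod 3 × Fin (k + 1) → V := fun p =>
    if p.1 = 0 then (e p.2 : V) else if p.1 = 1 then m (e p.2) else f (e p.2)
  have g0 : ∀ a, g (0, a) = e a := fun a => rfl
  have g1 : ∀ a, g (1, a) = m (e a) := fun a => rfl
  have g2 : ∀ a, g (2, a) = f (e a) := fun a => rfl
  have three : ∀ i : ZMod 3, i = 0 ∨ i = 1 ∨ i = 2 := by decide
  have mX : ∀ a, (e a : V) ∈ X := fun a => (e a).2
  have mY : ∀ a, m (e a) ∈ Y := fun a => hm _ (mX a)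
  have mZ : ∀ a, f (e a) ∈ Z := fun a => fZ _ (mX a)
  have hne : ∀ a b, (e a : V) ≠ e b ↔ a ≠ b := fun a b => by
    rw [Ne, Subtype.coe_inj, e.injective.eq_iff]
  have hg : Function.Bijective g := by
    constructor
    · rintro ⟨i, a⟩ ⟨j, b⟩ hij
      rcases three i with rfl | rfl | rfl <;> rcases three j with rfl | rfl | rfl <;>
        simp only [g0, g1, g2] at hij
      · rw [e.injective (Subtype.ext hij)]
      · exact absurd (hij ▸ mY b) (dXY _ (mX a))
      · exact absurd (mX a) (dZX _ (hij ▸ mZ b))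
      · exact absurd (hij ▸ mY a) (dXY _ (mX b))
      · rw [e.injective (Subtype.ext (minj _ (mX a) _ (mX b) hij))]
      · exact absurd (hij ▸ mZ b) (dYZ _ (mY a))
      · exact absurd (mX b) (dZX _ (hij ▸ mZ a))
      · exact absurd (hij ▸ mZ a) (dYZ _ (mY b))
      · rw [e.injective (Subtype.ext (finj _ (mX a) _ (mX b) hij))]
    · intro v
      rcases cover v with hv | hv | hv
      · exact ⟨(0, e.symm ⟨v, hv⟩), by rw [g0]; simp⟩
      · obtain ⟨x, hx, rfl⟩ := msurj v hv
        exact ⟨(1, e.symm ⟨x, hx⟩), by rw [g1]; simp⟩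
      · obtain ⟨x, hx, rfl⟩ := fsurj v hv
        exact ⟨(2, e.symm ⟨x, hx⟩), by rw [g2]; simp⟩
  refine ⟨RelIso.symm ⟨Equiv.ofBijective g hg, ?_⟩⟩
  rintro ⟨i, a⟩ ⟨j, b⟩
  simp only [Equiv.ofBijective_apply, tripartiteY]
  rcases three i with rfl | rfl | rfl <;> rcases three j with rfl | rfl | rfl <;>
    simp only [g0, g1, g2]
  · exact iff_of_false (iX _ (mX a) _ (mX b)) (fun hc => absurd hc.1 (by decide))
  · exact (aXY _ (mX a) _ (mX b)).trans ((hne a b).trans (by simp))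
  · exact iff_of_false (fun hc => dYZ _ (outX _ (mX a) _ hc) (mZ b))
      (fun hc => absurd hc.1 (by decide))
  · exact iff_of_false (fun hc => dYZ _ (mY a) (inX _ (mX b) _ hc))
      (fun hc => absurd hc.1 (by decide))
  · exact iff_of_false (iY _ (mY a) _ (mY b)) (fun hc => absurd hc.1 (by decide))
  · exact (aYZ _ (mX a) _ (mX b)).trans ((hne a b).trans
      ⟨fun hc => ⟨by decide, hc⟩, fun hc => hc.2⟩)
  · exact (aZX _ (mX a) _ (mX b)).trans ((hne a b).trans
      ⟨fun hc => ⟨by decide, hc⟩, fun hc => hc.2⟩)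
  · exact iff_of_false (fun hc => dZX _ (mZ a) (inY _ (mY b) _ hc))
      (fun hc => absurd hc.1 (by decide))
  · exact iff_of_false (iZ _ (mZ a) _ (mZ b)) (fun hc => absurd hc.1 (by decide))

theorem reach_lexProduct_iff {k : ℕ} {x y c d : ZMod 3 × Fin k}
    (hxy : ((directedCycle 3).lexProduct (Digraph.emptyDigraph (Fin k))).Adj x y) :
    ((directedCycle 3).lexProduct (Digraph.emptyDigraph (Fin k))).Reach x y c d ↔
      c.1 = x.1 ∧ d.1 = x.1 + 1 := by
  have adj : ∀ u v : ZMod 3 × Fin k,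
      ((directedCycle 3).lexProduct (Digraph.emptyDigraph (Fin k))).Adj u v ↔ v.1 = u.1 + 1 := by
    intro u v
    simp [lexProduct, directedCycle]
  constructor
  · intro h
    induction h with
    | refl => exact ⟨rfl, (adj _ _).1 hxy⟩
    | tail _ hb ih => exact ⟨ih.1, by rw [(adj _ _).1 hb, ih.1]⟩
    | head _ hb ih => exact ⟨add_right_cancel (((adj _ _).1 hb).symm.trans ih.2), ih.2⟩
  · rintro ⟨h1, h2⟩
    exact (Reach.refl.tail ((adj x d).2 h2)).head ((adj c d).2 (by rw [h2, h1]))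

theorem reachDigraphIso_completeBipartite (asymm : D.IsAsymmetric) {k : ℕ}
    (hD : D.IsIsomorphic ((directedCycle 3).lexProduct (Digraph.emptyDigraph (Fin k)))) :
    D.ReachDigraphIso (completeBipartiteDigraph k k) := by
  obtain ⟨α⟩ := hD
  refine reachDigraphIso_of_iso asymm α (fun x y hxy =>
    ⟨Sum.elim (fun a => (x.1, a)) (fun b => (x.1 + 1, b)), ?_, ?_, ?_⟩) ?_
  · rintro (a | a) (b | b) h <;> simp_all
  · rintro (a | a) (b | b) <;>
      simp only [Sum.elim_inl, Sum.elim_inr, reach_lexProduct_iff hxy,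
        completeBipartiteDigraph] <;> simp
  · intro a b h
    obtain ⟨h1, h2⟩ := (reach_lexProduct_iff hxy).1 h
    exact ⟨⟨Sum.inl a.2, Prod.ext h1.symm rfl⟩, ⟨Sum.inr b.2, Prod.ext h2.symm rfl⟩⟩
  · rintro (a | a)
    · exact ⟨Sum.inr a, Or.inl trivial⟩
    · exact ⟨Sum.inl a, Or.inr trivial⟩

theorem reach_tripartiteY_iff {k : ℕ} (hk : 3 ≤ k) {x y c d : ZMod 3 × Fin k}
    (hxy : (tripartiteY k).Adj x y) :
    (tripartiteY k).Reach x y c d ↔ c.1 = x.1 ∧ d.1 = x.1 + 1 ∧ c.2 ≠ d.2 := by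
  have third : ∀ a b : Fin k, ∃ c, c ≠ a ∧ c ≠ b := by
    intro a b
    have h1 : (({a, b} : Finset (Fin k))ᶜ).card ≠ 0 := by
      have h2 := Finset.card_le_two (a := a) (b := b)
      rw [Finset.card_compl, Fintype.card_fin]
      omega
    obtain ⟨c, hc⟩ := Finset.card_ne_zero.1 h1
    exact ⟨c, by simpa using hc⟩
  constructor
  · intro h
    induction h with
    | refl => exact ⟨rfl, hxy⟩
    | tail _ hb ih => exact ⟨ih.1, by rw [hb.1, ih.1], hb.2⟩
    | head _ hb ih => exact ⟨add_right_cancel (hb.1.symm.trans ih.2.1), ih.2.1, hb.2⟩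
  · rintro ⟨h1, h2, h3⟩
    -- Change the head of the edge twice, and its tail in between.
    obtain ⟨e, he, he'⟩ := third x.2 c.2
    have a1 : (tripartiteY k).Adj x (x.1 + 1, e) := ⟨rfl, he.symm⟩
    have a2 : (tripartiteY k).Adj c (x.1 + 1, e) := ⟨by rw [h1], he'.symm⟩
    have a3 : (tripartiteY k).Adj c d := ⟨by rw [h2, h1], h3⟩
    exact ((Reach.refl.tail a1).head a2).tail a3

theorem reachDigraphIso_complementPerfectMatching (asymm : D.IsAsymmetric) {k : ℕ} (hk : 3 ≤ k)
    (hD : D.IsIsomorphic (tripartiteY k)) :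
    D.ReachDigraphIso (complementPerfectMatching k) := by
  obtain ⟨α⟩ := hD
  have : Nontrivial (Fin k) := Fin.nontrivial_iff_two_le.2 (by omega)
  refine reachDigraphIso_of_iso asymm α (fun x y hxy =>
    ⟨Sum.elim (fun a => (x.1, a)) (fun b => (x.1 + 1, b)), ?_, ?_, ?_⟩) ?_
  · rintro (a | a) (b | b) h <;> simp_all
  · rintro (a | a) (b | b) <;>
      simp [reach_tripartiteY_iff hk hxy, complementPerfectMatching]
  · intro a b h
    obtain ⟨h1, h2, -⟩ := (reach_tripartiteY_iff hk hxy).1 h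
    exact ⟨⟨Sum.inl a.2, Prod.ext h1.symm rfl⟩, ⟨Sum.inr b.2, Prod.ext h2.symm rfl⟩⟩
  · rintro (a | a) <;> obtain ⟨b, hb⟩ := exists_ne a
    · exact ⟨Sum.inr b, Or.inl hb.symm⟩
    · exact ⟨Sum.inl b, Or.inr hb⟩

end Models


/-! ### Reachability digraphs of 2-regular digraphs -/

section TwoRegular

variable {V : Type*} {D : Digraph V}

/-- If all in- and outdegrees are `2`, the reachability digraph of an edge is traversed by a
two-way infinite alternating walk `p`, which is injective up to a period `2 * m`. -/
theorem exists_alternating_parametrization (h : D.IsLocallyFinite) (asymm : D.IsAsymmetric)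
    (hbip : D.HasBipartiteReachDigraph)
    (hk : ∀ x, (h.outF x).card = 2 ∧ (h.inF x).card = 2) {x y : V} (hxy : D.Adj x y) :
    ∃ (m : ℕ) (p : ℤ → V), m ≠ 1 ∧ (∀ i j, p i = p j ↔ ((2 * m : ℕ) : ℤ) ∣ i - j) ∧
      (∀ i j, D.Reach x y (p i) (p j) ↔ Even i ∧ (p j = p (i + 1) ∨ p i = p (j + 1))) ∧
      (∀ a b, D.Reach x y a b → (∃ i, p i = a) ∧ ∃ i, p i = b) := by
  classical
  have other : ∀ (s : Finset V) (b : V), s.card = 2 → b ∈ s →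
      ∃ b', b' ≠ b ∧ b' ∈ s ∧ ∀ v ∈ s, v = b ∨ v = b' := by
    intro s b hs hb
    obtain ⟨u, v, huv, rfl⟩ := Finset.card_eq_two.1 hs
    simp only [Finset.mem_insert, Finset.mem_singleton] at hb ⊢
    rcases hb with rfl | rfl
    · exact ⟨v, huv.symm, Or.inr rfl, fun w hw => hw⟩
    · exact ⟨u, huv, Or.inl rfl, fun w hw => hw.symm⟩
  have ho : ∀ a b, D.Adj a b → ∃ b', b' ≠ b ∧ D.Adj a b' ∧ ∀ v, D.Adj a v → v = b ∨ v = b' := by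
    intro a b hab
    simpa using other (h.outF a) b (hk a).1 (by simpa using hab)
  have hi : ∀ b a, D.Adj a b → ∃ a', a' ≠ a ∧ D.Adj a' b ∧ ∀ v, D.Adj v b → v = a ∨ v = a' := by
    intro b a hab
    simpa using other (h.inF b) a (hk b).2 (by simpa using hab)
  choose! o o1 o2 o3 using ho
  choose! n n1 n2 n3 using hi
  let E := {e : V × V // D.Adj e.1 e.2}
  -- `σ` exchanges the two edges with a common tail, `τ` those with a common head.
  let σ : Equiv.Perm E := Function.Involutive.toPerm
    (fun e => ⟨(e.1.1, o e.1.1 e.1.2), o2 _ _ e.2⟩) (by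
      rintro ⟨⟨a, b⟩, hab⟩
      refine Subtype.ext (Prod.ext rfl ?_)
      have h1 := o2 a b hab
      rcases o3 a b hab _ (o2 a _ h1) with h2 | h2
      · exact h2
      · exact absurd h2 (o1 a _ h1))
  let τ : Equiv.Perm E := Function.Involutive.toPerm
    (fun e => ⟨(n e.1.2 e.1.1, e.1.2), n2 _ _ e.2⟩) (by
      rintro ⟨⟨a, b⟩, hab⟩
      refine Subtype.ext (Prod.ext ?_ rfl)
      have h1 := n2 b a hab
      rcases n3 b a hab _ (n2 b _ h1) with h2 | h2
      · exact h2
      · exact absurd h2 (n1 b _ h1))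
  have σt : ∀ e : E, (σ e).1.1 = e.1.1 := fun e => rfl
  have τh : ∀ e : E, (τ e).1.2 = e.1.2 := fun e => rfl
  have σh : ∀ e : E, (σ e).1.2 ≠ e.1.2 := fun e => o1 _ _ e.2
  have τt : ∀ e : E, (τ e).1.1 ≠ e.1.1 := fun e => n1 _ _ e.2
  have σσ : σ * σ = 1 := Equiv.ext fun e => σ.symm_apply_apply e
  have ττ : τ * τ = 1 := Equiv.ext fun e => τ.symm_apply_apply e
  have σi : σ⁻¹ = σ := inv_eq_of_mul_eq_one_left σσ
  have τi : τ⁻¹ = τ := inv_eq_of_mul_eq_one_left ττ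
  have sameTail : ∀ e f : E, e.1.1 = f.1.1 → f = e ∨ f = σ e := by
    rintro ⟨⟨a, b⟩, hab⟩ ⟨⟨a', b'⟩, hab'⟩ (rfl : a = a')
    rcases o3 a b hab b' hab' with rfl | rfl
    · exact Or.inl rfl
    · exact Or.inr rfl
  have sameHead : ∀ e f : E, e.1.2 = f.1.2 → f = e ∨ f = τ e := by
    rintro ⟨⟨a, b⟩, hab⟩ ⟨⟨a', b'⟩, hab'⟩ (rfl : b = b')
    rcases n3 b a hab a' hab' with rfl | rfl
    · exact Or.inl rfl
    · exact Or.inr rfl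
  let s : Equiv.Perm E := σ * τ
  have conj : ∀ i : ℤ, σ * s ^ i = s ^ (-i) * σ := by
    intro i
    have h1 : σ * s * σ⁻¹ = s⁻¹ := by
      simp only [s, mul_inv_rev, σi, τi]
      rw [← mul_assoc, σσ, one_mul]
    rw [zpow_neg, ← inv_zpow, ← h1, conj_zpow, inv_mul_cancel_right]
  let e : E := ⟨(x, y), hxy⟩
  let w : ℤ → E := fun i => (s ^ i) e
  have wsucc : ∀ i, w (i + 1) = σ (τ (w i)) := by
    intro i
    simp only [w, add_comm i 1, zpow_add, zpow_one]
    rfl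
  have σw : ∀ i t, (s ^ (-t)) (σ (w i)) = σ (w (i + t)) := by
    intro i t
    have := Equiv.ext_iff.1 (conj t) (w i)
    simp only [Equiv.Perm.mul_apply] at this
    rw [← this]
    simp only [w, add_comm i t, zpow_add, Equiv.Perm.mul_apply]
  have sw : ∀ i t, (s ^ t) (w i) = w (t + i) := by
    intro i t
    simp only [w, zpow_add, Equiv.Perm.mul_apply]
  -- The walk never runs back along itself: it would have to turn at a vertex or an edge.
  have noflip : ∀ i j, w j ≠ σ (w i) := by
    intro i j hij
    have key : ∀ t, w (-t + j) = σ (w (i + t)) := by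
      intro t
      rw [← σw, ← hij, sw]
    rcases Int.even_or_odd' (j - i) with ⟨t, ht | ht⟩
    · have h1 := key t
      rw [show -t + j = i + t by omega] at h1
      exact σh _ (congrArg (fun f : E => f.1.2) h1).symm
    · have h1 := key t
      rw [show -t + j = i + t + 1 by omega, wsucc] at h1
      exact τt _ (congrArg (fun f : E => f.1.1) (σ.injective h1))
  let m := Function.minimalPeriod (s • ·) e
  have weq : ∀ i j, w i = w j ↔ (m : ℤ) ∣ i - j := by
    intro i j
    rw [← MulAction.zpow_smul_eq_iff_minimalPeriod_dvd, Equiv.Perm.smul_def, sub_eq_neg_add,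
      zpow_add, Equiv.Perm.mul_apply, zpow_neg, Equiv.Perm.inv_eq_iff_eq]
  have teq : ∀ i j, (w i).1.1 = (w j).1.1 ↔ (m : ℤ) ∣ i - j := by
    intro i j
    rw [← weq]
    refine ⟨fun h1 => ?_, fun h1 => by rw [h1]⟩
    rcases sameTail _ _ h1 with h2 | h2
    · exact h2.symm
    · exact absurd h2 (noflip i j)
  have heq : ∀ i j, (w i).1.2 = (w j).1.2 ↔ (m : ℤ) ∣ i - j := by
    intro i j
    rw [← weq]
    refine ⟨fun h1 => ?_, fun h1 => by rw [h1]⟩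
    rcases sameHead _ _ h1 with h2 | h2
    · exact h2.symm
    · refine absurd (?_ : w (i + 1) = σ (w j)) (noflip _ _)
      rw [wsucc, h2]
  have σreach : ∀ f : E, D.Reach x y f.1.1 f.1.2 → D.Reach x y (σ f).1.1 (σ f).1.2 :=
    fun f hf => hf.tail (σ f).2
  have τreach : ∀ f : E, D.Reach x y f.1.1 f.1.2 → D.Reach x y (τ f).1.1 (τ f).1.2 :=
    fun f hf => hf.head (τ f).2
  have wpred : ∀ i, w (i - 1) = τ (σ (w i)) := by
    intro i
    have := wsucc (i - 1)
    rw [sub_add_cancel] at this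
    rw [this]
    exact ((Equiv.ext_iff.1 ττ (w (i - 1))).symm.trans
      (congrArg τ (Equiv.ext_iff.1 σσ (τ (w (i - 1)))).symm))
  have wreach : ∀ i, D.Reach x y (w i).1.1 (w i).1.2 := by
    intro i
    induction i using Int.induction_on with
    | zero => exact Reach.refl
    | succ i ih => rw [wsucc]; exact σreach _ (τreach _ ih)
    | pred i ih => rw [wpred]; exact τreach _ (σreach _ ih)
  have all : ∀ a b (hr : D.Reach x y a b),
      ∃ i, (⟨(a, b), hr.adj hxy⟩ : E) = w i ∨ (⟨(a, b), hr.adj hxy⟩ : E) = σ (w i) := by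
    intro a b hr
    induction hr with
    | refl => exact ⟨0, Or.inl rfl⟩
    | @tail a b b' h' hb ih =>
      obtain ⟨i, ih⟩ := ih
      have : (w i).1.1 = a := by
        rcases ih with h1 | h1
        · rw [← h1]
        · rw [← σt, ← h1]
      exact ⟨i, sameTail (w i) ⟨(a, b'), hb⟩ this⟩
    | @head a b a' h' hb ih =>
      obtain ⟨i, h1 | h1⟩ := ih
      · rcases sameHead (w i) ⟨(a', b), hb⟩ (by rw [← h1]) with h2 | h2
        · exact ⟨i, Or.inl h2⟩
        · refine ⟨i + 1, Or.inr ?_⟩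
          rw [wsucc, h2]
          exact (Equiv.ext_iff.1 σσ (τ (w i))).symm
      · rcases sameHead (σ (w i)) ⟨(a', b), hb⟩ (by rw [← h1]) with h2 | h2
        · exact ⟨i, Or.inr h2⟩
        · exact ⟨i - 1, Or.inl (by rw [wpred, h2])⟩
  have cross : ∀ i j, (w i).1.1 ≠ (w j).1.2 := by
    intro i j hij
    have h1 := ((wreach i).symm hxy).trans (wreach j)
    rw [← hij] at h1
    exact hbip.not_reach asymm (w i).2 h1
  have σhead : ∀ i, (σ (w i)).1.2 = (w (i - 1)).1.2 := by
    intro i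
    rw [wpred, τh]
  let p : ℤ → V := fun i => if Even i then (w (i / 2)).1.1 else (w (i / 2)).1.2
  have pe : ∀ i, p (2 * i) = (w i).1.1 := by
    intro i
    simp only [p, even_two_mul, if_true]
    rw [Int.mul_ediv_cancel_left _ (by norm_num)]
  have po : ∀ i, p (2 * i + 1) = (w i).1.2 := by
    intro i
    have h1 : ¬ Even (2 * i + 1) := Int.not_even_iff_odd.2 (odd_two_mul_add_one i)
    have h2 : (2 * i + 1) / 2 = i := by omega
    simp only [p, h1, h2, if_false]
  have peq : ∀ i j, p i = p j ↔ ((2 * m : ℕ) : ℤ) ∣ i - j := by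
    have d2 : ∀ i j : ℤ, ((2 * m : ℕ) : ℤ) ∣ i - j → (2 : ℤ) ∣ i - j := by
      intro i j hij
      refine Dvd.dvd.trans ?_ hij
      push_cast
      exact dvd_mul_right _ _
    intro i j
    rcases Int.even_or_odd' i with ⟨i, rfl | rfl⟩ <;> rcases Int.even_or_odd' j with ⟨j, rfl | rfl⟩
    · rw [pe, pe, teq, ← mul_sub]
      push_cast
      rw [mul_dvd_mul_iff_left (by norm_num)]
    · rw [pe, po]
      refine iff_of_false (cross i j) (fun hd => ?_)
      have := d2 _ _ hd
      omega
    · rw [pe, po]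
      refine iff_of_false (cross j i).symm (fun hd => ?_)
      have := d2 _ _ hd
      omega
    · rw [po, po, heq, add_sub_add_right_eq_sub, ← mul_sub]
      push_cast
      rw [mul_dvd_mul_iff_left (by norm_num)]
  have padd : ∀ i j t, p i = p j → p (i + t) = p (j + t) := by
    intro i j t hij
    rw [peq] at hij ⊢
    rwa [add_sub_add_right_eq_sub]
  refine ⟨m, p, ?_, peq, ?_, ?_⟩
  · intro hm
    have h1 : w 1 = w 0 := by rw [weq, hm]; simp
    have h2 := wsucc 0
    rw [zero_add, h1] at h2
    exact noflip 0 0 (by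
      have h3 : σ (w 0) = τ (w 0) := by
        conv_lhs => rw [h2]
        exact Equiv.ext_iff.1 σσ (τ (w 0))
      exact absurd ((congrArg (fun f : E => f.1.2) h3).trans (τh _)) (σh _))
  · intro i j
    constructor
    · intro hr
      have even_of : ∀ r, p i = p (2 * r) → Even i := by
        intro r hir
        have h1 : (2 : ℤ) ∣ i - 2 * r := by
          refine Dvd.dvd.trans ?_ ((peq _ _).1 hir)
          push_cast
          exact dvd_mul_right _ _
        rw [Int.even_iff]
        omega
      obtain ⟨r, h1 | h1⟩ := all _ _ hr
      · have ht : p i = p (2 * r) := by rw [pe, ← h1]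
        refine ⟨even_of r ht, Or.inl ?_⟩
        rw [padd _ _ 1 ht, po, ← h1]
      · have ht : p i = p (2 * r) := by rw [pe, ← σt, ← h1]
        refine ⟨even_of r ht, Or.inr ?_⟩
        have hh : p j = p (2 * (r - 1) + 1) := by rw [po, ← σhead, ← h1]
        rw [padd _ _ 1 hh, ht]
        congr 1
        ring
    · rintro ⟨hi, h1⟩
      obtain ⟨r, rfl⟩ := hi.two_dvd
      rcases h1 with h1 | h1
      · rw [h1, pe, po]
        exact wreach r
      · have h2 := padd _ _ (-1) h1
        rw [add_neg_cancel_right, show 2 * r + -1 = 2 * (r - 1) + 1 by ring, po, ← σhead] at h2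
        rw [← h2, pe]
        exact σreach _ (wreach r)
  · intro a b hr
    obtain ⟨r, h1 | h1⟩ := all _ _ hr
    · exact ⟨⟨2 * r, by rw [pe, ← h1]⟩, ⟨2 * r + 1, by rw [po, ← h1]⟩⟩
    · exact ⟨⟨2 * r, by rw [pe, ← σt, ← h1]⟩, ⟨2 * (r - 1) + 1, by rw [po, ← σhead, ← h1]⟩⟩

theorem even_intCast_zmod_two_mul {m : ℕ} (i : ℤ) : Even (i : ZMod (2 * m)) ↔ Even i := by
  constructor
  · rintro ⟨r, hr⟩
    obtain ⟨r, rfl⟩ := ZMod.intCast_surjective r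
    rw [← Int.cast_add, ZMod.intCast_eq_intCast_iff_dvd_sub] at hr
    have h1 : (2 : ℤ) ∣ r + r - i := by
      refine Dvd.dvd.trans ?_ hr
      push_cast
      exact dvd_mul_right _ _
    rw [Int.even_iff]
    omega
  · rintro ⟨r, rfl⟩
    exact ⟨r, by push_cast; rfl⟩

/-- A 2-regular digraph with transitive automorphism action on its edges has cycles or double
rays as its reachability digraphs. -/
theorem reachDigraphIso_of_two_regular (h : D.IsLocallyFinite) (asymm : D.IsAsymmetric)
    (hbip : D.HasBipartiteReachDigraph)
    (hk : ∀ x, (h.outF x).card = 2 ∧ (h.inF x).card = 2)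
    (harc : ∀ x y x' y', D.Adj x y → D.Adj x' y' → ∃ α : D.Adj ≃r D.Adj, α x = x' ∧ α y = y')
    {x y : V} (hxy : D.Adj x y) :
    (∃ m : ℕ, 2 ≤ m ∧ D.ReachDigraphIso (alternatingCycle m)) ∨
      D.ReachDigraphIso alternatingDoubleRay := by
  obtain ⟨m, p, hm, peq, padj, psurj⟩ :=
    exists_alternating_parametrization h asymm hbip hk hxy
  -- It suffices to describe the reachability digraph of the single edge `x → y`.
  have transfer : ∀ {W : Type} (F : Digraph W) (q : W → V), Function.Injective q →
      (∀ i j, F.Adj i j ↔ D.Reach x y (q i) (q j)) →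
      (∀ a b, D.Reach x y a b → (∃ i, q i = a) ∧ ∃ i, q i = b) →
      (∀ i, ∃ j, F.Adj i j ∨ F.Adj j i) → D.ReachDigraphIso F := by
    intro W F q hq hadj hsurj hinc x' y' hxy'
    obtain ⟨α, rfl, rfl⟩ := harc x y x' y' hxy hxy'
    refine reachDigraph_iso asymm hxy' (fun i => α (q i)) (α.injective.comp hq)
      (fun i j => (hadj i j).trans ⟨fun hr => hr.map α, fun hr => ?_⟩) (fun a b hr => ?_) hinc
    · simpa using hr.map α.symm
    · have h1 := hr.map α.symm
      simp only [RelIso.symm_apply_apply] at h1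
      obtain ⟨⟨i, hi⟩, ⟨j, hj⟩⟩ := hsurj _ _ h1
      exact ⟨⟨i, by simp [hi]⟩, ⟨j, by simp [hj]⟩⟩
  rcases Nat.eq_zero_or_pos m with rfl | hm0
  · right
    have pinj : Function.Injective p := by
      intro i j hij
      rw [peq] at hij
      have : i - j = 0 := by simpa using hij
      omega
    refine transfer _ p pinj (fun i j => ?_) psurj (fun i => ?_)
    · rw [padj, pinj.eq_iff, pinj.eq_iff]
      rfl
    · rcases Int.even_or_odd i with hi | hi
      · exact ⟨i + 1, Or.inl ⟨hi, Or.inl rfl⟩⟩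
      · exact ⟨i + 1, Or.inr ⟨hi.add_one, Or.inr rfl⟩⟩
  · left
    refine ⟨m, by omega, ?_⟩
    have peq' : ∀ i j : ℤ, p i = p j ↔ (i : ZMod (2 * m)) = j := by
      intro i j
      rw [peq, ZMod.intCast_eq_intCast_iff_dvd_sub, ← dvd_neg, neg_sub]
    have hc : ∀ i : ℤ, p ((i : ZMod (2 * m)).cast : ℤ) = p i := by
      intro i
      rw [peq', ZMod.intCast_zmod_cast]
    refine transfer _ (fun a : ZMod (2 * m) => p (a.cast : ℤ)) ?_ ?_ ?_ ?_
    · intro a b hab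
      obtain ⟨i, rfl⟩ := ZMod.intCast_surjective a
      obtain ⟨j, rfl⟩ := ZMod.intCast_surjective b
      simp only [hc, peq'] at hab
      exact hab
    · intro a b
      obtain ⟨i, rfl⟩ := ZMod.intCast_surjective a
      obtain ⟨j, rfl⟩ := ZMod.intCast_surjective b
      simp only [hc, padj, peq', alternatingCycle, even_intCast_zmod_two_mul, Int.cast_add,
        Int.cast_one]
    · intro a b hr
      obtain ⟨⟨i, hi⟩, ⟨j, hj⟩⟩ := psurj a b hr
      exact ⟨⟨i, by rw [hc, hi]⟩, ⟨j, by rw [hc, hj]⟩⟩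
    · intro a
      obtain ⟨i, rfl⟩ := ZMod.intCast_surjective a
      rcases Int.even_or_odd i with hi | hi
      · exact ⟨i + 1, Or.inl ⟨even_intCast_zmod_two_mul i |>.2 hi, Or.inl rfl⟩⟩
      · refine ⟨i + 1, Or.inr ⟨?_, Or.inr rfl⟩⟩
        have := (even_intCast_zmod_two_mul (m := m) (i + 1)).2 hi.add_one
        rwa [Int.cast_add, Int.cast_one] at this

end TwoRegular


/-! ### Local structure around a vertex -/

section LocalStructure

variable {V : Type*} {D : Digraph V}

/-- The hypotheses on `D` other than the bipartiteness of the reachability digraphs. -/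
structure IsTriangular (D : Digraph V) : Prop where
  asymm : D.IsAsymmetric
  fin : D.IsLocallyFinite
  conn : D.IsConnected
  hom : D.IsCHomogeneous
  out : ∀ x, D.IsIndependent (D.outNbhd x)
  inn : ∀ x, D.IsIndependent (D.inNbhd x)
  exists_tri : ∃ x y z, D.Adj x y ∧ D.Adj y z ∧ D.Adj z x

namespace IsTriangular

variable (h : D.IsTriangular)

include h

theorem irrefl (a : V) : ¬ D.Adj a a := fun ha => h.asymm a a ha ha

theorem ne {a b : V} (hab : D.Adj a b) : a ≠ b := by
  rintro rfl; exact h.irrefl _ hab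

theorem not_out {x a b : V} (ha : D.Adj x a) (hb : D.Adj x b) : ¬ D.Adj a b :=
  h.out x a ha b hb

theorem not_inn {x a b : V} (ha : D.Adj a x) (hb : D.Adj b x) : ¬ D.Adj a b :=
  h.inn x a ha b hb

theorem vertex_transitive (x x' : V) : ∃ α : D.Adj ≃r D.Adj, α x = x' := by
  obtain ⟨α, hα⟩ := h.hom.extend (Set.finite_singleton x) (connSet_singleton x) (fun _ => x')
    (by simp) (by simp [h.irrefl])
  exact ⟨α, hα x rfl⟩

theorem arc_transitive (x y x' y' : V) (hxy : D.Adj x y) (hxy' : D.Adj x' y') :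
    ∃ α : D.Adj ≃r D.Adj, α x = x' ∧ α y = y' := by
  obtain ⟨α, rfl⟩ := h.vertex_transitive x x'
  have h1 : D.Adj (α x) (α y) := α.map_rel_iff.2 hxy
  obtain ⟨β, hβ, hβ'⟩ := h.hom.move h.asymm (Set.finite_singleton (α x))
    (connSet_singleton (α x)) (u := α y) (v := y') (by simpa using (h.ne h1).symm)
    (by simpa using (h.ne hxy').symm) ⟨α x, rfl, Or.inl h1⟩ (by
      rintro _ rfl
      exact ⟨iff_of_true h1 hxy', iff_of_false (h.asymm _ _ h1) (h.asymm _ _ hxy')⟩)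
  exact ⟨α.trans β, hβ _ rfl, hβ'⟩

/-- Automorphisms act transitively on pairs of edges with a common tail. -/
theorem out_star_transitive {x y y₂ x' y' y₂' : V} (hy : D.Adj x y) (hy₂ : D.Adj x y₂)
    (hne : y ≠ y₂) (hy' : D.Adj x' y') (hy₂' : D.Adj x' y₂') (hne' : y' ≠ y₂') :
    ∃ α : D.Adj ≃r D.Adj, α x = x' ∧ α y = y' ∧ α y₂ = y₂' := by
  obtain ⟨α, rfl, rfl⟩ := h.arc_transitive x y x' y' hy hy'
  have h2 : D.Adj (α x) (α y₂) := α.map_rel_iff.2 hy₂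
  obtain ⟨β, hβ, hβ'⟩ := h.hom.move h.asymm (Set.toFinite {α x, α y})
    (connSet_pair (Or.inr hy')) (u := α y₂) (v := y₂')
    (by simpa [(h.ne hy₂).symm] using hne.symm)
    (by simpa [(h.ne hy₂').symm] using hne'.symm) ⟨α x, Or.inl rfl, Or.inl h2⟩ (by
      rintro _ (rfl | rfl)
      · exact ⟨iff_of_true h2 hy₂', iff_of_false (h.asymm _ _ h2) (h.asymm _ _ hy₂')⟩
      · exact ⟨iff_of_false (h.not_out hy' h2) (h.not_out hy' hy₂'),
          iff_of_false (h.not_out h2 hy') (h.not_out hy₂' hy')⟩)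
  exact ⟨α.trans β, hβ _ (Or.inl rfl), hβ _ (Or.inr rfl), hβ'⟩

/-- Automorphisms act transitively on pairs of edges with a common head. -/
theorem in_star_transitive {x y y₂ x' y' y₂' : V} (hy : D.Adj y x) (hy₂ : D.Adj y₂ x)
    (hne : y ≠ y₂) (hy' : D.Adj y' x') (hy₂' : D.Adj y₂' x') (hne' : y' ≠ y₂') :
    ∃ α : D.Adj ≃r D.Adj, α x = x' ∧ α y = y' ∧ α y₂ = y₂' := by
  obtain ⟨α, rfl, rfl⟩ := h.arc_transitive y x y' x' hy hy'
  have h2 : D.Adj (α y₂) (α x) := α.map_rel_iff.2 hy₂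
  obtain ⟨β, hβ, hβ'⟩ := h.hom.move h.asymm (Set.toFinite {α x, α y})
    (connSet_pair (Or.inl hy')) (u := α y₂) (v := y₂')
    (by simpa [h.ne hy₂] using hne.symm)
    (by simpa [h.ne hy₂'] using hne'.symm) ⟨α x, Or.inl rfl, Or.inr h2⟩ (by
      rintro _ (rfl | rfl)
      · exact ⟨iff_of_false (h.asymm _ _ h2) (h.asymm _ _ hy₂'), iff_of_true h2 hy₂'⟩
      · exact ⟨iff_of_false (h.not_inn hy' h2) (h.not_inn hy' hy₂'),
          iff_of_false (h.not_inn h2 hy') (h.not_inn hy₂' hy')⟩)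
  exact ⟨α.trans β, hβ _ (Or.inl rfl), hβ _ (Or.inr rfl), hβ'⟩

/-- Automorphisms act transitively on induced directed paths of length two. -/
theorem path_transitive {a b c a' b' c' : V} (hab : D.Adj a b) (hbc : D.Adj b c)
    (hca : ¬ D.Adj c a) (hab' : D.Adj a' b') (hbc' : D.Adj b' c') (hca' : ¬ D.Adj c' a') :
    ∃ α : D.Adj ≃r D.Adj, α a = a' ∧ α b = b' ∧ α c = c' := by
  obtain ⟨α, rfl, rfl⟩ := h.arc_transitive a b a' b' hab hab'
  have h2 : D.Adj (α b) (α c) := α.map_rel_iff.2 hbc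
  have h3 : ¬ D.Adj (α c) (α a) := fun h3 => hca (α.map_rel_iff.1 h3)
  have ne1 : ∀ {v}, D.Adj (α b) v → v ∉ ({α a, α b} : Set V) := by
    rintro v hv (rfl | rfl)
    · exact h.asymm _ _ hab' hv
    · exact h.irrefl _ hv
  obtain ⟨β, hβ, hβ'⟩ := h.hom.move h.asymm (Set.toFinite {α a, α b})
    (connSet_pair (Or.inr hab')) (u := α c) (v := c') (ne1 h2) (ne1 hbc')
    ⟨α b, Or.inr rfl, Or.inl h2⟩ (by
      rintro _ (rfl | rfl)
      · exact ⟨iff_of_false (fun hc => h.not_out hab' hc h2) (fun hc => h.not_out hab' hc hbc'),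
          iff_of_false h3 hca'⟩
      · exact ⟨iff_of_true h2 hbc', iff_of_false (h.asymm _ _ h2) (h.asymm _ _ hbc')⟩)
  exact ⟨α.trans β, hβ _ (Or.inl rfl), hβ _ (Or.inr rfl), hβ'⟩

theorem exists_triangle {x y : V} (hxy : D.Adj x y) : ∃ z, D.Adj y z ∧ D.Adj z x := by
  obtain ⟨a, b, c, hab, hbc, hca⟩ := h.exists_tri
  obtain ⟨α, rfl, rfl⟩ := h.arc_transitive a b x y hab hxy
  exact ⟨α c, α.map_rel_iff.2 hbc, α.map_rel_iff.2 hca⟩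

open scoped Classical in
/-- All degrees agree, and all edges lie in the same number of triangles. -/
theorem exists_degrees : ∃ k t : ℕ, 1 ≤ t ∧
    (∀ x, (h.fin.outF x).card = k ∧ (h.fin.inF x).card = k) ∧
    ∀ x y, D.Adj x y → (h.fin.outF y ∩ h.fin.inF x).card = t := by
  obtain ⟨x₀, y₀, z₀, h₁, h₂, h₃⟩ := h.exists_tri
  have hout : ∀ x, (h.fin.outF x).card = (h.fin.outF x₀).card := by
    intro x
    obtain ⟨α, rfl⟩ := h.vertex_transitive x x₀
    refine Finset.card_bij (fun v _ => α v) ?_ (fun _ _ _ _ e => α.injective e) ?_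
    · intro v hv
      simpa [α.map_rel_iff] using hv
    · intro v hv
      refine ⟨α.symm v, ?_, by simp⟩
      rw [IsLocallyFinite.mem_outF, ← α.map_rel_iff]
      simpa using hv
  have hin : ∀ x, (h.fin.inF x).card = (h.fin.inF x₀).card := by
    intro x
    obtain ⟨α, rfl⟩ := h.vertex_transitive x x₀
    refine Finset.card_bij (fun v _ => α v) ?_ (fun _ _ _ _ e => α.injective e) ?_
    · intro v hv
      simpa [α.map_rel_iff] using hv
    · intro v hv
      refine ⟨α.symm v, ?_, by simp⟩
      rw [IsLocallyFinite.mem_inF, ← α.map_rel_iff]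
      simpa using hv
  have htri : ∀ x y, D.Adj x y → (h.fin.outF y ∩ h.fin.inF x).card =
      (h.fin.outF y₀ ∩ h.fin.inF x₀).card := by
    intro x y hxy
    obtain ⟨α, rfl, rfl⟩ := h.arc_transitive x y x₀ y₀ hxy h₁
    refine Finset.card_bij (fun v _ => α v) ?_ (fun _ _ _ _ e => α.injective e) ?_
    · intro v hv
      simpa [α.map_rel_iff] using hv
    · intro v hv
      refine ⟨α.symm v, ?_, by simp⟩
      rw [Finset.mem_inter, IsLocallyFinite.mem_inF, IsLocallyFinite.mem_outF,
        ← α.map_rel_iff, ← α.map_rel_iff (b := x)]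
      simpa using hv
  have ht : 1 ≤ (h.fin.outF y₀ ∩ h.fin.inF x₀).card :=
    Finset.card_pos.2 ⟨z₀, by simp [h₂, h₃]⟩
  -- Count the edges from the out- to the in-neighbourhood of `x₀` in two ways.
  have hcount := Finset.sum_card_bipartiteAbove_eq_sum_card_bipartiteBelow
    (s := h.fin.outF x₀) (t := h.fin.inF x₀) D.Adj
  rw [Finset.sum_const_nat (m := (h.fin.outF y₀ ∩ h.fin.inF x₀).card),
    Finset.sum_const_nat (m := (h.fin.outF y₀ ∩ h.fin.inF x₀).card)] at hcount
  · have := Nat.eq_of_mul_eq_mul_right ht hcount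
    exact ⟨_, _, ht, fun x => ⟨hout x, (hin x).trans this.symm⟩, htri⟩
  · intro z hz
    rw [← htri z x₀ (by simpa using hz)]
    congr 1
    ext v
    simp
  · intro y hy
    rw [← htri x₀ y (by simpa using hy)]
    congr 1
    ext v
    simp [and_comm]

open scoped Classical in
/-- Two in-neighbours of `x` that are both in or both outside `N⁺(y)` can be exchanged, fixing
`x`, `y` and the other in-neighbours of `x`. -/
theorem exists_swap {x y z₀ z₁ : V} (hxy : D.Adj x y) (hz₀ : D.Adj z₀ x) (hz₁ : D.Adj z₁ x)
    (hz : D.Adj y z₀ ↔ D.Adj y z₁) :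
    ∃ α : D.Adj ≃r D.Adj, α x = x ∧ α y = y ∧ ∀ z, D.Adj z x → α z = Equiv.swap z₀ z₁ z := by
  have hsw : ∀ z, D.Adj z x → D.Adj (Equiv.swap z₀ z₁ z) x := by
    intro z hz
    rw [Equiv.swap_apply_def]
    split_ifs <;> assumption
  have hsy : ∀ z, D.Adj y (Equiv.swap z₀ z₁ z) ↔ D.Adj y z := by
    intro z
    rw [Equiv.swap_apply_def]
    split_ifs with h1 h2
    · rw [h1, hz]
    · rw [h2, hz]
    · rfl
  have hx : Equiv.swap z₀ z₁ x = x :=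
    Equiv.swap_apply_of_ne_of_ne (h.ne hz₀).symm (h.ne hz₁).symm
  have hy : Equiv.swap z₀ z₁ y = y :=
    Equiv.swap_apply_of_ne_of_ne (fun e => h.asymm _ _ hxy (e ▸ hz₀))
      (fun e => h.asymm _ _ hxy (e ▸ hz₁))
  have hc : D.ConnSet ({y, x} ∪ D.inNbhd x) :=
    (connSet_pair (Or.inl hxy)).union fun b hb => ⟨x, Or.inr rfl, Or.inr hb⟩
  obtain ⟨α, hα⟩ := h.hom.extend ((Set.toFinite _).union (h.fin x).2) hc (Equiv.swap z₀ z₁)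
    (Equiv.injective _).injOn (by
      rintro a ((rfl | rfl) | ha) b ((rfl | rfl) | hb)
      · rw [hy]
      · rw [hx, hy]
      · rw [hy, hsy]
      · rw [hx, hy]
      · rw [hx]
      · rw [hx]
        exact iff_of_false (h.asymm _ _ (hsw b hb)) (h.asymm _ _ hb)
      · rw [hy]
        exact iff_of_false (fun hc => h.not_out (hsw a ha) hc hxy)
          (fun hc => h.not_out ha hc hxy)
      · rw [hx]
        exact iff_of_true (hsw a ha) ha
      · exact iff_of_false (h.not_inn (hsw a ha) (hsw b hb)) (h.not_inn ha hb))
  exact ⟨α, (hα x (Or.inl (Or.inr rfl))).trans hx, (hα y (Or.inl (Or.inl rfl))).trans hy,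
    fun z hz => hα z (Or.inr hz)⟩

open scoped Classical in
/-- The edges from `N⁺(x)` to `N⁻(x)` form a homogeneous bipartite graph, so they are a perfect
matching, the complement of a perfect matching, or all pairs. -/
theorem triangle_number {k t : ℕ} (ht : 1 ≤ t)
    (hk : ∀ x, (h.fin.outF x).card = k ∧ (h.fin.inF x).card = k)
    (htri : ∀ x y, D.Adj x y → (h.fin.outF y ∩ h.fin.inF x).card = t) :
    t = 1 ∨ t + 1 = k ∨ t = k := by
  obtain ⟨x, y₁, z₁, hy₁, -, -⟩ := h.exists_tri
  let N : V → Finset V := fun y => h.fin.outF y ∩ h.fin.inF x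
  have hN : ∀ {y z}, z ∈ N y ↔ D.Adj y z ∧ D.Adj z x := by
    intro y z
    simp [N]
  have cN : ∀ {y}, D.Adj x y → (N y).card = t := fun {y} hy => htri x y hy
  have htk : t ≤ k := by
    rw [← cN hy₁, ← (hk x).2]
    exact Finset.card_le_card Finset.inter_subset_right
  by_contra hcon
  push Not at hcon
  obtain ⟨c1, c2, c3⟩ := hcon
  have t2 : 2 ≤ t := by omega
  have tk : t + 2 ≤ k := by omega
  obtain ⟨y₂, hy₂, hne⟩ := Finset.exists_mem_ne
    (show 1 < (h.fin.outF x).card by rw [(hk x).1]; omega) y₁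
  rw [h.fin.mem_outF] at hy₂
  have dconst : ∀ {a b}, D.Adj x a → D.Adj x b → a ≠ b →
      (N a \ N b).card = (N y₁ \ N y₂).card := by
    intro a b ha hb hab
    obtain ⟨α, hx, rfl, rfl⟩ := h.out_star_transitive ha hb hab hy₁ hy₂ hne.symm
    refine Finset.card_bij (fun v _ => α v) ?_ (fun _ _ _ _ e => α.injective e) ?_
    · intro v hv
      simp only [Finset.mem_sdiff, hN] at hv ⊢
      rw [← α.map_rel_iff, ← α.map_rel_iff (b := x), ← α.map_rel_iff (a := b), hx] at hv
      exact hv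
    · intro v hv
      refine ⟨α.symm v, ?_, by simp⟩
      simp only [Finset.mem_sdiff, hN] at hv ⊢
      rw [← α.map_rel_iff, ← α.map_rel_iff (b := x), ← α.map_rel_iff (a := b), hx]
      simpa using hv
  have dpos : ∀ {a b}, D.Adj x a → D.Adj x b → a ≠ b → ∃ z ∈ N a, z ∉ N b := by
    intro a b ha hb hab
    by_contra hno
    push Not at hno
    have d0 : (N y₁ \ N y₂).card = 0 := by
      rw [← dconst ha hb hab, Finset.card_eq_zero, Finset.sdiff_eq_empty_iff_subset]
      exact hno
    have heq : ∀ c, D.Adj x c → N c ⊆ N y₁ := by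
      intro c hc
      by_cases e : c = y₁
      · rw [e]
      · have := dconst hc hy₁ e
        rw [d0, Finset.card_eq_zero, Finset.sdiff_eq_empty_iff_subset] at this
        exact this
    have hlt : (N y₁).card < (h.fin.inF x).card := by rw [cN hy₁, (hk x).2]; omega
    obtain ⟨z, hz, hz'⟩ := Finset.exists_mem_notMem_of_card_lt_card hlt
    rw [h.fin.mem_inF] at hz
    obtain ⟨c, hc, hc'⟩ := h.exists_triangle hz
    exact hz' (heq c hc (hN.2 ⟨hc', hz⟩))
  -- Exchanging `z₀` and `z₁` moves `b` to a vertex `c` with the same out-neighbours in `N⁻(x)`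
  -- up to this exchange.
  have swap : ∀ {a b z₀ z₁}, D.Adj x a → D.Adj x b → D.Adj z₀ x → D.Adj z₁ x →
      (D.Adj a z₀ ↔ D.Adj a z₁) → ∃ c, D.Adj x c ∧
        (D.Adj c z₀ ↔ D.Adj b z₁) ∧ (D.Adj c z₁ ↔ D.Adj b z₀) ∧
        ∀ z, D.Adj z x → z ≠ z₀ → z ≠ z₁ → (D.Adj c z ↔ D.Adj b z) := by
    intro a b z₀ z₁ ha hb hz₀ hz₁ hz
    obtain ⟨α, hx, -, hα⟩ := h.exists_swap ha hz₀ hz₁ hz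
    have e0 : α z₀ = z₁ := by rw [hα _ hz₀, Equiv.swap_apply_left]
    have e1 : α z₁ = z₀ := by rw [hα _ hz₁, Equiv.swap_apply_right]
    refine ⟨α b, ?_, ?_, ?_, ?_⟩
    · rw [← α.map_rel_iff, hx] at hb
      exact hb
    · rw [← α.map_rel_iff (b := z₁), e1]
    · rw [← α.map_rel_iff (b := z₀), e0]
    · intro z hz hz0 hz1
      rw [← α.map_rel_iff (a := b), hα z hz, Equiv.swap_apply_of_ne_of_ne hz0 hz1]
  have done1 : ∀ {b c z₀ z₁}, D.Adj x b → D.Adj x c → D.Adj z₁ x → D.Adj b z₁ →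
      ¬ D.Adj b z₀ → ¬ D.Adj c z₁ →
      (∀ z, D.Adj z x → z ≠ z₀ → z ≠ z₁ → (D.Adj c z ↔ D.Adj b z)) →
      (N y₁ \ N y₂).card = 1 := by
    intro b c z₀ z₁ hb hc hz₁x hz₁ hz₀ hz₁' hall
    rw [← dconst hb hc (by rintro rfl; exact hz₁' hz₁), Finset.card_eq_one]
    refine ⟨z₁, ?_⟩
    ext z
    simp only [Finset.mem_sdiff, hN, Finset.mem_singleton]
    constructor
    · rintro ⟨⟨h1, h2⟩, h3⟩
      by_contra e
      refine h3 ⟨(hall z h2 ?_ e).2 h1, h2⟩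
      rintro rfl
      exact hz₀ h1
    · rintro rfl
      exact ⟨⟨hz₁, hz₁x⟩, fun h3 => hz₁' h3.1⟩
  have case1 : ∀ {a b}, D.Adj x a → D.Adj x b → a ≠ b →
      (∃ z, D.Adj z x ∧ (D.Adj a z ↔ D.Adj b z)) → (N y₁ \ N y₂).card = 1 := by
    rintro a b ha hb hab ⟨z, hzx, hz⟩
    by_cases haz : D.Adj a z
    · have hbz := hz.1 haz
      obtain ⟨z₀, h1, h2⟩ := dpos ha hb hab
      rw [hN] at h1 h2
      have hbz₀ : ¬ D.Adj b z₀ := fun hc => h2 ⟨hc, h1.2⟩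
      obtain ⟨c, hc, -, hc2, hc3⟩ := swap ha hb h1.2 hzx (iff_of_true h1.1 haz)
      exact done1 hb hc hzx hbz hbz₀ (fun e => hbz₀ (hc2.1 e)) hc3
    · have hbz : ¬ D.Adj b z := fun hc => haz (hz.2 hc)
      obtain ⟨z₁, h1, h2⟩ := dpos hb ha hab.symm
      rw [hN] at h1 h2
      have haz₁ : ¬ D.Adj a z₁ := fun hc => h2 ⟨hc, h1.2⟩
      obtain ⟨c, hc, -, hc2, hc3⟩ := swap ha hb hzx h1.2 (iff_of_false haz haz₁)
      exact done1 hb hc h1.2 h1.1 hbz (fun e => hbz (hc2.1 e)) hc3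
  have d1 : (N y₁ \ N y₂).card = 1 := by
    by_contra hd
    have compl : ∀ {a b}, D.Adj x a → D.Adj x b → a ≠ b →
        ∀ z, D.Adj z x → ¬ (D.Adj a z ↔ D.Adj b z) :=
      fun ha hb hab z hz e => hd (case1 ha hb hab ⟨z, hz, e⟩)
    -- Three neighbourhoods cannot be pairwise complementary.
    have h3 : (((h.fin.outF x).erase y₁).erase y₂).Nonempty := by
      rw [← Finset.card_pos, Finset.card_erase_of_mem (by simp [hy₂, hne]),
        Finset.card_erase_of_mem (by simpa using hy₁), (hk x).1]
      omega
    obtain ⟨y₃, h3⟩ := h3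
    simp only [Finset.mem_erase, h.fin.mem_outF] at h3
    obtain ⟨z, hz⟩ := Finset.card_pos.1 (show 0 < (h.fin.inF x).card by rw [(hk x).2]; omega)
    rw [h.fin.mem_inF] at hz
    have e1 := compl hy₁ hy₂ hne.symm z hz
    have e2 := compl hy₁ h3.2.2 (Ne.symm h3.2.1) z hz
    have e3 := compl hy₂ h3.2.2 (Ne.symm h3.1) z hz
    tauto
  have uniq : ∀ {a b z z'}, D.Adj x a → D.Adj x b → a ≠ b → z ∈ N a \ N b → z' ∈ N a \ N b →
      z = z' := by
    intro a b z z' ha hb hab hz hz'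
    exact Finset.card_le_one.1 (by rw [dconst ha hb hab, d1]) z hz z' hz'
  obtain ⟨s, hs, hs'⟩ := dpos hy₁ hy₂ hne.symm
  obtain ⟨r, hr, hr'⟩ := dpos hy₂ hy₁ hne
  obtain ⟨s₂, hs₂, hss⟩ := Finset.exists_mem_ne (show 1 < (N y₁).card by rw [cN hy₁]; omega) s
  have ho : ((h.fin.inF x \ N y₁).erase r).Nonempty := by
    have hsub : N y₁ ⊆ h.fin.inF x := Finset.inter_subset_right
    rw [← Finset.card_pos, Finset.card_erase_of_mem, Finset.card_sdiff_of_subset hsub,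
      (hk x).2, cN hy₁]
    · omega
    · exact Finset.mem_sdiff.2 ⟨Finset.inter_subset_right hr, hr'⟩
  obtain ⟨o, ho⟩ := ho
  rw [Finset.mem_erase, Finset.mem_sdiff, h.fin.mem_inF] at ho
  obtain ⟨hor, hox, hoy⟩ := ho
  have hs₂' : s₂ ∈ N y₂ := by
    by_contra hc
    exact hss (uniq hy₁ hy₂ hne.symm (Finset.mem_sdiff.2 ⟨hs₂, hc⟩)
      (Finset.mem_sdiff.2 ⟨hs, hs'⟩))
  rw [hN] at hs hr hs₂ hs₂' hs' hr' hoy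
  obtain ⟨c, hc, c1, c2, c3⟩ := swap hy₁ hy₂ hs.2 hs₂.2 (iff_of_true hs.1 hs₂.1)
  have hr1 : ¬ D.Adj y₁ r := fun e => hr' ⟨e, hr.2⟩
  have ho1 : ¬ D.Adj y₁ o := fun e => hoy ⟨e, hox⟩
  have ho2 : ¬ D.Adj y₂ o := by
    intro e
    exact hor (uniq hy₂ hy₁ hne (Finset.mem_sdiff.2 ⟨hN.2 ⟨e, hox⟩, fun e' => hoy (hN.1 e')⟩)
      (Finset.mem_sdiff.2 ⟨hN.2 hr, fun e' => hr' (hN.1 e')⟩))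
  obtain ⟨d, hd, -, d2, d3⟩ := swap hy₁ hc hox hr.2 (iff_of_false ho1 hr1)
  have cs2 : ¬ D.Adj c s₂ := fun e => hs' ⟨c2.1 e, hs.2⟩
  have co : ¬ D.Adj c o := fun e => ho2 ((c3 o hox (by rintro rfl; exact ho1 hs.1)
    (by rintro rfl; exact ho1 hs₂.1)).1 e)
  have ds2 : ¬ D.Adj d s₂ := fun e => cs2 ((d3 s₂ hs₂.2 (by rintro rfl; exact ho1 hs₂.1)
    (by rintro rfl; exact hr1 hs₂.1)).1 e)
  have dr : ¬ D.Adj d r := fun e => co (d2.1 e)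
  have hdy : y₂ ≠ d := by rintro rfl; exact dr hr.1
  have := uniq hy₂ hd hdy (z := s₂) (z' := r)
    (Finset.mem_sdiff.2 ⟨hN.2 hs₂', fun e => ds2 (hN.1 e).1⟩)
    (Finset.mem_sdiff.2 ⟨hN.2 hr, fun e => dr (hN.1 e).1⟩)
  subst this
  exact hr1 hs₂.1

open scoped Classical in
/-- If all pairs in `N⁺(x) × N⁻(x)` are edges, the digraph is `C₃[K̄ₖ]`. -/
theorem lexProduct_iso {k : ℕ}
    (hk : ∀ x, (h.fin.outF x).card = k ∧ (h.fin.inF x).card = k)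
    (htri : ∀ x y, D.Adj x y → (h.fin.outF y ∩ h.fin.inF x).card = k) :
    D.IsIsomorphic ((directedCycle 3).lexProduct (Digraph.emptyDigraph (Fin k))) := by
  have key : ∀ {x y}, D.Adj x y → ∀ v, D.Adj y v ↔ D.Adj v x := by
    intro x y hxy v
    have h1 : h.fin.outF y ∩ h.fin.inF x = h.fin.outF y :=
      Finset.eq_of_subset_of_card_le Finset.inter_subset_left (by rw [htri x y hxy, (hk y).1])
    have h2 : h.fin.outF y ∩ h.fin.inF x = h.fin.inF x :=
      Finset.eq_of_subset_of_card_le Finset.inter_subset_right (by rw [htri x y hxy, (hk x).2])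
    have := Finset.ext_iff.1 (h1.symm.trans h2) v
    simpa using this
  obtain ⟨x, y, z, hxy, hyz, hzx⟩ := h.exists_tri
  have outP0 : ∀ a, D.Adj a y → ∀ v, D.Adj a v ↔ D.Adj x v := by
    intro a ha v
    rw [key hzx, key ((key ha z).1 hyz)]
  have outP1 : ∀ b, D.Adj x b → ∀ v, D.Adj b v ↔ D.Adj v x := fun b hb v => key hb v
  have outP2 : ∀ c, D.Adj c x → ∀ v, D.Adj c v ↔ D.Adj v y := fun c hc v =>
    key ((key hxy c).2 hc) v
  have inP0 : ∀ a, D.Adj a y → ∀ v, D.Adj v a ↔ D.Adj v x := by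
    intro a ha v
    rw [← key ha, key hxy]
  have inP1 : ∀ b, D.Adj x b → ∀ v, D.Adj v b ↔ D.Adj v y := by
    intro b hb v
    rw [← key ((key hb z).2 hzx), key hyz]
  have inP2 : ∀ c, D.Adj c x → ∀ v, D.Adj v c ↔ D.Adj x v := fun c hc v => (key hc v).symm
  have cover : ∀ v, D.Adj v y ∨ D.Adj x v ∨ D.Adj v x := by
    refine h.conn.mem_of_closed (S := {v | D.Adj v y ∨ D.Adj x v ∨ D.Adj v x}) (Or.inl hxy) ?_
    rintro a (ha | ha | ha) b (hb | hb)
    · exact Or.inr (Or.inl ((outP0 a ha b).1 hb))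
    · exact Or.inr (Or.inr ((inP0 a ha b).1 hb))
    · exact Or.inr (Or.inr ((outP1 a ha b).1 hb))
    · exact Or.inl ((inP1 a ha b).1 hb)
    · exact Or.inl ((outP2 a ha b).1 hb)
    · exact Or.inr (Or.inl ((inP2 a ha b).1 hb))
  have d01 : ∀ v, D.Adj v y → ¬ D.Adj x v := by
    intro v h1 h2
    exact h.not_out h2 hxy h1
  have d12 : ∀ v, D.Adj x v → ¬ D.Adj v x := fun v => h.asymm x v
  have d02 : ∀ v, D.Adj v y → ¬ D.Adj v x := by
    intro v h1 h2
    exact h.not_out h2 h1 hxy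
  let π : V → ZMod 3 := fun v => if D.Adj v y then 0 else if D.Adj x v then 1 else 2
  have π0 : ∀ v, D.Adj v y ↔ π v = 0 := by
    intro v
    by_cases h1 : D.Adj v y
    · simp [π, h1]
    · by_cases h2 : D.Adj x v
      · simp [π, h1, h2]
      · simp only [π, h1, h2, if_false, false_iff]; decide
  have π1 : ∀ v, D.Adj x v ↔ π v = 1 := by
    intro v
    by_cases h1 : D.Adj v y
    · simp [π, h1, d01 v h1]
    · by_cases h2 : D.Adj x v
      · simp [π, h1, h2]
      · simp only [π, h1, h2, if_false, false_iff]; decide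
  have π2 : ∀ v, D.Adj v x ↔ π v = 2 := by
    intro v
    by_cases h1 : D.Adj v y
    · simp only [π, h1, if_true, d02 v h1, false_iff]; decide
    · by_cases h2 : D.Adj x v
      · simp only [π, h1, h2, if_true, if_false, d12 v h2, false_iff]; decide
      · have h3 := cover v
        simp only [h1, h2, false_or] at h3
        simp [π, h1, h2, h3]
  refine lexProduct_iso_of_partition π (fun u v => ?_) (fun i => ?_)
  · rcases cover u with hu | hu | hu
    · rw [outP0 u hu, π1, (π0 u).1 hu, zero_add]
    · rw [outP1 u hu, π2, (π1 u).1 hu]; rfl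
    · rw [outP2 u hu, π0, (π2 u).1 hu]; rfl
  · have three : ∀ i : ZMod 3, i = 0 ∨ i = 1 ∨ i = 2 := by decide
    rcases three i with rfl | rfl | rfl
    · exact ⟨h.fin.inF y, (hk y).2, fun v => by rw [h.fin.mem_inF, π0]⟩
    · exact ⟨h.fin.outF x, (hk x).1, fun v => by rw [h.fin.mem_outF, π1]⟩
    · exact ⟨h.fin.inF x, (hk x).2, fun v => by rw [h.fin.mem_inF, π2]⟩

end IsTriangular

end LocalStructure


/-! ### Bipartite reachability digraphs are induced subdigraphs -/

section Bipartite

variable {V : Type*} {D : Digraph V}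

namespace IsTriangular

variable (h : D.IsTriangular) (hbip : D.HasBipartiteReachDigraph)

include h hbip

theorem not_tail_tail {a b c d : V} (hab : D.Adj a b) (hr : D.Reach a b c d) : ¬ D.Adj a c :=
  fun hac => hbip.not_reach h.asymm (hr.adj hab) ((hr.symm hab).trans (Reach.refl.tail hac))

theorem not_head_head {a b c d : V} (hab : D.Adj a b) (hr : D.Reach a b c d) : ¬ D.Adj b d :=
  fun hbd => hbip.not_reach h.asymm hbd ((hr.head hbd).symm hab)

/-- An edge from a head to a tail would, by means of a triangle on it, produce a vertex that is
both a head and a tail. -/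
theorem not_head_tail {a b c d : V} (hab : D.Adj a b) (hr : D.Reach a b c d) :
    ¬ D.Adj b c := by
  intro hbc
  obtain ⟨v, hcv, hvb⟩ := h.exists_triangle hbc
  have h1 : D.Reach a b v b := Reach.refl.head hvb
  exact hbip.not_reach h.asymm hvb ((h1.symm hab).trans (hr.tail hcv))

end IsTriangular

end Bipartite

/-! ### Complements of perfect matchings -/

section ComplementMatching

variable {V : Type*} {D : Digraph V}

namespace IsTriangular

variable (h : D.IsTriangular) (hbip : D.HasBipartiteReachDigraph)

include h hbip

open scoped Classical in
/-- If every vertex `y ∈ N⁺(x)` misses exactly one vertex of `N⁻(x)`, then the out-neighbours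
outside `N⁻(x)` of all these `y` agree. -/
theorem extra_outNeighbour_agree {k : ℕ} (hk3 : 3 ≤ k)
    (hk : ∀ x, (h.fin.outF x).card = k ∧ (h.fin.inF x).card = k)
    (htri : ∀ x y, D.Adj x y → (h.fin.outF y ∩ h.fin.inF x).card + 1 = k)
    {x y y' w : V} (hy : D.Adj x y) (hy' : D.Adj x y') (hw : D.Adj y w) (hwx : ¬ D.Adj w x) :
    D.Adj y' w := by
  by_contra hyw
  have hne : y ≠ y' := by rintro rfl; exact hyw hw
  have miss : ∀ {x y}, D.Adj x y → ∃ z, D.Adj z x ∧ ∀ z', D.Adj z' x → (D.Adj y z' ↔ z' ≠ z) := by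
    intro x y hxy
    have h1 := Finset.card_sdiff_add_card_inter (h.fin.inF x) (h.fin.outF y)
    rw [Finset.inter_comm, (hk x).2] at h1
    have h2 := htri x y hxy
    obtain ⟨z, hz⟩ := Finset.card_eq_one.1
      (show (h.fin.inF x \ h.fin.outF y).card = 1 by omega)
    have hz' := fun v => Finset.ext_iff.1 hz v
    simp only [Finset.mem_sdiff, h.fin.mem_inF, h.fin.mem_outF, Finset.mem_singleton] at hz'
    refine ⟨z, ((hz' z).2 rfl).1, fun v hv => ?_⟩
    rw [← not_iff_not, not_not, ← hz']
    exact ⟨fun e => ⟨hv, e⟩, fun e => e.2⟩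
  have extra : ∀ {z x v v'}, D.Adj z x → D.Adj v z → ¬ D.Adj x v → D.Adj v' z → ¬ D.Adj x v' →
      v = v' := by
    intro z x v v' hzx hv hv1 hv' hv1'
    have h1 := Finset.card_sdiff_add_card_inter (h.fin.inF z) (h.fin.outF x)
    rw [Finset.inter_comm, (hk z).2] at h1
    have h2 := htri z x hzx
    exact Finset.card_le_one.1 (show (h.fin.inF z \ h.fin.outF x).card ≤ 1 by omega) v
      (by simp [hv, hv1]) v' (by simp [hv', hv1'])
  have extraOut : ∀ {x y v v'}, D.Adj x y → D.Adj y v → ¬ D.Adj v x → D.Adj y v' →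
      ¬ D.Adj v' x → v = v' := by
    intro x y v v' hxy hv hv1 hv' hv1'
    have h1 := Finset.card_sdiff_add_card_inter (h.fin.outF y) (h.fin.inF x)
    rw [(hk y).1] at h1
    have h2 := htri x y hxy
    exact Finset.card_le_one.1 (show (h.fin.outF y \ h.fin.inF x).card ≤ 1 by omega) v
      (by simp [hv, hv1]) v' (by simp [hv', hv1'])
  -- Distinct vertices with a common out-neighbour have fewer than `k - 1` of them in common.
  obtain ⟨z, hz, hyz⟩ := miss hy
  obtain ⟨z', hz', hyz'⟩ := miss hy'
  have hzz : z ≠ z' := by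
    rintro rfl
    -- Each vertex of `N⁻(x)` is missed by exactly one vertex of `N⁺(x)`.
    have h1 := Finset.card_sdiff_add_card_inter (h.fin.outF x) (h.fin.inF z)
    rw [(hk x).1] at h1
    have h2 := htri z x hz
    exact hne (Finset.card_le_one.1 (show (h.fin.outF x \ h.fin.inF z).card ≤ 1 by omega) y
      (by simp [hy, hyz z hz]) y' (by simp [hy', hyz' z hz]))
  have common : ∀ {a b v}, a ≠ b → D.Adj a v → D.Adj b v →
      (h.fin.outF a ∩ h.fin.outF b).card + 2 ≤ k := by
    have hsub : h.fin.outF y ∩ h.fin.outF y' ⊆ ((h.fin.inF x).erase z).erase z' := by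
      intro v hv
      simp only [Finset.mem_inter, h.fin.mem_outF] at hv
      have hvx : D.Adj v x := by
        by_contra hvx
        have := extraOut hy hw hwx hv.1 hvx
        exact hyw (this ▸ hv.2)
      simp only [Finset.mem_erase, h.fin.mem_inF]
      exact ⟨(hyz' v hvx).1 hv.2, (hyz v hvx).1 hv.1, hvx⟩
    have hcard : (((h.fin.inF x).erase z).erase z').card + 2 = k := by
      rw [Finset.card_erase_of_mem (by simp [hzz.symm, hz']),
        Finset.card_erase_of_mem (by simpa using hz), (hk x).2]
      omega
    obtain ⟨v₀, hv₀⟩ := Finset.card_pos.1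
      (show 0 < (((h.fin.inF x).erase z).erase z').card by omega)
    simp only [Finset.mem_erase, h.fin.mem_inF] at hv₀
    intro a b v hab ha hb
    obtain ⟨α, -, rfl, rfl⟩ := h.in_star_transitive ((hyz v₀ hv₀.2.2).2 hv₀.2.1)
      ((hyz' v₀ hv₀.2.2).2 hv₀.1) hne ha hb hab
    have : (h.fin.outF (α y) ∩ h.fin.outF (α y')).card =
        (h.fin.outF y ∩ h.fin.outF y').card := by
      symm
      refine Finset.card_bij (fun v _ => α v) ?_ (fun _ _ _ _ e => α.injective e) ?_
      · intro v hv
        simpa [α.map_rel_iff] using hv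
      · intro v hv
        refine ⟨α.symm v, ?_, by simp⟩
        rw [Finset.mem_inter, IsLocallyFinite.mem_outF, IsLocallyFinite.mem_outF,
          ← α.map_rel_iff, ← α.map_rel_iff (a := y')]
        simpa using hv
    rw [this]
    exact (Nat.add_le_add_right (Finset.card_le_card hsub) 2).trans hcard.le
  -- `q` is the in-neighbour of `z` outside `N⁺(x)`.
  have hq : ∃ q, D.Adj q z ∧ ¬ D.Adj x q := by
    have h1 := Finset.card_sdiff_add_card_inter (h.fin.inF z) (h.fin.outF x)
    rw [Finset.inter_comm, (hk z).2] at h1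
    have h2 := htri z x hz
    obtain ⟨q, hq⟩ := Finset.card_pos.1
      (show 0 < (h.fin.inF z \ h.fin.outF x).card by omega)
    exact ⟨q, by simpa using hq⟩
  obtain ⟨q, hqz, hxq⟩ := hq
  have hqz' : ¬ D.Adj q z' := by
    intro hqz'
    have hall : ∀ v, D.Adj v x → D.Adj q v := by
      intro v hv
      by_cases hvz : v = z
      · rw [hvz]; exact hqz
      · obtain ⟨α, hx, hαz, rfl⟩ := h.in_star_transitive hz hz' hzz hz hv (Ne.symm hvz)
        have h1 : D.Adj (α q) z := by rw [← hαz]; exact α.map_rel_iff.2 hqz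
        have h2 : ¬ D.Adj x (α q) := by
          intro hc
          rw [← hx] at hc
          exact hxq (α.map_rel_iff.1 hc)
        have := extra hz h1 h2 hqz hxq
        rw [← this]
        exact α.map_rel_iff.2 hqz'
    have hle := Finset.card_le_card (show h.fin.outF y ∩ h.fin.inF x ⊆
        h.fin.outF y ∩ h.fin.outF q from by
      intro v hv
      simp only [Finset.mem_inter, h.fin.mem_inF, h.fin.mem_outF] at hv ⊢
      exact ⟨hv.1, hall v hv.2⟩)
    have h1 := htri x y hy
    have h2 := common (a := y) (b := q) (v := z') (by rintro rfl; exact hxq hy)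
      ((hyz z' hz').2 hzz.symm) hqz'
    omega
  have hyz1 : D.Adj y' z := (hyz' z hz).2 hzz
  have ymiss : ∀ v, D.Adj x v → v ≠ y' → D.Adj v z' := by
    intro v hv hvy
    by_contra hc
    have h1 := Finset.card_sdiff_add_card_inter (h.fin.outF x) (h.fin.inF z')
    rw [(hk x).1] at h1
    have h2 := htri z' x hz'
    exact hvy (Finset.card_le_one.1 (show (h.fin.outF x \ h.fin.inF z').card ≤ 1 by omega) v
      (by simp [hv, hc]) y' (by simp [hy', hyz' z' hz']))
  have ymiss' : ∀ v, D.Adj x v → v ≠ y → D.Adj v z := by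
    intro v hv hvy
    by_contra hc
    have h1 := Finset.card_sdiff_add_card_inter (h.fin.outF x) (h.fin.inF z)
    rw [(hk x).1] at h1
    have h2 := htri z x hz
    exact hvy (Finset.card_le_one.1 (show (h.fin.outF x \ h.fin.inF z).card ≤ 1 by omega) v
      (by simp [hv, hc]) y (by simp [hy, hyz z hz]))
  obtain ⟨y₃, hy₃⟩ : (((h.fin.outF x).erase y).erase y').Nonempty := by
    rw [← Finset.card_pos, Finset.card_erase_of_mem (by simp [hne.symm, hy']),
      Finset.card_erase_of_mem (by simpa using hy), (hk x).1]
    omega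
  simp only [Finset.mem_erase, h.fin.mem_outF] at hy₃
  obtain ⟨h31, h32, h33⟩ := hy₃
  have h3z := ymiss' y₃ h33 h32
  have h3z' := ymiss y₃ h33 h31
  -- Apart from `y'`, the vertices of `N⁺(x)` determine `x`; but `y'` can be moved to `q`.
  let A : Set V := insert z ({z'} ∪ {v | D.Adj x v ∧ v ≠ y'})
  have hA : D.ConnSet A := by
    refine ConnSet.insert (ConnSet.union (connSet_singleton z') ?_) (a := y₃)
      (Or.inr ⟨h33, h31⟩) (Or.inl h3z)
    rintro b ⟨hb, hb'⟩
    exact ⟨z', rfl, Or.inr (ymiss b hb hb')⟩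
  have hAfin : A.Finite :=
    ((Set.finite_singleton z').union ((h.fin x).1.subset fun v hv => hv.1)).insert z
  have reachy : ∀ {u}, D.Adj u z → ∀ v, D.Adj x v → v ≠ y' → D.Reach u z v z' := fun hu v hv hv' =>
    ((Reach.refl.head h3z).tail h3z').head (ymiss v hv hv')
  have side : ∀ {u}, D.Adj u z → ¬ D.Adj u z' → ∀ a ∈ A,
      (D.Adj a u ↔ False) ∧ (D.Adj u a ↔ a = z) := by
    intro u hu hu' a ha
    rcases ha with rfl | rfl | ⟨ha, ha'⟩
    · exact ⟨iff_of_false (h.asymm _ _ hu) id, iff_of_true hu rfl⟩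
    · refine ⟨iff_of_false ?_ id, iff_of_false hu' hzz.symm⟩
      exact h.not_head_tail hbip h3z' ((Reach.refl.tail h3z).head hu)
    · have hr := reachy hu a ha ha'
      refine ⟨iff_of_false ?_ id, iff_of_false (h.not_tail_tail hbip hu hr) ?_⟩
      · exact h.not_tail_tail hbip (hr.adj hu) (hr.symm hu)
      · rintro rfl
        exact h.asymm _ _ ha hz
  obtain ⟨α, hα, hαy⟩ := h.hom.move h.asymm hAfin hA (u := y') (v := q)
    (by
      rintro (rfl | rfl | ⟨-, ha⟩)
      · exact h.asymm _ _ hy' hz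
      · exact h.asymm _ _ hy' hz'
      · exact ha rfl)
    (by
      rintro (rfl | rfl | ⟨ha, -⟩)
      · exact h.irrefl _ hqz
      · exact h.not_inn hz' hz hqz
      · exact hxq ha) ⟨z, Or.inl rfl, Or.inr hyz1⟩ (fun a ha => by
      have s1 := side hyz1 (fun e => (hyz' z' hz').1 e rfl) a ha
      have s2 := side hqz hqz' a ha
      exact ⟨s1.1.trans s2.1.symm, s1.2.trans s2.2.symm⟩)
  have hαx : α x = x := by
    by_contra hc
    have hsub : (h.fin.outF x).erase y' ⊆ h.fin.outF (α x) ∩ h.fin.outF x := by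
      intro v hv
      simp only [Finset.mem_erase, h.fin.mem_outF, Finset.mem_inter] at hv ⊢
      refine ⟨?_, hv.2⟩
      rw [← hα v (Or.inr (Or.inr ⟨hv.2, hv.1⟩))]
      exact α.map_rel_iff.2 hv.2
    have h1 := Finset.card_le_card hsub
    rw [Finset.card_erase_of_mem (by simpa using hy'), (hk x).1] at h1
    have h2 : D.Adj (α x) y := by
      rw [← hα y (Or.inr (Or.inr ⟨hy, hne⟩))]
      exact α.map_rel_iff.2 hy
    have := common hc h2 hy
    omega
  have := α.map_rel_iff.2 hy'
  rw [hαx, hαy] at this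
  exact hxq this

open scoped Classical in
/-- If the edges from `N⁺(x)` to `N⁻(x)` form the complement of a perfect matching, the digraph
is `Yₖ₊₁`. -/
theorem tripartiteY_iso {k : ℕ} (hk3 : 3 ≤ k)
    (hk : ∀ x, (h.fin.outF x).card = k ∧ (h.fin.inF x).card = k)
    (htri : ∀ x y, D.Adj x y → (h.fin.outF y ∩ h.fin.inF x).card + 1 = k) :
    D.IsIsomorphic (tripartiteY (k + 1)) := by
  have ex : ∀ x, ∃ w, ∀ u, D.Adj u w ↔ D.Adj x u := by
    intro x
    obtain ⟨y, hy⟩ := Finset.card_pos.1 (show 0 < (h.fin.outF x).card by rw [(hk x).1]; omega)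
    rw [h.fin.mem_outF] at hy
    have h1 := Finset.card_sdiff_add_card_inter (h.fin.outF y) (h.fin.inF x)
    rw [(hk y).1] at h1
    have h2 := htri x y hy
    obtain ⟨w, hw⟩ := Finset.card_pos.1
      (show 0 < (h.fin.outF y \ h.fin.inF x).card by omega)
    simp only [Finset.mem_sdiff, h.fin.mem_outF, h.fin.mem_inF] at hw
    refine ⟨w, fun u => ?_⟩
    have heq : h.fin.outF x = h.fin.inF w := by
      refine Finset.eq_of_subset_of_card_le (fun v hv => ?_) (by rw [(hk x).1, (hk w).2])
      rw [h.fin.mem_outF] at hv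
      rw [h.fin.mem_inF]
      exact h.extra_outNeighbour_agree hbip hk3 hk htri hy hv hw.1 hw.2
    rw [← h.fin.mem_inF, ← heq, h.fin.mem_outF]
  choose f hf using ex
  have hf' : ∀ x, ¬ D.Adj (f x) x := by
    intro x hc
    have h1 := htri _ _ hc
    have h2 : h.fin.outF x ∩ h.fin.inF (f x) = h.fin.outF x := by
      ext u
      simp [hf x u]
    rw [h2, (hk x).1] at h1
    omega
  obtain ⟨x₀, -⟩ := h.exists_tri
  let w := f x₀
  let y₀ := f w
  have hy₀ : ¬ D.Adj x₀ y₀ := by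
    rw [hf w x₀]
    exact hf' x₀
  have inX : ∀ x ∈ insert x₀ (h.fin.outF w), ∀ u, D.Adj u x → u ∈ insert w (h.fin.inF x₀) := by
    intro x hx u hu
    rw [Finset.mem_insert, h.fin.mem_outF] at hx
    rw [Finset.mem_insert, h.fin.mem_inF]
    rcases hx with rfl | hx
    · exact Or.inr hu
    by_contra hc
    push Not at hc
    obtain ⟨y, hy, hyne⟩ := Finset.exists_mem_ne
      (show 1 < (h.fin.outF x ∩ h.fin.inF u).card by have := htri u x hu; omega) y₀
    simp only [Finset.mem_inter, h.fin.mem_outF, h.fin.mem_inF] at hy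
    -- Only one out-neighbour of `x` is not an in-neighbour of `w`, namely `y₀`.
    have hyw : D.Adj y w := by
      by_contra hyw
      have h1 := Finset.card_sdiff_add_card_inter (h.fin.outF x) (h.fin.inF w)
      rw [(hk x).1] at h1
      have h2 := htri w x hx
      exact hyne (Finset.card_le_one.1
        (show (h.fin.outF x \ h.fin.inF w).card ≤ 1 by omega) y (by simp [hy.1, hyw]) y₀
        (by
          rw [Finset.mem_sdiff, h.fin.mem_outF, h.fin.mem_inF]
          exact ⟨(hf w x).2 hx, fun e => hy₀ ((hf x₀ y₀).1 e)⟩))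
    have hx₀y := (hf x₀ y).1 hyw
    have h1 := Finset.card_sdiff_add_card_inter (h.fin.outF y) (h.fin.inF x₀)
    rw [(hk y).1] at h1
    have h2 := htri x₀ y hx₀y
    exact hc.1 (Finset.card_le_one.1
      (show (h.fin.outF y \ h.fin.inF x₀).card ≤ 1 by omega) u (by simp [hy.2, hc.2]) w
      (by
        rw [Finset.mem_sdiff, h.fin.mem_outF, h.fin.mem_inF]
        exact ⟨hyw, hf' x₀⟩))
  have inY : ∀ y ∈ insert y₀ (h.fin.outF x₀), ∀ u, D.Adj u y →
      u ∈ insert x₀ (h.fin.outF w) := by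
    intro y hy u hu
    rw [Finset.mem_insert, h.fin.mem_outF] at hy
    rw [Finset.mem_insert, h.fin.mem_outF]
    rcases hy with rfl | hy
    · exact Or.inr ((hf w u).1 hu)
    by_contra hc
    push Not at hc
    have hyw : D.Adj y w := (hf x₀ y).2 hy
    have h1 := Finset.card_sdiff_add_card_inter (h.fin.inF y) (h.fin.outF w)
    rw [Finset.inter_comm, (hk y).2] at h1
    have h2 := htri y w hyw
    exact hc.1 (Finset.card_le_one.1
      (show (h.fin.inF y \ h.fin.outF w).card ≤ 1 by omega) u (by simp [hu, hc.2]) x₀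
      (by
        rw [Finset.mem_sdiff, h.fin.mem_outF, h.fin.mem_inF]
        exact ⟨hy, hf' x₀⟩))
  have cX : (insert x₀ (h.fin.outF w)).card = k + 1 := by
    rw [Finset.card_insert_of_notMem (by simpa using hf' x₀), (hk w).1]
  have cY : (insert y₀ (h.fin.outF x₀)).card = k + 1 := by
    rw [Finset.card_insert_of_notMem (by simpa using hy₀), (hk x₀).1]
  have cZ : (insert w (h.fin.inF x₀)).card = k + 1 := by
    rw [Finset.card_insert_of_notMem (by simpa using hf' x₀), (hk x₀).2]
  have inZ : ∀ z ∈ insert w (h.fin.inF x₀), ∀ u, D.Adj u z →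
      u ∈ insert y₀ (h.fin.outF x₀) := by
    intro z hz u hu
    obtain ⟨v, hzv, hvu⟩ := h.exists_triangle hu
    exact out_closed_of_in_closed h.fin hk (cX.trans cY.symm) inY v
      (out_closed_of_in_closed h.fin hk (cZ.trans cX.symm) inX z hz v hzv) u hvu
  exact tripartiteY_iso_of_partition h.fin h.conn (by omega) hk h.out cX cY cZ inX inY inZ f
    (fun x _ => hf x) (fun x _ => hf' x)

end IsTriangular

end ComplementMatching


/-! ### Excluding 4-cycles -/

section FourCycles

variable {V : Type*} {D : Digraph V}

namespace IsTriangular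

variable (h : D.IsTriangular) (hbip : D.HasBipartiteReachDigraph)

include h

open scoped Classical in
theorem triangle_unique (h1 : ∀ x y, D.Adj x y → (h.fin.outF y ∩ h.fin.inF x).card = 1)
    {x y z z' : V} (hxy : D.Adj x y) (hyz : D.Adj y z) (hzx : D.Adj z x) (hyz' : D.Adj y z')
    (hzx' : D.Adj z' x) : z = z' :=
  Finset.card_le_one.1 (h1 x y hxy).le z (by simp [hyz, hzx]) z' (by simp [hyz', hzx'])

open scoped Classical in
/-- Any two vertices with a common out-neighbour have `c` common out-neighbours, and any two
vertices with a common in-neighbour have equally many common in-neighbours. -/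
theorem exists_common_number {k : ℕ} (hk2 : 2 ≤ k)
    (hk : ∀ x, (h.fin.outF x).card = k ∧ (h.fin.inF x).card = k) :
    ∃ c, (∀ a b v, a ≠ b → D.Adj a v → D.Adj b v →
        (h.fin.outF a ∩ h.fin.outF b).card = c) ∧
      (∀ a b v, a ≠ b → D.Adj v a → D.Adj v b → (h.fin.inF a ∩ h.fin.inF b).card = c) := by
  obtain ⟨x, y, -, hxy, -, -⟩ := h.exists_tri
  obtain ⟨x₂, hx₂, hxx⟩ := Finset.exists_mem_ne
    (show 1 < (h.fin.inF y).card by rw [(hk y).2]; omega) x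
  obtain ⟨y₂, hy₂, hyy⟩ := Finset.exists_mem_ne
    (show 1 < (h.fin.outF x).card by rw [(hk x).1]; omega) y
  rw [h.fin.mem_inF] at hx₂
  rw [h.fin.mem_outF] at hy₂
  have hout : ∀ a b v, a ≠ b → D.Adj a v → D.Adj b v →
      (h.fin.outF a ∩ h.fin.outF b).card = (h.fin.outF x ∩ h.fin.outF x₂).card := by
    intro a b v hab ha hb
    obtain ⟨α, -, rfl, rfl⟩ := h.in_star_transitive ha hb hab hxy hx₂ hxx.symm
    refine Finset.card_bij (fun v _ => α v) ?_ (fun _ _ _ _ e => α.injective e) ?_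
    · intro v hv
      simpa [α.map_rel_iff] using hv
    · intro v hv
      refine ⟨α.symm v, ?_, by simp⟩
      rw [Finset.mem_inter, IsLocallyFinite.mem_outF, IsLocallyFinite.mem_outF,
        ← α.map_rel_iff, ← α.map_rel_iff (a := b)]
      simpa using hv
  have hin : ∀ a b v, a ≠ b → D.Adj v a → D.Adj v b →
      (h.fin.inF a ∩ h.fin.inF b).card = (h.fin.inF y ∩ h.fin.inF y₂).card := by
    intro a b v hab ha hb
    obtain ⟨α, -, rfl, rfl⟩ := h.out_star_transitive ha hb hab hxy hy₂ hyy.symm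
    refine Finset.card_bij (fun v _ => α v) ?_ (fun _ _ _ _ e => α.injective e) ?_
    · intro v hv
      simpa [α.map_rel_iff] using hv
    · intro v hv
      refine ⟨α.symm v, ?_, by simp⟩
      rw [Finset.mem_inter, IsLocallyFinite.mem_inF, IsLocallyFinite.mem_inF,
        ← α.map_rel_iff, ← α.map_rel_iff (b := b)]
      simpa using hv
  -- Count the alternating 4-cycles through the edge `x → y` in two ways.
  have hcount := Finset.sum_card_bipartiteAbove_eq_sum_card_bipartiteBelow
    (s := (h.fin.inF y).erase x) (t := (h.fin.outF x).erase y) D.Adj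
  rw [Finset.sum_const_nat (m := (h.fin.outF x ∩ h.fin.outF x₂).card - 1),
    Finset.sum_const_nat (m := (h.fin.inF y ∩ h.fin.inF y₂).card - 1),
    Finset.card_erase_of_mem (by simpa using hxy),
    Finset.card_erase_of_mem (by simpa using hxy), (hk x).1, (hk y).2] at hcount
  · have e1 := Nat.eq_of_mul_eq_mul_left (show 0 < k - 1 by omega) hcount
    have p1 : 0 < (h.fin.outF x ∩ h.fin.outF x₂).card :=
      Finset.card_pos.2 ⟨y, by simp [hxy, hx₂]⟩
    have p2 : 0 < (h.fin.inF y ∩ h.fin.inF y₂).card :=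
      Finset.card_pos.2 ⟨x, by simp [hxy, hy₂]⟩
    exact ⟨_, hout, fun a b v hab ha hb => (hin a b v hab ha hb).trans (by omega)⟩
  · intro b hb
    simp only [Finset.mem_erase, h.fin.mem_outF] at hb
    rw [← hin y b x (Ne.symm hb.1) hxy hb.2,
      ← Finset.card_erase_of_mem (show x ∈ h.fin.inF y ∩ h.fin.inF b by simp [hxy, hb.2])]
    congr 1
    ext v
    simp [and_assoc]
  · intro a ha
    simp only [Finset.mem_erase, h.fin.mem_inF] at ha
    rw [← hout x a y (Ne.symm ha.1) hxy ha.2,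
      ← Finset.card_erase_of_mem (show y ∈ h.fin.outF x ∩ h.fin.outF a by simp [hxy, ha.2])]
    congr 1
    ext v
    simp [and_assoc]

include hbip

theorem no_transitive_four_cycle {a b c d : V} (hab : D.Adj a b) (hbc : D.Adj b c)
    (hcd : D.Adj c d) (had : D.Adj a d) : False :=
  h.not_head_tail hbip hab ((Reach.refl.tail had).head hcd) hbc

open scoped Classical in
/-- If the number `c` of common out-neighbours satisfies `1 < c < k`, then `k = 2 * c`, and a
vertex `x` is determined by any `c + 1` of its out-neighbours; moving one of the other
out-neighbours gives a contradiction. -/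
theorem common_number_extreme {k c : ℕ}
    (hk : ∀ x, (h.fin.outF x).card = k ∧ (h.fin.inF x).card = k)
    (h1 : ∀ x y, D.Adj x y → (h.fin.outF y ∩ h.fin.inF x).card = 1)
    (hout : ∀ a b v, a ≠ b → D.Adj a v → D.Adj b v → (h.fin.outF a ∩ h.fin.outF b).card = c)
    (hin : ∀ a b v, a ≠ b → D.Adj v a → D.Adj v b → (h.fin.inF a ∩ h.fin.inF b).card = c)
    (hc1 : 1 < c) (hck : c < k) : False := by
  have tri := fun {x y z z' : V} => h.triangle_unique h1 (x := x) (y := y) (z := z) (z' := z')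
  have key : ∀ {x y₁ y₂ w u}, D.Adj x y₁ → D.Adj x y₂ → y₁ ≠ y₂ → D.Adj y₁ w → D.Adj w u →
      D.Adj u y₁ → (D.Adj y₂ w ↔ ¬ D.Adj u y₂) := by
    intro x y₁ y₂ w u hy₁ hy₂ hne hw hwu hu
    have fwd : ∀ {w u}, D.Adj y₁ w → D.Adj w u → D.Adj u y₁ → D.Adj u y₂ → ¬ D.Adj y₂ w :=
      fun hw hwu hu e2 e1 => hne (tri hwu hu hw e2 e1)
    refine ⟨fun e1 e2 => fwd hw hwu hu e2 e1, fun hu2 => ?_⟩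
    by_contra hw2
    obtain ⟨u₀, hu₀, hux⟩ := Finset.exists_mem_ne
      (show 1 < (h.fin.inF y₁ ∩ h.fin.inF y₂).card by rw [hin y₁ y₂ x hne hy₁ hy₂]; exact hc1) x
    simp only [Finset.mem_inter, h.fin.mem_inF] at hu₀
    obtain ⟨w₀, hw₀, hwu₀⟩ := h.exists_triangle hu₀.1
    have hw₀2 := fwd hw₀ hwu₀ hu₀.1 hu₀.2
    have notA : ∀ {v}, D.Adj y₁ v → v ∉ ({x, y₁, y₂} : Set V) := by
      rintro v hv (rfl | rfl | rfl)
      · exact h.asymm _ _ hy₁ hv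
      · exact h.irrefl _ hv
      · exact h.not_out hy₁ hy₂ hv
    have side : ∀ {w u}, D.Adj y₁ w → D.Adj w u → D.Adj u y₁ → u ≠ x → ¬ D.Adj y₂ w →
        ∀ a ∈ ({x, y₁, y₂} : Set V), (D.Adj a w ↔ a = y₁) ∧ (D.Adj w a ↔ False) := by
      rintro w u hw hwu hu hux hw2 a (rfl | rfl | rfl)
      · exact ⟨iff_of_false (fun e => h.not_out hy₁ e hw) (h.ne hy₁),
          iff_of_false (fun e => hux (tri hw hwu hu e hy₁)) id⟩
      · exact ⟨iff_of_true hw rfl, iff_of_false (h.asymm _ _ hw) id⟩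
      · exact ⟨iff_of_false hw2 hne.symm,
          iff_of_false (fun e => h.no_transitive_four_cycle hbip hy₁ hw e hy₂) id⟩
    have hconn : D.ConnSet ({x, y₁, y₂} : Set V) := by
      have h2 := (connSet_pair (D := D) (a := x) (b := y₁) (Or.inl hy₁)).insert
        (Or.inr rfl) (b := y₂) (Or.inl hy₂)
      convert h2 using 1
      ext v
      simp only [Set.mem_insert_iff, Set.mem_singleton_iff]
      tauto
    obtain ⟨α, hα, hαw⟩ := h.hom.move h.asymm (Set.toFinite _) hconn (notA hw₀) (notA hw)
      ⟨y₁, by simp, Or.inl hw₀⟩ (fun a ha => by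
        have s1 := side hw₀ hwu₀ hu₀.1 hux hw₀2 a ha
        have s2 := side hw hwu hu (by rintro rfl; exact hu2 hy₂) hw2 a ha
        exact ⟨s1.1.trans s2.1.symm, s1.2.trans s2.2.symm⟩)
    have e1 : D.Adj w (α u₀) := by rw [← hαw]; exact α.map_rel_iff.2 hwu₀
    have e2 : D.Adj (α u₀) y₁ := by
      have := α.map_rel_iff.2 hu₀.1
      rwa [hα y₁ (by simp)] at this
    have e3 : D.Adj (α u₀) y₂ := by
      have := α.map_rel_iff.2 hu₀.2
      rwa [hα y₂ (by simp)] at this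
    rw [tri hw e1 e2 hwu hu] at e3
    exact hu2 e3
  have third : ∀ a b, D.Adj a b → ∃ z, D.Adj b z ∧ D.Adj z a := fun a b => h.exists_triangle
  choose! T T1 T2 using third
  obtain ⟨x, y₁, -, hy₁, -, -⟩ := h.exists_tri
  obtain ⟨y₂, hy₂, hne⟩ := Finset.exists_mem_ne
    (show 1 < (h.fin.outF x).card by rw [(hk x).1]; omega) y₁
  rw [h.fin.mem_outF] at hy₂
  have hcard : (h.fin.outF y₁ ∩ h.fin.outF y₂).card = k - c := by
    have h2 : (h.fin.inF y₁ \ h.fin.inF y₂).card = k - c := by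
      have h3 := Finset.card_sdiff_add_card_inter (h.fin.inF y₁) (h.fin.inF y₂)
      rw [hin y₁ y₂ x hne.symm hy₁ hy₂, (hk y₁).2] at h3
      omega
    rw [← h2]
    refine Finset.card_bij (fun w _ => T y₁ w) ?_ ?_ ?_
    · intro w hw
      simp only [Finset.mem_inter, h.fin.mem_outF, Finset.mem_sdiff, h.fin.mem_inF] at hw ⊢
      exact ⟨T2 _ _ hw.1, (key hy₁ hy₂ hne.symm hw.1 (T1 _ _ hw.1) (T2 _ _ hw.1)).1 hw.2⟩
    · intro w hw w' hw' e
      simp only [Finset.mem_inter, h.fin.mem_outF] at hw hw'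
      have e1 := T1 _ _ hw'.1
      rw [← e] at e1
      exact tri (T2 _ _ hw.1) hw.1 (T1 _ _ hw.1) hw'.1 e1
    · intro u hu
      simp only [Finset.mem_sdiff, h.fin.mem_inF] at hu
      have e1 := T1 _ _ hu.1
      have e2 := T2 _ _ hu.1
      refine ⟨T u y₁, ?_, tri e1 (T1 _ _ e1) (T2 _ _ e1) e2 hu.1⟩
      simp only [Finset.mem_inter, h.fin.mem_outF]
      exact ⟨e1, (key hy₁ hy₂ hne.symm e1 e2 hu.1).2 hu.2⟩
  obtain ⟨w, hw⟩ := Finset.card_pos.1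
    (show 0 < (h.fin.outF y₁ ∩ h.fin.outF y₂).card by omega)
  simp only [Finset.mem_inter, h.fin.mem_outF] at hw
  have hkc : (h.fin.outF y₁ ∩ h.fin.outF y₂).card = c := hout y₁ y₂ w hne.symm hw.1 hw.2
  obtain ⟨w', hw', hww⟩ := Finset.exists_mem_ne
    (show 1 < (h.fin.outF y₁ ∩ h.fin.outF y₂).card by omega) w
  simp only [Finset.mem_inter, h.fin.mem_outF] at hw'
  have cM : ∀ v, D.Adj y₁ v → D.Adj y₂ v → (h.fin.inF v ∩ h.fin.outF x).card = c + 1 := by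
    intro v hv1 hv2
    have hu1 := T1 _ _ hv1
    have hu2 := T2 _ _ hv1
    have hux : x ≠ T y₁ v := by
      intro e
      refine (key hy₁ hy₂ hne.symm hv1 hu1 hu2).1 hv2 ?_
      rw [← e]
      exact hy₂
    have heq : h.fin.inF v ∩ h.fin.outF x =
        insert y₁ (h.fin.outF x \ h.fin.outF (T y₁ v)) := by
      ext y
      simp only [Finset.mem_inter, h.fin.mem_inF, h.fin.mem_outF, Finset.mem_insert,
        Finset.mem_sdiff]
      by_cases hy : y = y₁
      · subst hy
        simp [hv1, hy₁]
      · constructor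
        · rintro ⟨e1, e2⟩
          exact Or.inr ⟨e2, (key hy₁ e2 (Ne.symm hy) hv1 hu1 hu2).1 e1⟩
        · rintro (e | ⟨e1, e2⟩)
          · exact absurd e hy
          · exact ⟨(key hy₁ e1 (Ne.symm hy) hv1 hu1 hu2).2 e2, e1⟩
    have h3 := Finset.card_sdiff_add_card_inter (h.fin.outF x) (h.fin.outF (T y₁ v))
    rw [hout x _ y₁ hux hy₁ hu2, (hk x).1] at h3
    rw [heq, Finset.card_insert_of_notMem (by simp [hu2])]
    omega
  have cw := cM w hw.1 hw.2
  have cw' := cM w' hw'.1 hw'.2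
  have hinw : (h.fin.inF w ∩ h.fin.inF w').card = c := hin w w' y₁ hww.symm hw.1 hw'.1
  obtain ⟨y₃, hy₃, hy₃'⟩ : ∃ y₃ ∈ h.fin.inF w ∩ h.fin.outF x, ¬ D.Adj y₃ w' := by
    by_contra hcon
    push Not at hcon
    have := Finset.card_le_card (show h.fin.inF w ∩ h.fin.outF x ⊆ h.fin.inF w ∩ h.fin.inF w' from
      fun v hv => Finset.mem_inter.2
        ⟨(Finset.mem_inter.1 hv).1, h.fin.mem_inF.2 (hcon v hv)⟩)
    omega
  simp only [Finset.mem_inter, h.fin.mem_inF, h.fin.mem_outF] at hy₃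
  have hlt : ((h.fin.inF w ∩ h.fin.outF x) \ h.fin.inF w').card <
      (h.fin.inF w \ h.fin.inF w').card := by
    have e1 := Finset.card_sdiff_add_card_inter (h.fin.inF w) (h.fin.inF w')
    have e2 := Finset.card_sdiff_add_card_inter (h.fin.inF w ∩ h.fin.outF x) (h.fin.inF w')
    have e3 : 1 < ((h.fin.inF w ∩ h.fin.outF x) ∩ h.fin.inF w').card :=
      Finset.one_lt_card.2 ⟨y₁, by simp [hw, hw', hy₁], y₂, by simp [hw, hw', hy₂], hne.symm⟩
    rw [(hk w).2] at e1
    omega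
  obtain ⟨q, hq, hq'⟩ := Finset.exists_mem_notMem_of_card_lt_card hlt
  simp only [Finset.mem_sdiff, Finset.mem_inter, h.fin.mem_inF, h.fin.mem_outF] at hq hq'
  have hxq : ¬ D.Adj x q := fun e => hq' ⟨⟨hq.1, e⟩, hq.2⟩
  let A : Set V := insert w ({w'} ∪ {v | D.Adj x v ∧ D.Adj v w'})
  have hA : D.ConnSet A := by
    refine ConnSet.insert (ConnSet.union (connSet_singleton w') ?_) (a := y₁)
      (Or.inr ⟨hy₁, hw'.1⟩) (Or.inl hw.1)
    rintro b ⟨-, hb⟩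
    exact ⟨w', rfl, Or.inr hb⟩
  have hAfin : A.Finite :=
    ((Set.finite_singleton w').union ((h.fin x).1.subset fun v hv => hv.1)).insert w
  have side : ∀ {u}, D.Adj u w → ¬ D.Adj u w' → ∀ a ∈ A,
      (D.Adj a u ↔ False) ∧ (D.Adj u a ↔ a = w) := by
    intro u hu hu' a ha
    rcases ha with rfl | rfl | ⟨ha, ha'⟩
    · exact ⟨iff_of_false (h.asymm _ _ hu) id, iff_of_true hu rfl⟩
    · refine ⟨iff_of_false ?_ id, iff_of_false hu' hww⟩
      exact h.not_head_tail hbip hw'.1 ((Reach.refl.tail hw.1).head hu)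
    · have hr : D.Reach u w a w' := ((Reach.refl.head hw.1).tail hw'.1).head ha'
      refine ⟨iff_of_false ?_ id, iff_of_false (h.not_tail_tail hbip hu hr) ?_⟩
      · exact h.not_tail_tail hbip (hr.adj hu) (hr.symm hu)
      · rintro rfl
        exact h.not_out hy₁ ha hw.1
  obtain ⟨α, hα, hαy⟩ := h.hom.move h.asymm hAfin hA (u := y₃) (v := q)
    (by
      rintro (rfl | rfl | ⟨-, ha⟩)
      · exact h.irrefl _ hy₃.1
      · exact h.not_out hy₁ hy₃.2 hw'.1
      · exact hy₃' ha)
    (by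
      rintro (rfl | rfl | ⟨ha, -⟩)
      · exact h.irrefl _ hq.1
      · exact h.not_out hw'.1 hw.1 hq.1
      · exact hxq ha) ⟨w, Or.inl rfl, Or.inr hy₃.1⟩ (fun a ha => by
      have s1 := side hy₃.1 hy₃' a ha
      have s2 := side hq.1 hq.2 a ha
      exact ⟨s1.1.trans s2.1.symm, s1.2.trans s2.2.symm⟩)
  have hαM : ∀ v, D.Adj x v → D.Adj v w' → D.Adj (α x) v := by
    intro v hv hv'
    have := α.map_rel_iff.2 hv
    rwa [hα v (Or.inr (Or.inr ⟨hv, hv'⟩))] at this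
  have hαx : α x = x := by
    by_contra hc
    have hle := Finset.card_le_card (show h.fin.inF w' ∩ h.fin.outF x ⊆
        h.fin.outF (α x) ∩ h.fin.outF x from by
      intro v hv
      simp only [Finset.mem_inter, h.fin.mem_inF, h.fin.mem_outF] at hv ⊢
      exact ⟨hαM v hv.2 hv.1, hv.2⟩)
    have := hout (α x) x y₁ hc (hαM y₁ hy₁ hw'.1) hy₁
    omega
  have := α.map_rel_iff.2 hy₃.2
  rw [hαx, hαy] at this
  exact hxq this

omit hbip in
open scoped Classical in
/-- The reachability digraphs are not complete bipartite: the digraph would be the line digraph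
of `C₃[K̄ₖ]`, which is not C-homogeneous for `k ≥ 3`. -/
theorem common_number_ne {k : ℕ} (hk3 : 3 ≤ k)
    (hk : ∀ x, (h.fin.outF x).card = k ∧ (h.fin.inF x).card = k)
    (h1 : ∀ x y, D.Adj x y → (h.fin.outF y ∩ h.fin.inF x).card = 1)
    (hout : ∀ a b v, a ≠ b → D.Adj a v → D.Adj b v → (h.fin.outF a ∩ h.fin.outF b).card = k)
    (hin : ∀ a b v, a ≠ b → D.Adj v a → D.Adj v b → (h.fin.inF a ∩ h.fin.inF b).card = k) :
    False := by
  have tri := fun {x y z z' : V} => h.triangle_unique h1 (x := x) (y := y) (z := z) (z' := z')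
  have sameOut : ∀ {a b v}, D.Adj a v → D.Adj b v → ∀ u, D.Adj a u → D.Adj b u := by
    intro a b v ha hb u hu
    by_cases e : a = b
    · rwa [← e]
    · have h2 := Finset.eq_of_subset_of_card_le
        (Finset.inter_subset_left (s₁ := h.fin.outF a) (s₂ := h.fin.outF b))
        (by rw [hout a b v e ha hb, (hk a).1])
      have h3 : u ∈ h.fin.outF a ∩ h.fin.outF b := by
        rw [h2]; exact h.fin.mem_outF.2 hu
      exact h.fin.mem_outF.1 (Finset.mem_inter.1 h3).2
  have sameIn : ∀ {a b v}, D.Adj v a → D.Adj v b → ∀ u, D.Adj u a → D.Adj u b := by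
    intro a b v ha hb u hu
    by_cases e : a = b
    · rwa [← e]
    · have h2 := Finset.eq_of_subset_of_card_le
        (Finset.inter_subset_left (s₁ := h.fin.inF a) (s₂ := h.fin.inF b))
        (by rw [hin a b v e ha hb, (hk a).2])
      have h3 : u ∈ h.fin.inF a ∩ h.fin.inF b := by
        rw [h2]; exact h.fin.mem_inF.2 hu
      exact h.fin.mem_inF.1 (Finset.mem_inter.1 h3).2
  obtain ⟨x, y₁, -, hy₁, -, -⟩ := h.exists_tri
  obtain ⟨y₂, hy₂, hne⟩ := Finset.exists_mem_ne
    (show 1 < (h.fin.outF x).card by rw [(hk x).1]; omega) y₁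
  rw [h.fin.mem_outF] at hy₂
  obtain ⟨x₂, hx₂, hxx₂⟩ := Finset.exists_mem_ne
    (show 1 < (h.fin.inF y₁).card by rw [(hk y₁).2]; omega) x
  obtain ⟨x₃, hx₃⟩ : (((h.fin.inF y₁).erase x).erase x₂).Nonempty := by
    rw [← Finset.card_pos, Finset.card_erase_of_mem (by simp [hxx₂, hx₂]),
      Finset.card_erase_of_mem (by simpa using hy₁), (hk y₁).2]
    omega
  simp only [Finset.mem_erase, h.fin.mem_inF] at hx₃ hx₂
  obtain ⟨hx₃₂, hxx₃, hx₃⟩ := hx₃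
  have hx₂' := sameIn hy₁ hy₂ x₂ hx₂
  have hx₃' := sameIn hy₁ hy₂ x₃ hx₃
  -- `zᵢₐ` is the third vertex of the triangle on the edge `xₐ → yᵢ`.
  obtain ⟨z₁₂, a1, a2⟩ := h.exists_triangle hx₂
  obtain ⟨z₂₂, b1, b2⟩ := h.exists_triangle hx₂'
  obtain ⟨z₂₃, c1, c2⟩ := h.exists_triangle hx₃'
  let A : Set V := {z₁₂, y₂, y₁, x}
  have hA : D.ConnSet A :=
    ((connSet_pair (D := D) (a := x) (b := y₁) (Or.inl hy₁)).insert (a := x) (Or.inr rfl)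
      (b := y₂) (Or.inl hy₂)).insert (a := y₁) (Or.inr (Or.inl rfl)) (Or.inl a1)
  have side : ∀ {z x'}, D.Adj x' y₁ → D.Adj x' y₂ → x' ≠ x → D.Adj y₂ z → D.Adj z x' →
      ¬ D.Adj z₁₂ z → ¬ D.Adj z z₁₂ → ∀ a ∈ A, (D.Adj a z ↔ a = y₂) ∧ (D.Adj z a ↔ False) := by
    rintro z x' hx1 hx2 hxx hyz hzx n1 n2 a (rfl | rfl | rfl | rfl)
    · refine ⟨iff_of_false n1 ?_, iff_of_false n2 id⟩
      rintro rfl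
      exact h.not_out hy₁ hy₂ a1
    · exact ⟨iff_of_true hyz rfl, iff_of_false (h.asymm _ _ hyz) id⟩
    · refine ⟨iff_of_false (fun e => hne (tri hzx hx2 hyz hx1 e)) hne.symm,
        iff_of_false (fun e => ?_) id⟩
      exact h.asymm _ _ hyz (sameIn hy₁ hy₂ z e)
    · exact ⟨iff_of_false (fun e => h.not_out hy₂ e hyz) (h.ne hy₂),
        iff_of_false (fun e => hxx (tri hyz hzx hx2 e hy₂)) id⟩
  have n1 : ¬ D.Adj z₁₂ z₂₂ := fun e => h.irrefl _ (sameOut a2 b2 z₂₂ e)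
  have n2 : ¬ D.Adj z₂₂ z₁₂ := fun e => h.irrefl _ (sameOut b2 a2 z₁₂ e)
  have n3 : ¬ D.Adj z₁₂ z₂₃ := fun e => h.asymm _ _ hx₂' (sameIn e a2 y₂ c1)
  have n4 : ¬ D.Adj z₂₃ z₁₂ := fun e => h.asymm _ _ hx₃ (sameIn e c2 y₁ a1)
  have notA : ∀ {z}, D.Adj y₂ z → z ≠ z₁₂ → z ∉ A := by
    rintro z hz hzz (rfl | rfl | rfl | rfl)
    · exact hzz rfl
    · exact h.irrefl _ hz
    · exact h.not_out hy₂ hy₁ hz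
    · exact h.asymm _ _ hy₂ hz
  obtain ⟨α, hα, hαz⟩ := h.hom.move h.asymm (Set.toFinite A) hA
    (notA b1 (by rintro rfl; exact hne (tri b2 hx₂' b1 hx₂ a1)))
    (notA c1 (by rintro rfl; exact hx₃₂ (tri a1 c2 hx₃ a2 hx₂)))
    ⟨y₂, Or.inr (Or.inl rfl), Or.inl b1⟩ (fun a ha => by
      have s1 := side hx₂ hx₂' hxx₂ b1 b2 n1 n2 a ha
      have s2 := side hx₃ hx₃' hxx₃ c1 c2 n3 n4 a ha
      exact ⟨s1.1.trans s2.1.symm, s1.2.trans s2.2.symm⟩)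
  have e1 : D.Adj z₁₂ (α x₂) := by
    have := α.map_rel_iff.2 a2
    rwa [hα z₁₂ (Or.inl rfl)] at this
  have e2 : D.Adj z₂₃ (α x₂) := by
    have := α.map_rel_iff.2 b2
    rwa [hαz] at this
  exact hx₃₂ (tri c1 c2 hx₃' (sameOut e1 e2 x₂ a2) hx₂')

/-- There are no alternating 4-cycles. -/
theorem no_alternating_four_cycle {k : ℕ} (hk3 : 3 ≤ k)
    (hk : ∀ x, (h.fin.outF x).card = k ∧ (h.fin.inF x).card = k)
    (h1 : ∀ x y z z', D.Adj x y → D.Adj y z → D.Adj z x → D.Adj y z' → D.Adj z' x → z = z')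
    {a b v w : V} (hab : a ≠ b) (hav : D.Adj a v) (hbv : D.Adj b v) (haw : D.Adj a w)
    (hbw : D.Adj b w) : v = w := by
  classical
  have h1' : ∀ x y, D.Adj x y → (h.fin.outF y ∩ h.fin.inF x).card = 1 := by
    intro x y hxy
    obtain ⟨z, hz, hz'⟩ := h.exists_triangle hxy
    refine Finset.card_eq_one.2 ⟨z, ?_⟩
    ext u
    simp only [Finset.mem_inter, h.fin.mem_outF, h.fin.mem_inF, Finset.mem_singleton]
    exact ⟨fun hu => h1 _ _ _ _ hxy hu.1 hu.2 hz hz', by rintro rfl; exact ⟨hz, hz'⟩⟩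
  obtain ⟨c, hout, hin⟩ := h.exists_common_number (by omega) hk
  have hc := hout a b v hab hav hbv
  have hck : c ≤ k := by
    rw [← hc, ← (hk a).1]
    exact Finset.card_le_card Finset.inter_subset_left
  rcases hck.lt_or_eq with hlt | rfl
  · by_contra hvw
    refine h.common_number_extreme hbip hk h1' hout hin ?_ hlt
    rw [← hc]
    exact Finset.one_lt_card.2 ⟨v, by simp [hav, hbv], w, by simp [haw, hbw], hvw⟩
  · exact (h.common_number_ne hk3 hk h1' hout hin).elim

end IsTriangular

end FourCycles


section SquareFree

variable {V : Type*} {D : Digraph V}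

/-- Triangular digraphs in which the underlying undirected graph has no cycles of length `4`, so that
triangles are edge-disjoint, and all in- and outdegrees are at least `3`. The degree condition is
stated as the existence of a neighbour different from two given vertices. -/
structure IsSquareFree (D : Digraph V) : Prop extends IsTriangular D where
  out_many : ∀ x e₁ e₂, ∃ p, D.Adj x p ∧ p ≠ e₁ ∧ p ≠ e₂
  in_many : ∀ x e₁ e₂, ∃ p, D.Adj p x ∧ p ≠ e₁ ∧ p ≠ e₂
  no_square : ∀ a b c d, D.Link a b → D.Link b c → D.Link c d → D.Link d a →
    a ≠ c → b ≠ d → False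

namespace IsTriangular

variable (h : D.IsTriangular) (hbip : D.HasBipartiteReachDigraph)
  (tri : ∀ x y z z', D.Adj x y → D.Adj y z → D.Adj z x → D.Adj y z' → D.Adj z' x → z = z')
  (alt : ∀ a b v w, a ≠ b → D.Adj a v → D.Adj b v → D.Adj a w → D.Adj b w → v = w)

include h hbip tri alt

/-- Two vertices are joined by at most one directed path of length two. -/
theorem no_two_paths (in_many : ∀ x e₁ e₂, ∃ p, D.Adj p x ∧ p ≠ e₁ ∧ p ≠ e₂)
    {a b b' c : V} (hab : D.Adj a b) (hbc : D.Adj b c) (hab' : D.Adj a b') (hbc' : D.Adj b' c) :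
    b = b' := by
  by_contra hne
  have hca : ¬ D.Adj c a := fun hca => hne (tri _ _ _ _ hca hab hbc hab' hbc')
  have double : ∀ {x y z}, D.Adj x y → D.Adj y z → ¬ D.Adj z x →
      ∃ y', y' ≠ y ∧ D.Adj x y' ∧ D.Adj y' z := by
    intro x y z hxy hyz hzx
    obtain ⟨α, rfl, rfl, rfl⟩ := h.path_transitive hab hbc hca hxy hyz hzx
    exact ⟨α b', fun e => hne (α.injective e).symm, α.map_rel_iff.2 hab', α.map_rel_iff.2 hbc'⟩
  obtain ⟨x₁, hx₁, -, -⟩ := in_many b b b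
  obtain ⟨x₂, hx₂, h21, -⟩ := in_many b x₁ x₁
  obtain ⟨x₃, hx₃, h31, h32⟩ := in_many b x₁ x₂
  obtain ⟨z₂, hz₂, hzx₂⟩ := h.exists_triangle hx₂
  obtain ⟨z₃, hz₃, hzx₃⟩ := h.exists_triangle hx₃
  -- `yᵢⱼ` is the second midpoint between `xᵢ` and `zⱼ`.
  obtain ⟨y₁₃, n13, p13, q13⟩ := double hx₁ hz₃ (fun e => h31 (tri _ _ _ _ hz₃ hzx₃ hx₃ e hx₁))
  obtain ⟨y₂₃, n23, p23, q23⟩ := double hx₂ hz₃ (fun e => h32 (tri _ _ _ _ hz₃ hzx₃ hx₃ e hx₂))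
  obtain ⟨y₁₂, n12, p12, q12⟩ := double hx₁ hz₂ (fun e => h21 (tri _ _ _ _ hz₂ hzx₂ hx₂ e hx₁))
  let A : Set V := {y₂₃, x₂, x₁, b}
  have hA : D.ConnSet A :=
    ((connSet_pair (D := D) (a := b) (b := x₁) (Or.inr hx₁)).insert (a := b) (Or.inr rfl)
      (b := x₂) (Or.inr hx₂)).insert (a := x₂) (Or.inl rfl) (Or.inl p23)
  have nx₂ : ∀ {u}, D.Adj x₁ u → u ≠ b → ¬ D.Adj x₂ u := fun hu hub e =>
    hub (alt _ _ _ _ h21.symm hu e hx₁ hx₂)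
  have side : ∀ {u}, D.Adj x₁ u → u ≠ b → ∀ a ∈ A, (D.Adj a u ↔ a = x₁) ∧
      (D.Adj u a ↔ False) := by
    intro u hu hub a ha
    have hr : D.Reach x₁ u x₂ b := (Reach.refl.tail hx₁).head hx₂
    have hr' : D.Reach x₁ u x₂ y₂₃ := hr.tail p23
    rcases ha with rfl | rfl | rfl | rfl
    · refine ⟨iff_of_false (h.not_head_head hbip p23 (hr'.symm hu)) ?_,
        iff_of_false (h.not_head_head hbip hu hr') id⟩
      rintro rfl
      exact h.not_inn hx₂ hx₁ p23
    · exact ⟨iff_of_false (nx₂ hu hub) h21, iff_of_false (h.not_head_tail hbip hu hr) id⟩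
    · exact ⟨iff_of_true hu rfl, iff_of_false (h.asymm _ _ hu) id⟩
    · exact ⟨iff_of_false (h.not_out hx₁ hu) (h.ne hx₁).symm,
        iff_of_false (h.not_out hu hx₁) id⟩
  have notA : ∀ {u}, D.Adj x₁ u → u ≠ b → u ∉ A := by
    rintro u hu hub (rfl | rfl | rfl | rfl)
    · exact nx₂ hu hub p23
    · exact h.not_inn hx₁ hx₂ hu
    · exact h.irrefl _ hu
    · exact hub rfl
  obtain ⟨α, hα, hαy⟩ := h.hom.move h.asymm (Set.toFinite A) hA (notA p13 n13) (notA p12 n12)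
    ⟨x₁, Or.inr (Or.inr (Or.inl rfl)), Or.inl p13⟩ (fun a ha => by
      have s1 := side p13 n13 a ha
      have s2 := side p12 n12 a ha
      exact ⟨s1.1.trans s2.1.symm, s1.2.trans s2.2.symm⟩)
  have e1 := α.map_rel_iff.2 hz₃
  rw [hα b (Or.inr (Or.inr (Or.inr rfl)))] at e1
  have e2 := α.map_rel_iff.2 q23
  rw [hα y₂₃ (Or.inl rfl)] at e2
  have e3 := α.map_rel_iff.2 q13
  rw [hαy, alt _ _ _ _ n23 e2 e1 q23 hz₃] at e3
  have e4 := alt _ _ _ _ n12 e3 hz₃ q12 hz₂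
  subst e4
  exact h32 (tri _ _ _ _ hz₃ hzx₃ hx₃ hzx₂ hx₂)

open scoped Classical in
theorem no_directed_four_cycle {k : ℕ}
    (hk : ∀ x, (h.fin.outF x).card = k ∧ (h.fin.inF x).card = k)
    (in_many : ∀ x e₁ e₂, ∃ p, D.Adj p x ∧ p ≠ e₁ ∧ p ≠ e₂)
    {a b c d : V} (hab : D.Adj a b) (hbc : D.Adj b c) (hcd : D.Adj c d) (hda : D.Adj d a) :
    False := by
  have two := fun {a b b' c : V} => h.no_two_paths hbip tri alt in_many (a := a) (b := b)
    (b' := b') (c := c)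
  have hca : ¬ D.Adj c a := fun hca => h.not_out hcd hca hda
  have close : ∀ {x y z}, D.Adj x y → D.Adj y z → ¬ D.Adj z x →
      ∃ v, D.Adj z v ∧ D.Adj v x := by
    intro x y z hxy hyz hzx
    obtain ⟨α, rfl, rfl, rfl⟩ := h.path_transitive hab hbc hca hxy hyz hzx
    exact ⟨α d, α.map_rel_iff.2 hcd, α.map_rel_iff.2 hda⟩
  -- Each out-neighbour of `x` contributes an in-neighbour of `z`, so it contributes only one.
  have uniq : ∀ {z x y v v'}, D.Adj z x → D.Adj x y → ¬ D.Adj y z → D.Adj y v → D.Adj v z →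
      D.Adj y v' → D.Adj v' z → v = v' := by
    intro z x y v v' hzx hxy hyz hv hvz hv' hvz'
    have exg : ∀ y, D.Adj x y → ∃ g, D.Adj g z ∧ (g = y ∨ D.Adj y g) := by
      intro y hy
      by_cases hyz : D.Adj y z
      · exact ⟨y, hyz, Or.inl rfl⟩
      · obtain ⟨g, hg, hg'⟩ := close hzx hy hyz
        exact ⟨g, hg', Or.inr hg⟩
    choose! g g1 g2 using exg
    have ginj : ∀ y y' w w', D.Adj x y → D.Adj x y' → (w = y ∨ D.Adj y w) →
        (w' = y' ∨ D.Adj y' w') → w = w' → y = y' := by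
      rintro y y' w w' hy hy' (rfl | hw) (rfl | hw') e
      · exact e
      · rw [← e] at hw'
        exact absurd hw' (h.not_out hy' hy)
      · rw [e] at hw
        exact absurd hw (h.not_out hy hy')
      · rw [← e] at hw'
        exact two hy hw hy' hw'
    have gsurj := Finset.surj_on_of_inj_on_of_card_le (s := h.fin.outF x) (t := h.fin.inF z)
      (fun y _ => g y) (fun y hy => by simpa using g1 y (by simpa using hy))
      (fun y y' hy hy' e => ginj y y' (g y) (g y') (by simpa using hy) (by simpa using hy')
        (g2 y (by simpa using hy)) (g2 y' (by simpa using hy')) e)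
      (by rw [(hk x).1, (hk z).2])
    have all : ∀ w, D.Adj y w → D.Adj w z → w = g y := by
      intro w hw hwz
      obtain ⟨y', hy', e⟩ := gsurj w (by simpa using hwz)
      rw [h.fin.mem_outF] at hy'
      rw [e, ginj y y' w (g y') hxy hy' (Or.inr hw) (g2 y' hy') e]
    rw [all v hv hvz, all v' hv' hvz']
  obtain ⟨z₁, hz₁, -, -⟩ := in_many a a a
  obtain ⟨z₂, hz₂, h21, -⟩ := in_many a z₁ z₁
  obtain ⟨z₃, hz₃, h31, h32⟩ := in_many a z₁ z₂
  obtain ⟨y₁, hy₁, hyz₁⟩ := h.exists_triangle hz₁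
  obtain ⟨y₂, hy₂, hyz₂⟩ := h.exists_triangle hz₂
  have hne : y₁ ≠ y₂ := by
    rintro rfl
    exact h21 (tri _ _ _ _ hy₁ hyz₂ hz₂ hyz₁ hz₁)
  have n12 : ¬ D.Adj y₁ z₂ := fun e => h21 (tri _ _ _ _ hy₁ e hz₂ hyz₁ hz₁)
  have n13 : ¬ D.Adj y₁ z₃ := fun e => h31 (tri _ _ _ _ hy₁ e hz₃ hyz₁ hz₁)
  have n21 : ¬ D.Adj y₂ z₁ := fun e => h21 (tri _ _ _ _ hy₂ hyz₂ hz₂ e hz₁)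
  have n23 : ¬ D.Adj y₂ z₃ := fun e => h32 (tri _ _ _ _ hy₂ e hz₃ hyz₂ hz₂)
  obtain ⟨w₁₂, p12, q12⟩ := close hz₂ hy₁ n12
  obtain ⟨w₁₃, p13, q13⟩ := close hz₃ hy₁ n13
  obtain ⟨w₂₁, p21, q21⟩ := close hz₁ hy₂ n21
  obtain ⟨w₂₃, p23, q23⟩ := close hz₃ hy₂ n23
  -- An automorphism that exchanges `y₁` and `y₂` also exchanges `w₁₂` and `w₂₁`.
  have nonadj : ¬ D.Adj w₁₂ w₂₁ ∧ ¬ D.Adj w₂₁ w₁₂ := by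
    obtain ⟨σ, sa, s1, s2⟩ := h.out_star_transitive hy₁ hy₂ hne hy₂ hy₁ hne.symm
    have t1 : σ z₁ = z₂ := by
      have e1 := σ.map_rel_iff.2 hyz₁
      have e2 := σ.map_rel_iff.2 hz₁
      rw [s1] at e1
      rw [sa] at e2
      exact tri _ _ _ _ hy₂ e1 e2 hyz₂ hz₂
    have t2 : σ z₂ = z₁ := by
      have e1 := σ.map_rel_iff.2 hyz₂
      have e2 := σ.map_rel_iff.2 hz₂
      rw [s2] at e1
      rw [sa] at e2
      exact tri _ _ _ _ hy₁ e1 e2 hyz₁ hz₁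
    have u1 : σ w₁₂ = w₂₁ := by
      have e1 := σ.map_rel_iff.2 p12
      have e2 := σ.map_rel_iff.2 q12
      rw [s1] at e1
      rw [t2] at e2
      exact uniq hz₁ hy₂ n21 e1 e2 p21 q21
    have u2 : σ w₂₁ = w₁₂ := by
      have e1 := σ.map_rel_iff.2 p21
      have e2 := σ.map_rel_iff.2 q21
      rw [s2] at e1
      rw [t1] at e2
      exact uniq hz₂ hy₁ n12 e1 e2 p12 q12
    constructor
    · intro e
      have := σ.map_rel_iff.2 e
      rw [u1, u2] at this
      exact h.asymm _ _ e this
    · intro e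
      have := σ.map_rel_iff.2 e
      rw [u1, u2] at this
      exact h.asymm _ _ e this
  have side : ∀ {y y' w z}, D.Adj a y → D.Adj a y' → y ≠ y' → D.Adj y w → D.Adj w z →
      D.Adj z a → ∀ v ∈ ({y', y, a} : Set V), (D.Adj v w ↔ v = y) ∧ (D.Adj w v ↔ False) ∧
        w ≠ v := by
    rintro y y' w z hy hy' hne hw hwz hza v (rfl | rfl | rfl)
    · refine ⟨iff_of_false (fun e => hne (two hy hw hy' e)) hne.symm,
        iff_of_false (fun e => h.no_transitive_four_cycle hbip hy hw e hy') id, ?_⟩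
      rintro rfl
      exact h.not_out hy hy' hw
    · exact ⟨iff_of_true hw rfl, iff_of_false (h.asymm _ _ hw) id, (h.ne hw).symm⟩
    · refine ⟨iff_of_false (fun e => h.not_out hy e hw) (h.ne hy),
        iff_of_false (fun e => h.not_inn e hza hwz) id, ?_⟩
      rintro rfl
      exact h.asymm _ _ hy hw
  have hA : ∀ {y y'}, D.Adj a y → D.Adj a y' → D.ConnSet ({y', y, a} : Set V) := fun hy hy' =>
    (connSet_pair (Or.inl hy)).insert (Or.inr rfl) (Or.inl hy')
  obtain ⟨β, hβ, hβw⟩ := h.hom.move h.asymm (Set.toFinite _) (hA hy₁ hy₂)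
    (fun e => (side hy₁ hy₂ hne p12 q12 hz₂ _ e).2.2 rfl)
    (fun e => (side hy₁ hy₂ hne p13 q13 hz₃ _ e).2.2 rfl)
    ⟨y₁, by simp, Or.inl p12⟩ (fun v hv => by
      have s1 := side hy₁ hy₂ hne p12 q12 hz₂ v hv
      have s2 := side hy₁ hy₂ hne p13 q13 hz₃ v hv
      exact ⟨s1.1.trans s2.1.symm, s1.2.1.trans s2.2.1.symm⟩)
  have βa : β a = a := hβ a (by simp)
  have β1 : β y₁ = y₁ := hβ y₁ (by simp)
  have β2 : β y₂ = y₂ := hβ y₂ (by simp)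
  have p21' : D.Adj y₂ (β w₂₁) := by rw [← β2]; exact β.map_rel_iff.2 p21
  have q21' : D.Adj (β w₂₁) (β z₁) := β.map_rel_iff.2 q21
  have hz₁' : D.Adj (β z₁) a := by
    have := β.map_rel_iff.2 hz₁
    rwa [βa] at this
  have nonadj' : ¬ D.Adj w₁₃ (β w₂₁) ∧ ¬ D.Adj (β w₂₁) w₁₃ := by
    rw [← hβw]
    exact ⟨fun e => nonadj.1 (β.map_rel_iff.1 e), fun e => nonadj.2 (β.map_rel_iff.1 e)⟩
  have ne13 : ∀ {w}, D.Adj y₂ w → w ≠ w₁₃ := by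
    rintro w hw rfl
    exact hne (two hy₁ p13 hy₂ hw)
  have side' : ∀ {w z}, D.Adj y₂ w → D.Adj w z → D.Adj z a → ¬ D.Adj w₁₃ w → ¬ D.Adj w w₁₃ →
      ∀ v ∈ insert w₁₃ ({y₁, y₂, a} : Set V), (D.Adj v w ↔ v = y₂) ∧ (D.Adj w v ↔ False) ∧
        w ≠ v := by
    rintro w z hw hwz hza e1 e2 v (rfl | hv)
    · refine ⟨iff_of_false e1 ?_, iff_of_false e2 id, ne13 hw⟩
      rintro rfl
      exact h.not_out hy₁ hy₂ p13
    · exact side hy₂ hy₁ hne.symm hw hwz hza v hv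
  have m1 := side' p21' q21' hz₁' nonadj'.1 nonadj'.2
  have m2 := side' p23 q23 hz₃ (h.not_inn q13 q23) (h.not_inn q23 q13)
  obtain ⟨γ, hγ, hγw⟩ := h.hom.move h.asymm (Set.toFinite _)
    ((hA hy₂ hy₁).insert (a := y₁) (by simp) (Or.inl p13))
    (fun e => (m1 _ e).2.2 rfl) (fun e => (m2 _ e).2.2 rfl)
    ⟨y₂, by simp, Or.inl p21'⟩ (fun v hv =>
      ⟨(m1 v hv).1.trans (m2 v hv).1.symm, (m1 v hv).2.1.trans (m2 v hv).2.1.symm⟩)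
  have γa : γ a = a := hγ a (by simp)
  let τ := β.trans γ
  have τa : τ a = a := by simp only [τ, RelIso.trans_apply, βa, γa]
  have τ1 : τ w₁₂ = w₁₃ := by
    simp only [τ, RelIso.trans_apply, hβw]
    exact hγ _ (by simp)
  have τ2 : τ w₂₁ = w₂₃ := hγw
  have r1 : D.Adj w₁₂ (τ.symm z₃) := by
    rw [← τ.map_rel_iff, τ1, RelIso.apply_symm_apply]
    exact q13
  have r2 : D.Adj w₂₁ (τ.symm z₃) := by
    rw [← τ.map_rel_iff, τ2, RelIso.apply_symm_apply]
    exact q23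
  have r3 : D.Adj (τ.symm z₃) a := by
    rw [← τ.map_rel_iff, τa, RelIso.apply_symm_apply]
    exact hz₃
  have i1 := uniq hy₁ p12 (fun e => h.not_inn e hz₂ q12) q12 hz₂ r1 r3
  have i2 := uniq hy₂ p21 (fun e => h.not_inn e hz₁ q21) q21 hz₁ r2 r3
  exact h21 (i1.trans i2.symm)

end IsTriangular

open scoped Classical in
/-- If the edges from `N⁺(x)` to `N⁻(x)` form a perfect matching and `k ≥ 3`, then there are no
4-cycles. -/
theorem IsTriangular.isSquareFree (h : D.IsTriangular) (hbip : D.HasBipartiteReachDigraph)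
    {k : ℕ} (hk3 : 3 ≤ k) (hk : ∀ x, (h.fin.outF x).card = k ∧ (h.fin.inF x).card = k)
    (h1 : ∀ x y, D.Adj x y → (h.fin.outF y ∩ h.fin.inF x).card = 1) : D.IsSquareFree := by
  have tri := fun x y z z' => h.triangle_unique h1 (x := x) (y := y) (z := z) (z' := z')
  have alt := fun a b v w => h.no_alternating_four_cycle hbip hk3 hk tri (a := a) (b := b)
    (v := v) (w := w)
  have many : ∀ (s : Finset V), s.card = k → ∀ e₁ e₂, ∃ p ∈ s, p ≠ e₁ ∧ p ≠ e₂ := by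
    intro s hs e₁ e₂
    have h2 := Finset.card_le_two (a := e₁) (b := e₂)
    obtain ⟨p, hp, hp'⟩ := Finset.exists_mem_notMem_of_card_lt_card
      (show ({e₁, e₂} : Finset V).card < s.card by omega)
    exact ⟨p, hp, by simpa using hp'⟩
  have in_many : ∀ x e₁ e₂, ∃ p, D.Adj p x ∧ p ≠ e₁ ∧ p ≠ e₂ := fun x e₁ e₂ => by
    simpa using many _ (hk x).2 e₁ e₂
  have two := fun {a b b' c : V} => h.no_two_paths hbip tri alt in_many (a := a) (b := b)
    (b' := b') (c := c)
  have dir := fun {a b c d : V} => h.no_directed_four_cycle hbip tri alt hk in_many (a := a)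
    (b := b) (c := c) (d := d)
  have tra := fun {a b c d : V} => h.no_transitive_four_cycle hbip (a := a) (b := b) (c := c)
    (d := d)
  refine { toIsTriangular := h, in_many := in_many,
           out_many := fun x e₁ e₂ => by simpa using many _ (hk x).1 e₁ e₂, no_square := ?_ }
  rintro a b c d (e0 | e0) (e1 | e1) (e2 | e2) (e3 | e3) hac hbd
  all_goals first
    | exact dir e0 e1 e2 e3
    | exact dir e3 e2 e1 e0
    | exact tra e0 e1 e2 e3
    | exact tra e3 e0 e1 e2
    | exact tra e2 e3 e0 e1
    | exact tra e1 e2 e3 e0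
    | exact tra e2 e1 e0 e3
    | exact tra e1 e0 e3 e2
    | exact tra e0 e3 e2 e1
    | exact tra e3 e2 e1 e0
    | exact hbd (two e0 e1 e3 e2)
    | exact hbd (two e1 e0 e2 e3)
    | exact hac (two e0 e3 e1 e2)
    | exact hac (two e3 e0 e2 e1)
    | exact hbd (alt _ _ _ _ hac e0 e1 e3 e2)
    | exact hac (alt _ _ _ _ hbd e0 e3 e1 e2)

end SquareFree


/-! ### Reduced walks -/

section Reduced

variable {V : Type*} {D : Digraph V}

/-- A walk `r 0, …, r n` in the underlying undirected graph in which vertices at distance two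
along the walk are distinct and not adjacent. -/
def Reduced (D : Digraph V) (n : ℕ) (r : ℕ → V) : Prop :=
  (∀ i < n, D.Link (r i) (r (i + 1))) ∧
    ∀ i, i + 2 ≤ n → r i ≠ r (i + 2) ∧ ¬ D.Link (r i) (r (i + 2))

/-- The edges `rp` and `rp'` exist and are directed in the same way with respect to `r`. -/
def SameDir (D : Digraph V) (r p p' : V) : Prop :=
  (D.Adj r p ∧ D.Adj r p') ∨ (D.Adj p r ∧ D.Adj p' r)

theorem SameDir.left {r p p' : V} (h : D.SameDir r p p') : D.Link r p :=
  h.imp And.left And.left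

theorem SameDir.right {r p p' : V} (h : D.SameDir r p p') : D.Link r p' :=
  h.imp And.right And.right

theorem SameDir.symm {r p p' : V} (h : D.SameDir r p p') : D.SameDir r p' p :=
  h.imp And.symm And.symm

theorem Link.map (α : D.Adj ≃r D.Adj) {a b : V} (h : D.Link a b) : D.Link (α a) (α b) :=
  h.imp α.map_rel_iff.2 α.map_rel_iff.2

theorem Link.of_map (α : D.Adj ≃r D.Adj) {a b : V} (h : D.Link (α a) (α b)) : D.Link a b :=
  h.imp α.map_rel_iff.1 α.map_rel_iff.1

/-- The image of an edge under an automorphism fixing one of its ends. -/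
theorem Link.sameDir_map (α : D.Adj ≃r D.Adj) {a b : V} (h : D.Link a b) (ha : α a = a) :
    D.SameDir a b (α b) := by
  rcases h with h | h
  · have := α.map_rel_iff.2 h
    rw [ha] at this
    exact Or.inl ⟨h, this⟩
  · have := α.map_rel_iff.2 h
    rw [ha] at this
    exact Or.inr ⟨h, this⟩

theorem Reduced.mono {n m : ℕ} {r : ℕ → V} (h : D.Reduced n r) (hm : m ≤ n) : D.Reduced m r :=
  ⟨fun i hi => h.1 i (by omega), fun i hi => h.2 i (by omega)⟩

theorem Reduced.shift {n m i : ℕ} {r : ℕ → V} (h : D.Reduced n r) (hm : i + m ≤ n) :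
    D.Reduced m (fun j => r (i + j)) :=
  ⟨fun j hj => h.1 (i + j) (by omega), fun j hj => h.2 (i + j) (by omega)⟩

/-- The sequence `r` up to index `n`, continued by `c`. -/
def snocSeq (n : ℕ) (r : ℕ → V) (c : V) : ℕ → V := fun i => if i ≤ n then r i else c

theorem snocSeq_of_le {n i : ℕ} (r : ℕ → V) (c : V) (hi : i ≤ n) : snocSeq n r c i = r i :=
  if_pos hi

theorem snocSeq_succ (n : ℕ) (r : ℕ → V) (c : V) : snocSeq n r c (n + 1) = c :=
  if_neg (by omega)

theorem Reduced.snoc {n : ℕ} {r : ℕ → V} {c : V} (h : D.Reduced n r) (hl : D.Link (r n) c)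
    (hc : ∀ i, i + 1 = n → r i ≠ c ∧ ¬ D.Link (r i) c) :
    D.Reduced (n + 1) (snocSeq n r c) := by
  refine ⟨fun i hi => ?_, fun i hi => ?_⟩
  · rw [snocSeq_of_le r c (show i ≤ n by omega)]
    rcases Nat.lt_succ_iff_lt_or_eq.1 hi with hi' | rfl
    · rw [snocSeq_of_le r c (show i + 1 ≤ n by omega)]
      exact h.1 i hi'
    · rw [snocSeq_succ]
      exact hl
  · rw [snocSeq_of_le r c (show i ≤ n by omega)]
    by_cases hi' : i + 2 ≤ n
    · rw [snocSeq_of_le r c hi']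
      exact h.2 i hi'
    · obtain rfl : n = i + 1 := by omega
      rw [snocSeq_succ]
      exact hc i rfl

/-- The sequence `r` preceded by `b`. -/
def consSeq (b : V) (r : ℕ → V) : ℕ → V
  | 0 => b
  | i + 1 => r i

theorem Reduced.cons {n : ℕ} {r : ℕ → V} {b : V} (h : D.Reduced n r) (hl : D.Link b (r 0))
    (hb : 1 ≤ n → b ≠ r 1 ∧ ¬ D.Link b (r 1)) : D.Reduced (n + 1) (consSeq b r) := by
  refine ⟨fun i hi => ?_, fun i hi => ?_⟩
  · cases i with
    | zero => exact hl
    | succ i => exact h.1 i (by omega)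
  · cases i with
    | zero => exact hb (by omega)
    | succ i => exact h.2 i (by omega)

theorem connSet_walk {n : ℕ} {r : ℕ → V} (h : ∀ i < n, D.Link (r i) (r (i + 1))) :
    D.ConnSet (r '' Set.Iic n) := by
  induction n with
  | zero =>
    have : r '' Set.Iic 0 = {r 0} := by
      ext v
      simp [eq_comm]
    rw [this]
    exact connSet_singleton _
  | succ n ih =>
    have : r '' Set.Iic (n + 1) = insert (r (n + 1)) (r '' Set.Iic n) := by
      rw [← Set.image_insert_eq]
      congr 1
      ext i
      simp only [Set.mem_Iic, Set.mem_insert_iff]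
      omega
    rw [this]
    exact (ih fun i hi => h i (by omega)).insert ⟨n, Set.mem_Iic.2 le_rfl, rfl⟩ (h n (by omega))

namespace IsSquareFree

variable (h : D.IsSquareFree)

include h

theorem link_ne {a b : V} (hab : D.Link a b) : a ≠ b := by
  rintro rfl
  exact hab.elim (h.irrefl a) (h.irrefl a)

theorem sameDir_not_link {r p p' : V} (hs : D.SameDir r p p') : ¬ D.Link p p' := by
  rintro (e | e)
  · rcases hs with hs | hs
    · exact h.not_out hs.1 hs.2 e
    · exact h.not_inn hs.1 hs.2 e
  · rcases hs with hs | hs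
    · exact h.not_out hs.2 hs.1 e
    · exact h.not_inn hs.2 hs.1 e

/-- Every edge lies in only one triangle of the underlying undirected graph. -/
theorem link_triangle_unique {a b c d : V} (hab : D.Link a b) (hac : D.Link a c)
    (hbc : D.Link b c) (had : D.Link a d) (hbd : D.Link b d) : c = d := by
  by_contra hcd
  exact h.no_square a c b d hac hbc.symm hbd had.symm (h.link_ne hab) hcd

theorem path_ends {a b c d : V} (hab : D.Link a b) (hbc : D.Link b c) (hcd : D.Link c d)
    (hac : a ≠ c) (hbd : b ≠ d) (hac' : ¬ D.Link a c) : a ≠ d ∧ ¬ D.Link a d := by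
  refine ⟨?_, fun e => h.no_square a b c d hab hbc hcd e.symm hac hbd⟩
  rintro rfl
  exact hac' hcd.symm

/-- At a vertex `r` with neighbours `q` and `p`, the edge `rp` can be replaced by another edge of
the same direction that does not lie in a triangle with `rq`. -/
theorem exists_sameDir {r q p : V} (hrq : D.Link r q) (hrp : D.Link r p) :
    ∃ p', p' ≠ p ∧ D.SameDir r p p' ∧ q ≠ p' ∧ ¬ D.Link q p' := by
  -- `e` is the only neighbour of `r` of the relevant direction that is equal or adjacent to `q`.
  have key : ∀ {e}, (∀ p', D.SameDir r p p' → p' ≠ e → q ≠ p' ∧ ¬ D.Link q p') →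
      ∃ p', p' ≠ p ∧ D.SameDir r p p' ∧ q ≠ p' ∧ ¬ D.Link q p' := by
    intro e he
    rcases hrp with hp | hp
    · obtain ⟨p', h1, h2, h3⟩ := h.out_many r p e
      exact ⟨p', h2, Or.inl ⟨hp, h1⟩, he p' (Or.inl ⟨hp, h1⟩) h3⟩
    · obtain ⟨p', h1, h2, h3⟩ := h.in_many r p e
      exact ⟨p', h2, Or.inr ⟨hp, h1⟩, he p' (Or.inr ⟨hp, h1⟩) h3⟩
  by_cases hs : D.SameDir r q p
  · refine key (e := q) fun p' hp' hne => ⟨hne.symm, h.sameDir_not_link (r := r) ?_⟩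
    rcases hs with hs | hs <;> rcases hp' with hp' | hp'
    · exact Or.inl ⟨hs.1, hp'.2⟩
    · exact (h.asymm _ _ hs.2 hp'.1).elim
    · exact (h.asymm _ _ hs.2 hp'.1).elim
    · exact Or.inr ⟨hs.1, hp'.2⟩
  · have hq : ∀ p', D.SameDir r p p' → q ≠ p' := by
      rintro p' hp' rfl
      exact hs hp'.symm
    obtain ⟨e, hqe, hre⟩ : ∃ e, D.Link q e ∧ D.Link r e := by
      rcases hrq with hrq | hrq
      · obtain ⟨e, h1, h2⟩ := h.exists_triangle hrq
        exact ⟨e, Or.inl h1, Or.inr h2⟩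
      · obtain ⟨e, h1, h2⟩ := h.exists_triangle hrq
        exact ⟨e, Or.inr h2, Or.inl h1⟩
    exact key (e := e) fun p' hp' hne =>
      ⟨hq p' hp', fun hl => hne (h.link_triangle_unique hrq hp'.right hl hre hqe)⟩

/-- C-homogeneity for two vertices that are attached to a connected set in the same way. -/
theorem move {A : Set V} (hfin : A.Finite) (hA : D.ConnSet A) {u v : V}
    (hl : ∃ a ∈ A, D.Link a u)
    (huv : ∀ a ∈ A, D.SameDir a u v ∨
      ((a ≠ u ∧ ¬ D.Link a u) ∧ (a ≠ v ∧ ¬ D.Link a v))) :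
    ∃ α : D.Adj ≃r D.Adj, (∀ a ∈ A, α a = a) ∧ α u = v := by
  refine h.hom.move h.asymm hfin hA ?_ ?_ hl fun a ha => ?_
  · intro hu
    rcases huv u hu with hs | hs
    · exact h.link_ne hs.left rfl
    · exact hs.1.1 rfl
  · intro hv
    rcases huv v hv with hs | hs
    · exact h.link_ne hs.right rfl
    · exact hs.2.1 rfl
  · rcases huv a ha with (hs | hs) | hs
    · exact ⟨iff_of_true hs.1 hs.2, iff_of_false (h.asymm _ _ hs.1) (h.asymm _ _ hs.2)⟩
    · exact ⟨iff_of_false (h.asymm _ _ hs.1) (h.asymm _ _ hs.2), iff_of_true hs.1 hs.2⟩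
    · exact ⟨iff_of_false (fun e => hs.1.2 (Or.inl e)) (fun e => hs.2.2 (Or.inl e)),
        iff_of_false (fun e => hs.1.2 (Or.inr e)) (fun e => hs.2.2 (Or.inr e))⟩

/-- Automorphisms exchange two edges of the same direction at `r`. -/
theorem exists_exchange {r p p' : V} (hne : p ≠ p') (hs : D.SameDir r p p') :
    ∃ σ : D.Adj ≃r D.Adj, σ r = r ∧ σ p = p' ∧ σ p' = p := by
  rcases hs with hs | hs
  · exact h.out_star_transitive hs.1 hs.2 hne hs.2 hs.1 hne.symm
  · exact h.in_star_transitive hs.1 hs.2 hne hs.2 hs.1 hne.symm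

/-- A symmetric path `a, p, r, p', a'` does not close up to a 5-cycle: reflecting it would yield
two neighbours of `p` that are adjacent to `a'`. -/
theorem not_link_of_symmetric {a p r p' a' : V} (hne : p ≠ p') (hs : D.SameDir r p p')
    (ha : (D.Adj p a ∧ D.Adj p' a') ∨ (D.Adj a p ∧ D.Adj a' p'))
    (hra : r ≠ a) (hra' : r ≠ a') (nra : ¬ D.Link r a) (nra' : ¬ D.Link r a') :
    ¬ D.Link a a' := by
  intro haa
  have hpa : D.Link p a := ha.imp And.left And.left
  have hpa' : D.Link p' a' := ha.imp And.right And.right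
  have npp : ¬ D.Link p p' := h.sameDir_not_link hs
  obtain ⟨σ, σr, σp, σp'⟩ := h.exists_exchange hne hs
  have hσa : D.SameDir p' (σ a) a' := by
    rcases ha with ha | ha
    · refine Or.inl ⟨?_, ha.2⟩
      rw [← σp]
      exact σ.map_rel_iff.2 ha.1
    · refine Or.inr ⟨?_, ha.2⟩
      rw [← σp]
      exact σ.map_rel_iff.2 ha.1
  have rσa : r ≠ σ a := fun e => hra (σ.injective (σr.trans e))
  have nrσa : ¬ D.Link r (σ a) := fun e => nra (Link.of_map σ (by rwa [σr]))
  have hA : D.ConnSet ({p', p, r} : Set V) :=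
    (connSet_pair hs.left).insert (Or.inr rfl) hs.right
  have far : ∀ {x}, r ≠ x → ¬ D.Link r x → D.Link p' x → p ≠ x ∧ ¬ D.Link p x :=
    fun hrx _ hx => h.path_ends hs.left.symm hs.right hx hne hrx npp
  obtain ⟨β, hβ, hβa⟩ := h.move (Set.toFinite _) hA (u := σ a) (v := a')
    ⟨p', by simp, hσa.left⟩ (by
      rintro x (rfl | rfl | rfl)
      · exact Or.inl hσa
      · exact Or.inr ⟨far rσa nrσa hσa.left, far hra' nra' hpa'⟩
      · exact Or.inr ⟨⟨rσa, nrσa⟩, ⟨hra', nra'⟩⟩)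
  let ρ := σ.trans β
  have ρp' : ρ p' = p := by
    simp only [ρ, RelIso.trans_apply, σp']
    exact hβ p (by simp)
  have ρa : ρ a = a' := hβa
  have hs' : D.SameDir p a (ρ a') := by
    rcases ha with ha | ha
    · refine Or.inl ⟨ha.1, ?_⟩
      rw [← ρp']
      exact ρ.map_rel_iff.2 ha.2
    · refine Or.inr ⟨ha.1, ?_⟩
      rw [← ρp']
      exact ρ.map_rel_iff.2 ha.2
  have hne' : a ≠ ρ a' := by
    intro e
    rcases haa with haa | haa
    · have := ρ.map_rel_iff.2 haa
      rw [ρa, ← e] at this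
      exact h.asymm _ _ haa this
    · have := ρ.map_rel_iff.2 haa
      rw [ρa, ← e] at this
      exact h.asymm _ _ haa this
  have hl : D.Link a' (ρ a') := by
    have := haa.map ρ
    rwa [ρa] at this
  exact h.no_square a' a p (ρ a') haa.symm hpa.symm hs'.right hl.symm
    (far hra' nra' hpa').1.symm hne'

/-- A reduced walk of length at least four does not close up, if no shorter one does. -/
theorem not_link_ends_step {s : ℕ}
    (ih : ∀ m, 2 ≤ m → m < s + 4 → ∀ r, D.Reduced m r → r 0 ≠ r m ∧ ¬ D.Link (r 0) (r m))
    {v : ℕ → V} (hv : D.Reduced (s + 4) v) : ¬ D.Link (v 0) (v (s + 4)) := by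
  intro hclose
  have far : ∀ {n : ℕ} {r : ℕ → V}, D.Reduced n r → ∀ i j, i + 2 ≤ j → j ≤ n → j < i + (s + 4) →
      r i ≠ r j ∧ ¬ D.Link (r i) (r j) := by
    intro n r hr i j h1 h2 h3
    have := ih (j - i) (by omega) (by omega) _ (hr.shift (i := i) (m := j - i) (by omega))
    rwa [Nat.add_zero, Nat.add_sub_cancel' (by omega)] at this
  have l1 := hv.1 s (by omega)
  have l2 := hv.1 (s + 1) (by omega)
  have l3 := hv.1 (s + 2) (by omega)
  have l4 := hv.1 (s + 3) (by omega)
  -- `p' ≠ v (s + 2)` is another continuation of `v 0, …, v (s + 1)`.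
  obtain ⟨p', hpne, hps, hqp, hqp'⟩ := h.exists_sameDir l1.symm l2
  have W : D.Reduced (s + 2) (snocSeq (s + 1) v p') := by
    refine (hv.mono (by omega)).snoc hps.right fun i hi => ?_
    obtain rfl : i = s := by omega
    exact ⟨hqp, hqp'⟩
  have W0 : snocSeq (s + 1) v p' 0 = v 0 := snocSeq_of_le v p' (by omega)
  have W1 : snocSeq (s + 1) v p' 1 = v 1 := snocSeq_of_le v p' (by omega)
  have Wp : snocSeq (s + 1) v p' (s + 2) = p' := snocSeq_succ _ _ _
  have pfar : ∀ i, i ≤ s → v i ≠ p' ∧ ¬ D.Link (v i) p' := by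
    intro i hi
    have := far W i (s + 2) (by omega) le_rfl (by omega)
    rwa [Wp, snocSeq_of_le v p' (show i ≤ s + 1 by omega)] at this
  have bp : v (s + 4) ≠ p' ∧ ¬ D.Link (v (s + 4)) p' := by
    have h1 := far hv 1 (s + 4) (by omega) le_rfl (by omega)
    have C : D.Reduced (s + 3) (consSeq (v (s + 4)) (snocSeq (s + 1) v p')) := by
      refine W.cons ?_ fun _ => ?_
      · rw [W0]; exact hclose.symm
      · rw [W1]; exact ⟨h1.1.symm, fun e => h1.2 e.symm⟩
    have := far C 0 (s + 3) (by omega) le_rfl (by omega)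
    rwa [show consSeq (v (s + 4)) (snocSeq (s + 1) v p') (s + 3) =
      snocSeq (s + 1) v p' (s + 2) from rfl, Wp] at this
  have hP : D.ConnSet (v '' Set.Iic (s + 1)) := connSet_walk fun i hi => hv.1 i (by omega)
  have hPfin : (v '' Set.Iic (s + 1)).Finite := (Set.finite_Iic _).image v
  have memP : ∀ i, i ≤ s + 1 → v i ∈ v '' Set.Iic (s + 1) := fun i hi => ⟨i, hi, rfl⟩
  obtain ⟨α, hα, hαp⟩ := h.move (hPfin.insert (v (s + 4)))
    (hP.insert (memP 0 (by omega)) hclose) (u := v (s + 2)) (v := p')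
    ⟨v (s + 1), Or.inr (memP _ le_rfl), l2⟩ (by
      rintro x (rfl | ⟨i, hi, rfl⟩)
      · have := far hv (s + 2) (s + 4) le_rfl le_rfl (by omega)
        exact Or.inr ⟨⟨this.1.symm, fun e => this.2 e.symm⟩, bp⟩
      · rcases Nat.lt_or_ge s i with hi' | hi'
        · obtain rfl : i = s + 1 := le_antisymm hi hi'
          exact Or.inl hps
        · exact Or.inr ⟨far hv i (s + 2) (by omega) (by omega) (by omega), pfar i hi'⟩)
  have αb : α (v (s + 4)) = v (s + 4) := hα _ (Or.inl rfl)
  have αr : α (v (s + 1)) = v (s + 1) := hα _ (Or.inr (memP _ le_rfl))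
  have hra := far hv (s + 1) (s + 3) le_rfl (by omega) (by omega)
  obtain ⟨a₁, ha₁⟩ : ∃ a₁, a₁ = α (v (s + 3)) := ⟨_, rfl⟩
  have hdir : (D.Adj (v (s + 2)) (v (s + 3)) ∧ D.Adj p' a₁) ∨
      (D.Adj (v (s + 3)) (v (s + 2)) ∧ D.Adj a₁ p') := by
    rw [ha₁, ← hαp]
    exact l3.imp (fun e => ⟨e, α.map_rel_iff.2 e⟩) (fun e => ⟨e, α.map_rel_iff.2 e⟩)
  have hpa₁ : D.Link p' a₁ := hdir.imp And.right And.right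
  have hba₁ : D.Link (v (s + 4)) a₁ := by
    rw [ha₁, ← αb]
    exact l4.symm.map α
  have hra₁ : v (s + 1) ≠ a₁ ∧ ¬ D.Link (v (s + 1)) a₁ := by
    rw [ha₁]
    exact ⟨fun e => hra.1 (α.injective (αr.trans e)), fun e => hra.2 (Link.of_map α (by rwa [αr]))⟩
  -- `a₂` is another continuation of `v 0, …, v (s + 1), p'` besides `a₁`.
  obtain ⟨a₂, hane, has, hra₂, nra₂⟩ := h.exists_sameDir hps.right.symm hpa₁
  have hdir₂ : (D.Adj (v (s + 2)) (v (s + 3)) ∧ D.Adj p' a₂) ∨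
      (D.Adj (v (s + 3)) (v (s + 2)) ∧ D.Adj a₂ p') := by
    rcases hdir with hd | hd <;> rcases has with hs | hs
    · exact Or.inl ⟨hd.1, hs.2⟩
    · exact (h.asymm _ _ hd.2 hs.1).elim
    · exact (h.asymm _ _ hd.2 hs.1).elim
    · exact Or.inr ⟨hd.1, hs.2⟩
  have npp := h.sameDir_not_link hps
  have ap' := h.path_ends l3.symm l2.symm hps.right hra.1.symm hpne.symm (fun e => hra.2 e.symm)
  have side : ∀ {x}, D.Link p' x → v (s + 1) ≠ x → ¬ D.Link (v (s + 1)) x →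
      ¬ D.Link (v (s + 3)) x →
      ∀ y ∈ insert (v (s + 3)) (insert (v (s + 2)) (v '' Set.Iic (s + 1))),
        y ≠ x ∧ ¬ D.Link y x := by
    intro x hx hrx hrx' hax y hy
    rcases hy with rfl | rfl | ⟨i, hi, rfl⟩
    · refine ⟨?_, hax⟩
      rintro rfl
      exact ap'.2 hx.symm
    · exact h.path_ends l2.symm hps.right hx hpne.symm hrx npp
    · have W' : D.Reduced (s + 3) (snocSeq (s + 2) (snocSeq (s + 1) v p') x) := by
        refine W.snoc (by rwa [Wp]) fun j hj => ?_
        obtain rfl : j = s + 1 := by omega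
        rw [snocSeq_of_le v p' le_rfl]
        exact ⟨hrx, hrx'⟩
      have hi : i ≤ s + 1 := hi
      have := far W' i (s + 3) (by omega) le_rfl (by omega)
      rwa [snocSeq_succ, snocSeq_of_le _ x (show i ≤ s + 2 by omega),
        snocSeq_of_le v p' hi] at this
  have side₁ := side hpa₁ hra₁.1 hra₁.2
    (h.not_link_of_symmetric hpne.symm hps hdir hra.1 hra₁.1 hra.2 hra₁.2)
  have side₂ := side has.right hra₂ nra₂
    (h.not_link_of_symmetric hpne.symm hps hdir₂ hra.1 hra₂ hra.2 nra₂)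
  obtain ⟨β, hβ, hβa⟩ := h.move
    (((hPfin.insert (v (s + 2))).insert (v (s + 3))).insert p')
    (((hP.insert (memP _ le_rfl) l2).insert (Or.inl rfl) l3).insert
      (Or.inr (Or.inr (memP _ le_rfl))) hps.right) (u := a₁) (v := a₂)
    ⟨p', Or.inl rfl, hpa₁⟩ (by
      rintro x (rfl | hx)
      · exact Or.inl has
      · exact Or.inr ⟨side₁ x hx, side₂ x hx⟩)
  have β0 : β (v 0) = v 0 := hβ _ (Or.inr (Or.inr (Or.inr (memP 0 (by omega)))))
  have βa : β (v (s + 3)) = v (s + 3) := hβ _ (Or.inr (Or.inl rfl))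
  have hb0 := hclose.sameDir_map β β0
  have hb1 := l4.sameDir_map β βa
  by_cases e : v (s + 4) = β (v (s + 4))
  · -- The vertex `v (s + 4)` is adjacent to both `a₁` and `a₂`.
    have h1 := hba₁.map β
    rw [← e, hβa] at h1
    exact h.no_square (v (s + 4)) a₁ p' a₂ hba₁ hpa₁.symm has.right h1.symm bp.1 hane.symm
  · -- The vertices `v 0` and `v (s + 3)` have two common neighbours.
    exact h.no_square (v (s + 4)) (v 0) (β (v (s + 4))) (v (s + 3)) hclose.symm hb0.right
      hb1.right.symm l4 e (far hv 0 (s + 3) (by omega) (by omega) (by omega)).1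

/-- Reduced walks are induced paths. -/
theorem reduced_ends : ∀ n, 2 ≤ n → ∀ r, D.Reduced n r →
    r 0 ≠ r n ∧ ¬ D.Link (r 0) (r n) := by
  intro n
  induction n using Nat.strong_induction_on with
  | _ n ih =>
    intro hn r hr
    match n, hn, ih, hr with
    | 2, _, _, hr => exact hr.2 0 le_rfl
    | 3, _, _, hr =>
      have h0 := hr.2 0 (by omega)
      exact h.path_ends (hr.1 0 (by omega)) (hr.1 1 (by omega)) (hr.1 2 (by omega)) h0.1
        (hr.2 1 (by omega)).1 h0.2
    | s + 4, _, ih, hr =>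
      refine ⟨fun e => ?_, h.not_link_ends_step (fun m h2 hm => ih m hm h2) hr⟩
      have h1 := ih (s + 3) (by omega) (by omega) r (hr.mono (by omega))
      have h2 := hr.1 (s + 3) (by omega)
      rw [← e] at h2
      exact h1.2 h2.symm

/-! ### Two ends -/

theorem exists_reduced_ray {x y : V} (hxy : D.Link x y) :
    ∃ r : ℕ → V, r 0 = x ∧ r 1 = y ∧ ∀ n, D.Reduced n r := by
  have next : ∀ p : {p : V × V // D.Link p.1 p.2},
      ∃ q : {p : V × V // D.Link p.1 p.2}, q.1.1 = p.1.2 ∧ p.1.1 ≠ q.1.2 ∧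
        ¬ D.Link p.1.1 q.1.2 := by
    rintro ⟨⟨a, b⟩, hab⟩
    obtain ⟨c, -, hs, h1, h2⟩ := h.exists_sameDir hab.symm hab.symm
    exact ⟨⟨(b, c), hs.right⟩, rfl, h1, h2⟩
  choose f f1 f2 f3 using next
  let e : ℕ → {p : V × V // D.Link p.1 p.2} := fun n => Nat.rec ⟨(x, y), hxy⟩ (fun _ p => f p) n
  have e1 : ∀ n, (e (n + 1)).1.1 = (e n).1.2 := fun n => f1 (e n)
  refine ⟨fun n => (e n).1.1, rfl, e1 0, fun n => ⟨fun i _ => ?_, fun i _ => ?_⟩⟩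
  · simp only [e1]
    exact (e i).2
  · have : (e (i + 2)).1.1 = (f (e i)).1.2 := e1 (i + 1)
    simp only [this]
    exact ⟨f2 _, f3 _⟩

/-- Deleting a vertex separates reduced rays that leave it along different triangles. -/
theorem hasAtLeastTwoEnds : D.HasAtLeastTwoEnds := by
  obtain ⟨x, -, -, -⟩ := h.exists_tri
  obtain ⟨y₁, hy₁, -, -⟩ := h.out_many x x x
  obtain ⟨y₂, hy₂, hne, -⟩ := h.out_many x y₁ y₁
  have ray : ∀ r : ℕ → V, (∀ n, D.Reduced n r) →
      ∃ ρ : GraphRay D.toSimpleGraphInclusive, ρ.vert = r := by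
    intro r hr
    have hlink : ∀ n, D.Link (r n) (r (n + 1)) := fun n => (hr (n + 1)).1 n (by omega)
    have hlt : ∀ i j, i < j → r i ≠ r j := by
      intro i j hij
      rcases Nat.lt_or_ge (i + 1) j with h1 | h1
      · have := (h.reduced_ends (j - i) (by omega) _
          ((hr j).shift (i := i) (m := j - i) (by omega))).1
        rwa [Nat.add_zero, Nat.add_sub_cancel' (by omega)] at this
      · obtain rfl : j = i + 1 := by omega
        exact h.link_ne (hlink i)
    refine ⟨⟨r, fun i j hij => ?_, fun n => ⟨h.link_ne (hlink n), hlink n⟩⟩, rfl⟩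
    rcases lt_trichotomy i j with h1 | h1 | h1
    · exact absurd hij (hlt i j h1)
    · exact h1
    · exact absurd hij.symm (hlt j i h1)
  obtain ⟨r, r0, r1, hr⟩ := h.exists_reduced_ray (Or.inl hy₁)
  obtain ⟨s, s0, s1, hs⟩ := h.exists_reduced_ray (Or.inl hy₂)
  obtain ⟨ρ, hρ⟩ := ray r hr
  obtain ⟨σ, hσ⟩ := ray s hs
  refine ⟨⟨Quotient.mk (GraphRay.setoid _) ρ, Quotient.mk (GraphRay.setoid _) σ, fun e => ?_⟩⟩
  have heq : ρ.Equivalent σ := Quotient.exact e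
  obtain ⟨C, ⟨N, hN⟩, ⟨M, hM⟩⟩ := heq {x} (Set.finite_singleton x)
  rw [hρ] at hN
  rw [hσ] at hM
  -- `B` consists of the ends of the reduced walks that start at `x` in the triangle on `xy₁`.
  let B : V → Prop := fun v => ∃ m w, D.Reduced (m + 1) w ∧ w 0 = x ∧
    (w 1 = y₁ ∨ D.Link y₁ (w 1)) ∧ w (m + 1) = v
  have hB : ∀ v v', B v → D.Link v v' → v' ≠ x → B v' := by
    rintro v v' ⟨m, w, hw, w0, w1, rfl⟩ hl hx
    have hwl := hw.1 m (by omega)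
    by_cases e1 : w m = v'
    · cases m with
      | zero => exact absurd (e1.symm.trans w0) hx
      | succ m => exact ⟨m, w, hw.mono (by omega), w0, w1, e1⟩
    by_cases e2 : D.Link (w m) v'
    · cases m with
      | zero =>
        rw [w0] at e2 hwl
        refine ⟨0, consSeq x (fun _ => v'), ⟨fun i hi => ?_, fun i hi => by omega⟩, rfl, ?_, rfl⟩
        · obtain rfl : i = 0 := by omega
          exact e2
        · change v' = y₁ ∨ D.Link y₁ v'
          rcases w1 with w1 | w1
          · rw [← w1]; exact Or.inr hl
          · exact Or.inl (h.link_triangle_unique hwl e2 hl (Or.inl hy₁) w1.symm)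
      | succ m =>
        have h2 := hw.2 m (by omega)
        refine ⟨m + 1, snocSeq (m + 1) w v', (hw.mono (by omega)).snoc e2 fun i hi => ?_, ?_, ?_,
          snocSeq_succ _ _ _⟩
        · obtain rfl : i = m := by omega
          have h3 := hw.1 i (by omega)
          refine ⟨?_, fun e3 => ?_⟩
          · rintro rfl
            exact h2.2 hl.symm
          · exact h2.1 (h.link_triangle_unique e2 h3.symm e3.symm hwl hl.symm)
        · rw [snocSeq_of_le w v' (by omega)]; exact w0
        · rw [snocSeq_of_le w v' (by omega)]; exact w1
    · refine ⟨m + 1, snocSeq (m + 1) w v', hw.snoc hl fun i hi => ?_, ?_, ?_,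
        snocSeq_succ _ _ _⟩
      · obtain rfl : i = m := by omega
        exact ⟨e1, e2⟩
      · rw [snocSeq_of_le w v' (by omega)]; exact w0
      · rw [snocSeq_of_le w v' (by omega)]; exact w1
  have hreach : ∀ a b : ({x}ᶜ : Set V),
      (D.toSimpleGraphInclusive.induce {x}ᶜ).Reachable a b → B a → B b := by
    rintro a b ⟨w⟩
    induction w with
    | nil => exact id
    | @cons a b c hadj _ ih => exact fun ha => ih (hB _ _ ha hadj.2 b.2)
  have back : ∀ n, B (s (n + 1)) → B (s 1) := by
    intro n
    induction n with
    | zero => exact id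
    | succ n ih =>
      intro hn
      refine ih (hB _ _ hn ((hs (n + 2)).1 (n + 1) (by omega)).symm ?_)
      rw [← s0]
      rcases Nat.eq_zero_or_pos n with rfl | hn'
      · exact (h.link_ne ((hs 1).1 0 (by omega))).symm
      · exact (h.reduced_ends (n + 1) (by omega) s (hs _)).1.symm
  obtain ⟨m1, c1⟩ := hN (N + 1) (by omega)
  obtain ⟨m2, c2⟩ := hM (M + 1) (by omega)
  have hBr : B (r (N + 1)) := ⟨N, r, hr _, r0, Or.inl r1, rfl⟩
  have hBs := back M (hreach ⟨_, m1⟩ ⟨_, m2⟩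
    (SimpleGraph.ConnectedComponent.exact (c1.trans c2.symm)) hBr)
  rw [s1] at hBs
  obtain ⟨m, w, hw, w0, w1, w2⟩ := hBs
  rcases Nat.eq_zero_or_pos m with rfl | hm
  · rw [Nat.zero_add] at w2
    rw [w2] at w1
    rcases w1 with w1 | w1 | w1
    · exact hne w1
    · exact h.not_out hy₁ hy₂ w1
    · exact h.not_out hy₂ hy₁ w1
  · have := (h.reduced_ends (m + 1) (by omega) w hw).2
    rw [w0, w2] at this
    exact this (Or.inl hy₂)

end IsSquareFree

end Reduced

end Digraph

theorem lemma4p13 {V : Type*} (D : Digraph V)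
    (hasymm : D.IsAsymmetric)
    (hfin : D.IsLocallyFinite)
    (hconn : D.IsConnected)
    (hhom : D.IsCHomogeneous)
    (htri : Nonempty ((Digraph.directedCycle 3).Adj ↪r D.Adj))
    (hout : ∀ x, D.IsIndependent (D.outNbhd x))
    (hin : ∀ x, D.IsIndependent (D.inNbhd x))
    (hbip : D.HasBipartiteReachDigraph) :
    D.HasAtLeastTwoEnds ∨
    (∃ k : ℕ, 1 ≤ k ∧ D.ReachDigraphIso (Digraph.completeBipartiteDigraph k k) ∧
      D.IsIsomorphic ((Digraph.directedCycle 3).lexProduct (Digraph.emptyDigraph (Fin k)))) ∨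
    (∃ k : ℕ, 3 ≤ k ∧ D.ReachDigraphIso (Digraph.complementPerfectMatching k) ∧
      D.IsIsomorphic (Digraph.tripartiteY k)) ∨
    ((∃ m : ℕ, 2 ≤ m ∧ D.ReachDigraphIso (Digraph.alternatingCycle m)) ∨
      D.ReachDigraphIso Digraph.alternatingDoubleRay) := by
  classical
  obtain ⟨φ⟩ := htri
  have h : D.IsTriangular := by
    refine ⟨hasymm, hfin, hconn, hhom, hout, hin, φ 0, φ 1, φ 2, ?_, ?_, ?_⟩ <;>
      exact φ.map_rel_iff.2 rfl
  obtain ⟨k, t, ht, hk, htri⟩ := h.exists_degrees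
  obtain ⟨x, y, -, hxy, -, -⟩ := h.exists_tri
  have htk : t ≤ k := by
    rw [← htri x y hxy, ← (hk y).1]
    exact Finset.card_le_card Finset.inter_subset_left
  by_cases e1 : t = k
  · subst e1
    have hiso := h.lexProduct_iso hk htri
    exact Or.inr (Or.inl ⟨t, ht, Digraph.reachDigraphIso_completeBipartite hasymm hiso, hiso⟩)
  by_cases e2 : k = 2
  · subst e2
    exact Or.inr (Or.inr (Or.inr
      (Digraph.reachDigraphIso_of_two_regular h.fin hasymm hbip hk h.arc_transitive hxy)))
  rcases h.triangle_number ht hk htri with rfl | hc | hc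
  · exact Or.inl (h.isSquareFree hbip (by omega) hk htri).hasAtLeastTwoEnds
  · have hiso := h.tripartiteY_iso hbip (by omega) hk fun x y hxy => by rw [htri x y hxy, hc]
    exact Or.inr (Or.inr (Or.inl ⟨k + 1, by omega,
      Digraph.reachDigraphIso_complementPerfectMatching hasymm (by omega) hiso, hiso⟩))
  · exact absurd hc e1
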